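/- Let $\kappa\in(0,1)$, $q=q_N=N^{\kappa}$, and let $c,C>0$ be constants. For every (large) $N$ let $S=(s_{ij})$ be an $N\times N$ matrix with $s_{ij}\in[c/N,\,C/N]$ (no low-rank condition), and let $H=(h_{ij})$ be a real symmetric $N\times N$ random matrix whose entries $h_{ij}$, $i\le j$, are independent and whose law is, for all entries, one of the following: (unbiased) $\mathbb P[h_{ij}=\pm q^{-1/2}]=\tfrac12 q s_{ij}$ and $\mathbb P[h_{ij}=0]=1-q s_{ij}$; (biased) $h_{ij}=a_{ij}-\mathbb E a_{ij}$ with $\mathbb P[a_{ij}=q^{-1/2}]=q s_{ij}$ and $\mathbb P[a_{ij}=0]=1-q s_{ij}$. Let $T=(t_{ij})$ be the variance matrix $t_{ij}=\mathbb E h_{ij}^2$, that is, $t_{ij}=s_{ij}$ in the unbiased case and $t_{ij}=s_{ij}(1-q s_{ij})$ in the biased case; in the biased case with $\kappa\le 2/3$ one may also take $t_{ij}=s_{ij}$. Let $t^{(N)}(x,y)=N t_{ij}$ for $x\in(\frac{i-1}N,\frac iN]$, $y\in(\frac{j-1}N,\frac jN]$, and let $g=g^{(N)}:\mathbb C^+\times(0,1]\to\mathbb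 C^+$ solve the quadratic vector equation $$g_z(x)=-\frac{1}{z+\int_0^1 t^{(N)}(x,y)\,g_z(y)\,dy},\qquad z\in\mathbb C^+ .$$ The solution is a step function; let $g_i=g_i(z)$ be its value on $(\frac{i-1}N,\frac iN]$ and let $m^{(N)}(z)=\int_0^1 g_z(x)\,dx$. Let $I\subset\mathbb R$ be a bulk interval: a bounded interval for which there is a $c_I>0$, independent of $N$, with $\operatorname{Im} m^{(N)}(E+i\eta)>c_I$ for all $E\in I$, $0<\eta\le1$ and all large $N$. Put $G(z)=(H-z)^{-1}$ and, for $z=E+i\eta$, $$\Lambda(z)=\max\Bigl\{\max_i|G_{ii}(z)-g_i(z)|,\ \max_{i\ne j}|G_{ij}(z)|\Bigr\},\qquad \Phi(z)=\frac1{\sqrt q}+\frac1{\sqrt{N\eta}} .$$ Then for every fixed $\delta>0$ one has $\Lambda\prec\Phi$ uniformly on $\mathcal D^I_\delta=\{E+i\eta:\ E\in I,\ N^{\delta-1}\le\eta\le10\}$; that is, for all $\varepsilon,D>0$ and all sufficiently large $N$, $$\sup_{z\in\mathcal D^I_\delta}\mathbb P\bigl[\Lambda(z)>N^{\varepsilon}\,\Phi(z)\bigr]\le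 N^{-D}.$$ -/

import Mathlib

open MeasureTheory ProbabilityTheory Filter Set

noncomputable section

/-- Stochastic domination `X ≺ Y`, uniformly in the parameter `u ∈ U N`. -/
def StochDom {α : Type*} {Ω : ℕ → Type*} [∀ N, MeasurableSpace (Ω N)]
    (μ : ∀ N, Measure (Ω N)) (U : ℕ → Set α) (X Y : ∀ N, α → Ω N → ℝ) : Prop :=
  ∀ ε : ℝ, 0 < ε → ∀ D : ℝ, 0 < D → ∀ᶠ N : ℕ in atTop,
    (⨆ u ∈ U N, μ N {ω | |X N u ω| > (N : ℝ) ^ ε * Y N u ω}) ≤ ENNReal.ofReal ((N : ℝ) ^ (-D))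

/-- A real symmetric random matrix whose entries are independent up to the symmetry constraint. -/
structure IsSymmIndep {N : ℕ} {Ω : Type*} [MeasurableSpace Ω] (μ : Measure Ω)
    (H : Ω → Matrix (Fin N) (Fin N) ℝ) : Prop where
  measurable_entry : ∀ i j, Measurable fun ω => H ω i j
  symm : ∀ ω i j, H ω i j = H ω j i
  indep : iIndepFun
    (fun (e : {e : Fin N × Fin N // e.1 ≤ e.2}) (ω : Ω) => H ω e.1.1 e.1.2) μ

/-- The unbiased ensemble: `h_ij = ± 1/√q` with probability `q s_ij / 2` each, and `h_ij = 0` with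
probability `1 - q s_ij`. -/
structure IsUnbiasedSparse {N : ℕ} {Ω : Type*} [MeasurableSpace Ω] (μ : Measure Ω) (q : ℝ)
    (s : Matrix (Fin N) (Fin N) ℝ) (H : Ω → Matrix (Fin N) (Fin N) ℝ) : Prop
    extends IsSymmIndep μ H where
  prob_pos : ∀ i j, μ.real {ω | H ω i j = 1 / √q} = q * s i j / 2
  prob_neg : ∀ i j, μ.real {ω | H ω i j = -(1 / √q)} = q * s i j / 2
  prob_zero : ∀ i j, μ.real {ω | H ω i j = 0} = 1 - q * s i j

/-- The biased ensemble: `h_ij` is the centering (its mean `√q s_ij` is subtracted) of a variable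
equal to `1/√q` with probability `q s_ij` and to `0` with probability `1 - q s_ij`. -/
structure IsBiasedSparse {N : ℕ} {Ω : Type*} [MeasurableSpace Ω] (μ : Measure Ω) (q : ℝ)
    (s : Matrix (Fin N) (Fin N) ℝ) (H : Ω → Matrix (Fin N) (Fin N) ℝ) : Prop
    extends IsSymmIndep μ H where
  prob_one : ∀ i j, μ.real {ω | H ω i j = 1 / √q - √q * s i j} = q * s i j
  prob_zero : ∀ i j, μ.real {ω | H ω i j = 0 - √q * s i j} = 1 - q * s i j

/-- The variances `s_ij (1 - q s_ij)` of the entries of the biased ensemble. -/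
def biasedVariance {N : ℕ} (q : ℝ) (s : Matrix (Fin N) (Fin N) ℝ) : Matrix (Fin N) (Fin N) ℝ :=
  Matrix.of fun i j => s i j * (1 - q * s i j)

/-- The cell `(i/N, (i+1)/N]` of `(0,1]` that belongs to the index `i ∈ {0, …, N-1}`. -/
def cell (N : ℕ) (i : Fin N) : Set ℝ := Ioc ((i : ℝ) / N) (((i : ℝ) + 1) / N)

/-- The step kernel on `[0,1]²` with value `N t_ij` on the product of the cells of `i` and `j`. -/
def stepKernel {N : ℕ} (t : Matrix (Fin N) (Fin N) ℝ) (x y : ℝ) : ℝ :=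
  ∑ i, ∑ j, (cell N i).indicator 1 x * (cell N j).indicator 1 y * ((N : ℝ) * t i j)

/-- `g : ℂ⁺ × (0,1] → ℂ⁺` solves the quadratic vector equation `g = -1/(z + S g)`, where `S` is the
integral operator whose kernel is the step kernel of `t`. (The right-hand side depends on `x` only
through its cell, so a solution is a step function, and the integral is a true one.) -/
structure SolvesQVE {N : ℕ} (t : Matrix (Fin N) (Fin N) ℝ) (g : ℂ → ℝ → ℂ) : Prop where
  im_pos : ∀ z : ℂ, 0 < z.im → ∀ x ∈ Ioc (0 : ℝ) 1, 0 < (g z x).im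
  eqn : ∀ z : ℂ, 0 < z.im → ∀ x ∈ Ioc (0 : ℝ) 1,
    g z x = -1 / (z + ∫ y in (0 : ℝ)..1, (stepKernel t x y : ℂ) * g z y)

/-- `m(z) = ∫₀¹ g_z(x) dx`. -/
def qveMean (g : ℂ → ℝ → ℂ) (z : ℂ) : ℂ := ∫ x in (0 : ℝ)..1, g z x

/-- A bounded interval on which `Im m` has a lower bound that does not depend on (large) `N`. -/
def IsBulkInterval (m : ℕ → ℂ → ℂ) (I : Set ℝ) : Prop :=
  I.OrdConnected ∧ Bornology.IsBounded I ∧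
    ∃ cI : ℝ, 0 < cI ∧ ∀ᶠ N : ℕ in atTop,
      ∀ z : ℂ, z.re ∈ I → 0 < z.im → z.im ≤ 1 → cI < (m N z).im

/-- The spectral domain `{E + iη : E ∈ I, N^(δ-1) ≤ η ≤ 10}`. -/
def spectralDomain (I : Set ℝ) (δ : ℝ) (N : ℕ) : Set ℂ :=
  {z | z.re ∈ I ∧ (N : ℝ) ^ (δ - 1) ≤ z.im ∧ z.im ≤ 10}

/-- The resolvent `G(z) = (H - z)⁻¹`. -/
def greenFunction {N : ℕ} (H : Matrix (Fin N) (Fin N) ℝ) (z : ℂ) : Matrix (Fin N) (Fin N) ℂ :=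
  (H.map (fun a : ℝ => (a : ℂ)) - z • (1 : Matrix (Fin N) (Fin N) ℂ))⁻¹

/-- `Λ_d = max_i |G_ii - g_i|`, where `g_i` is the value of `g` on the cell of `i`, which is its
value at the right end point of this cell. -/
def lambdaDiag {N : ℕ} (H : Matrix (Fin N) (Fin N) ℝ) (g : ℂ → ℝ → ℂ) (z : ℂ) : ℝ :=
  ⨆ i : Fin N, ‖greenFunction H z i i - g z (((i : ℝ) + 1) / N)‖

/-- `Λ_o = max_{i ≠ j} |G_ij|`. -/
def lambdaOff {N : ℕ} (H : Matrix (Fin N) (Fin N) ℝ) (z : ℂ) : ℝ :=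
  ⨆ e : {e : Fin N × Fin N // e.1 ≠ e.2}, ‖greenFunction H z e.1.1 e.1.2‖

/-- `Λ = max {Λ_d, Λ_o}`. -/
def lambdaMax {N : ℕ} (H : Matrix (Fin N) (Fin N) ℝ) (g : ℂ → ℝ → ℂ) (z : ℂ) : ℝ :=
  max (lambdaDiag H g z) (lambdaOff H z)

/-- The control parameter `Φ = 1/√q + 1/√(N η)`, with `η = Im z`. -/
def controlPhi (q : ℝ) (N : ℕ) (z : ℂ) : ℝ := 1 / √q + 1 / √((N : ℝ) * z.im)

end

/-! Schur's complement formula writes the diagonal of `G` as an approximate solution of the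
quadratic vector equation: `G_ii (z + ∑ t_ij G_jj + Υ_i) = -1`, where `Υ` is `selfConsistentError`.
The law follows once `Υ` and the off-diagonal entries are shown to be small, and the equation is
shown to be stable under small perturbations.

Smallness. Row `i` of `H` is independent of the minor without row and column `i`. Hence the linear
and quadratic forms in that row are martingale sums with predictable coefficients. Their increments
are bounded by a multiple of `q^(-1/2)`, the entries have variance at most `C/N`, and the Ward
identity bounds `∑_k |G_kj|²` by a multiple of `1/η`; together these produce the scale `Φ`. An
exponential supermartingale (`expect_exp_le_one`, `prob_norm_sum_gt_le`) gives tails `e^(1-t)`, used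
with `t` a small power of `N`. The entries take finitely many values, so these arguments run on
finite weighted sums and reach the given probability space through `measure_le_prob_configMatrix`.
The outcome is `IsSparseModel.prob_not_rowEstimates_le`.

Stability. In the bulk, `|g|` is bounded above, and `|g|` and `Im g` are bounded below. Conjugating
by `Im g` turns the linearization `g² T` into phases `g²/|g|²` times a positive substochastic matrix
with entries comparable to `1/N`. Such a matrix can nearly preserve the maximum only of almost
constant vectors, and the phases, being away from `1`, then destroy it:
`norm_le_of_phase_mul_substochastic`. No low-rank structure is needed.

Bootstrap. The row estimates presuppose bounded minors, so `η` descends from a large value, where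
the trivial bound `‖G‖ ≤ 1/η` suffices, along a grid of polynomial size. Closeness at one point
gives rough closeness at the next by continuity, and stability restores the sharp bound, so errors
do not accumulate: `isCloseToDiag_of_rowEstimates`. -/

noncomputable section

/-! ### Concentration for martingale sums on a finite product space -/

section FiniteProduct

variable {E V : Type*} [Fintype E] [DecidableEq E] [Fintype V]

/-- Expectation with respect to the product weight on configurations. -/
def expect (w : E → V → ℝ) (F : (E → V) → ℝ) : ℝ := ∑ x, (∏ e, w e (x e)) * F x

open Classical in
/-- Probability of a set of configurations under the product weight. -/
def prob (w : E → V → ℝ) (P : (E → V) → Prop) : ℝ := expect w fun x => if P x then 1 else 0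

lemma expect_mono {w : E → V → ℝ} (hw : ∀ e v, 0 ≤ w e v) {F F' : (E → V) → ℝ}
    (h : ∀ x, F x ≤ F' x) : expect w F ≤ expect w F' :=
  Finset.sum_le_sum fun x _ =>
    mul_le_mul_of_nonneg_left (h x) (Finset.prod_nonneg fun e _ => hw e _)

lemma expect_const_mul (w : E → V → ℝ) (a : ℝ) (F : (E → V) → ℝ) :
    expect w (fun x => a * F x) = a * expect w F := by
  simp only [expect, Finset.mul_sum]
  exact Finset.sum_congr rfl fun x _ => by ring

lemma expect_one {w : E → V → ℝ} (hw1 : ∀ e, ∑ v, w e v = 1) : expect w (fun _ => 1) = 1 := by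
  simp only [expect, mul_one]
  rw [← Fintype.prod_sum]
  simp [hw1]

/-- This is averaging over one coordinate first; it plays the role of conditional expectation. -/
lemma expect_resample {w : E → V → ℝ} (hw1 : ∀ e, ∑ v, w e v = 1) (e : E) (F : (E → V) → ℝ) :
    expect w F = expect w fun x => ∑ v, w e v * F (Function.update x e v) := by
  classical
  -- Swapping coordinate `e` with an independent fresh sample preserves the joint weight.
  let φ : (E → V) × V → (E → V) × V := fun p => (Function.update p.1 e p.2, p.1 e)
  have hφ : Function.Involutive φ := fun p => by simp [φ]
  have hprod : ∀ (x : E → V) (v : V), (∏ e', w e' (x e')) * w e v =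
      (∏ e', w e' (Function.update x e v e')) * w e (x e) := by
    intro x v
    rw [← Finset.mul_prod_erase _ _ (Finset.mem_univ e),
      ← Finset.mul_prod_erase _ (fun e' => w e' (Function.update x e v e')) (Finset.mem_univ e)]
    have : ∏ e' ∈ Finset.univ.erase e, w e' (Function.update x e v e') =
        ∏ e' ∈ Finset.univ.erase e, w e' (x e') :=
      Finset.prod_congr rfl fun e' he' => by
        rw [Function.update_of_ne (Finset.ne_of_mem_erase he')]
    rw [this, Function.update_self]
    ring
  calc expect w F = ∑ p : (E → V) × V, (∏ e', w e' (p.1 e')) * w e p.2 * F p.1 := by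
        rw [Fintype.sum_prod_type]
        refine Finset.sum_congr rfl fun x _ => ?_
        change _ = ∑ v, (∏ e', w e' (x e')) * w e v * F x
        rw [← Finset.sum_mul, ← Finset.mul_sum, hw1, mul_one]
    _ = ∑ p : (E → V) × V, (∏ e', w e' ((φ p).1 e')) * w e (φ p).2 * F (φ p).1 :=
        (Equiv.sum_comp (hφ.toPerm) fun p : (E → V) × V =>
          (∏ e', w e' (p.1 e')) * w e p.2 * F p.1).symm
    _ = _ := by
        rw [Fintype.sum_prod_type]
        refine Finset.sum_congr rfl fun x _ => ?_
        rw [Finset.mul_sum]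
        refine Finset.sum_congr rfl fun v _ => ?_
        simp only [φ]
        rw [← hprod]
        ring

lemma prob_mono {w : E → V → ℝ} (hw : ∀ e v, 0 ≤ w e v) {P Q : (E → V) → Prop}
    (h : ∀ x, P x → Q x) : prob w P ≤ prob w Q := by
  classical
  refine expect_mono hw fun x => ?_
  by_cases hP : P x
  · simp [hP, h x hP]
  · simp only [hP, if_false]
    split_ifs <;> norm_num

lemma prob_or_le {w : E → V → ℝ} (hw : ∀ e v, 0 ≤ w e v) (P Q : (E → V) → Prop) :
    prob w (fun x => P x ∨ Q x) ≤ prob w P + prob w Q := by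
  classical
  unfold prob expect
  rw [← Finset.sum_add_distrib]
  refine Finset.sum_le_sum fun x _ => ?_
  rw [← mul_add]
  refine mul_le_mul_of_nonneg_left ?_ (Finset.prod_nonneg fun e _ => hw e _)
  by_cases hP : P x <;> by_cases hQ : Q x <;> simp [hP, hQ]

lemma prob_exists_le {w : E → V → ℝ} (hw : ∀ e v, 0 ≤ w e v) {ι : Type*} [Fintype ι]
    (P : ι → (E → V) → Prop) {a : ℝ} (h : ∀ i, prob w (P i) ≤ a) :
    prob w (fun x => ∃ i, P i x) ≤ Fintype.card ι * a := by
  classical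
  calc prob w (fun x => ∃ i, P i x) ≤ ∑ i, prob w (P i) := by
        unfold prob expect
        rw [Finset.sum_comm]
        refine Finset.sum_le_sum fun x _ => ?_
        rw [← Finset.mul_sum]
        refine mul_le_mul_of_nonneg_left ?_ (Finset.prod_nonneg fun e _ => hw e _)
        dsimp only
        split_ifs with hx
        · obtain ⟨i, hi⟩ := hx
          refine le_trans ?_ (Finset.single_le_sum (f := fun i => if P i x then (1 : ℝ) else 0)
            (fun i _ => by split_ifs <;> norm_num) (Finset.mem_univ i))
          simp [hi]
        · exact Finset.sum_nonneg fun i _ => by split_ifs <;> norm_num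
    _ ≤ ∑ _i : ι, a := Finset.sum_le_sum fun i _ => h i
    _ = _ := by simp

lemma exp_le_one_add_add_sq {x : ℝ} (hx : |x| ≤ 1) : Real.exp x ≤ 1 + x + x ^ 2 := by
  have := (abs_le.1 (Real.abs_exp_sub_one_sub_id_le hx)).2
  linarith

/-- The exponential moment of a centered bounded variable. -/
lemma sum_weight_exp_le {p ξ : V → ℝ} (hp : ∀ v, 0 ≤ p v) (hp1 : ∑ v, p v = 1)
    (hmean : ∑ v, p v * ξ v = 0) {M σ : ℝ} (hM : ∀ v, |ξ v| ≤ M)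
    (hvar : ∑ v, p v * ξ v ^ 2 ≤ σ) {f : ℝ} (hf : M * |f| ≤ 1) :
    ∑ v, p v * Real.exp (ξ v * f - σ * f ^ 2) ≤ 1 := by
  have h1 : ∑ v, p v * Real.exp (ξ v * f) ≤ 1 + σ * f ^ 2 := by
    calc ∑ v, p v * Real.exp (ξ v * f)
        ≤ ∑ v, p v * (1 + ξ v * f + (ξ v * f) ^ 2) := by
          refine Finset.sum_le_sum fun v _ => mul_le_mul_of_nonneg_left ?_ (hp v)
          refine exp_le_one_add_add_sq ?_
          rw [abs_mul]
          exact (mul_le_mul_of_nonneg_right (hM v) (abs_nonneg f)).trans hf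
      _ = ∑ v, p v + (∑ v, p v * ξ v) * f + (∑ v, p v * ξ v ^ 2) * f ^ 2 := by
          rw [Finset.sum_mul, Finset.sum_mul, ← Finset.sum_add_distrib, ← Finset.sum_add_distrib]
          exact Finset.sum_congr rfl fun v _ => by ring
      _ ≤ _ := by
          rw [hp1, hmean]
          nlinarith [mul_le_mul_of_nonneg_right hvar (sq_nonneg f)]
  calc ∑ v, p v * Real.exp (ξ v * f - σ * f ^ 2)
      = (∑ v, p v * Real.exp (ξ v * f)) * Real.exp (-(σ * f ^ 2)) := by
        rw [Finset.sum_mul]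
        refine Finset.sum_congr rfl fun v _ => ?_
        rw [sub_eq_add_neg, Real.exp_add]; ring
    _ ≤ Real.exp (σ * f ^ 2) * Real.exp (-(σ * f ^ 2)) := by
        refine mul_le_mul_of_nonneg_right (h1.trans ?_) (Real.exp_pos _).le
        linarith [Real.add_one_le_exp (σ * f ^ 2)]
    _ = 1 := by rw [← Real.exp_add]; simp

variable {ι : Type*} [LinearOrder ι]

/-- The exponential supermartingale built from independent centered variables `ξ k (x (key k))`
and predictable multipliers `f k`. -/
lemma expect_exp_le_one {w : E → V → ℝ} (hw : ∀ e v, 0 ≤ w e v) (hw1 : ∀ e, ∑ v, w e v = 1)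
    {key : ι → E} (hkey : Function.Injective key) {ξ : ι → V → ℝ} {M σ : ℝ}
    (hmean : ∀ k, ∑ v, w (key k) v * ξ k v = 0) (hM : ∀ k v, |ξ k v| ≤ M)
    (hvar : ∀ k, ∑ v, w (key k) v * ξ k v ^ 2 ≤ σ) {f : ι → (E → V) → ℝ}
    (hf : ∀ k x, M * |f k x| ≤ 1)
    (hpred : ∀ k l, k ≤ l → ∀ x v, f k (Function.update x (key l) v) = f k x) (s : Finset ι) :
    expect w (fun x => Real.exp (∑ k ∈ s, (ξ k (x (key k)) * f k x - σ * f k x ^ 2))) ≤ 1 := by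
  -- The largest index is integrated out first: by `hpred` no other summand, and no multiplier,
  -- depends on its coordinate.
  induction s using Finset.induction_on_max with
  | empty => simp [expect_one hw1]
  | insert a s hs ih =>
    have ha : a ∉ s := fun h => lt_irrefl _ (hs a h)
    rw [expect_resample hw1 (key a)]
    refine (expect_mono hw fun x => ?_).trans ih
    have hrest : ∀ v, ∑ k ∈ s, (ξ k (Function.update x (key a) v (key k)) *
          f k (Function.update x (key a) v) - σ * f k (Function.update x (key a) v) ^ 2) =
        ∑ k ∈ s, (ξ k (x (key k)) * f k x - σ * f k x ^ 2) := by
      intro v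
      refine Finset.sum_congr rfl fun k hk => ?_
      rw [hpred k a (hs k hk).le, Function.update_of_ne]
      exact fun h => (hs k hk).ne (hkey h)
    calc ∑ v, w (key a) v * Real.exp (∑ k ∈ insert a s,
          (ξ k (Function.update x (key a) v (key k)) * f k (Function.update x (key a) v) -
            σ * f k (Function.update x (key a) v) ^ 2))
        = (∑ v, w (key a) v * Real.exp (ξ a v * f a x - σ * f a x ^ 2)) *
            Real.exp (∑ k ∈ s, (ξ k (x (key k)) * f k x - σ * f k x ^ 2)) := by
          rw [Finset.sum_mul]
          refine Finset.sum_congr rfl fun v _ => ?_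
          rw [Finset.sum_insert ha, hrest, hpred a a le_rfl, Function.update_self, Real.exp_add,
            mul_assoc]
      _ ≤ _ := mul_le_of_le_one_left (Real.exp_pos _).le
          (sum_weight_exp_le (hw _) (hw1 _) (hmean a) (hM a) (hvar a) (hf a x))

lemma prob_real_sum_ge_le {w : E → V → ℝ} (hw : ∀ e v, 0 ≤ w e v) (hw1 : ∀ e, ∑ v, w e v = 1)
    {key : ι → E} (hkey : Function.Injective key) {ξ : ι → V → ℝ} {M σ : ℝ}
    (hmean : ∀ k, ∑ v, w (key k) v * ξ k v = 0) (hM : ∀ k v, |ξ k v| ≤ M)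
    (hvar : ∀ k, ∑ v, w (key k) v * ξ k v ^ 2 ≤ σ) {f : ι → (E → V) → ℝ}
    (hf : ∀ k x, M * |f k x| ≤ 1)
    (hpred : ∀ k l, k ≤ l → ∀ x v, f k (Function.update x (key l) v) = f k x) (s : Finset ι)
    (hsq : ∀ x, σ * ∑ k ∈ s, f k x ^ 2 ≤ 1) (t : ℝ) :
    prob w (fun x => t ≤ ∑ k ∈ s, ξ k (x (key k)) * f k x) ≤ Real.exp (1 - t) := by
  have h := expect_exp_le_one hw hw1 hkey hmean hM hvar hf hpred s
  calc prob w (fun x => t ≤ ∑ k ∈ s, ξ k (x (key k)) * f k x)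
      ≤ expect w (fun x => Real.exp (1 - t) *
          Real.exp (∑ k ∈ s, (ξ k (x (key k)) * f k x - σ * f k x ^ 2))) := by
        classical
        refine expect_mono hw fun x => ?_
        split_ifs with hx
        -- The compensator `σ ∑ f²` costs at most `1`, whence `1 - t` in the exponent.
        · rw [← Real.exp_add, Finset.sum_sub_distrib, ← Finset.mul_sum]
          refine Real.one_le_exp ?_
          linarith [hsq x]
        · positivity
    _ ≤ _ := by
        rw [expect_const_mul]
        exact mul_le_of_le_one_right (Real.exp_pos _).le h

/-- Large deviation bound for a sum of independent centered variables with complex predictable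
multipliers. -/
lemma prob_norm_sum_gt_le {w : E → V → ℝ} (hw : ∀ e v, 0 ≤ w e v) (hw1 : ∀ e, ∑ v, w e v = 1)
    {key : ι → E} (hkey : Function.Injective key) {ξ : ι → V → ℝ} {M σ : ℝ} (hM0 : 0 ≤ M)
    (hσ : 0 ≤ σ)
    (hmean : ∀ k, ∑ v, w (key k) v * ξ k v = 0) (hM : ∀ k v, |ξ k v| ≤ M)
    (hvar : ∀ k, ∑ v, w (key k) v * ξ k v ^ 2 ≤ σ) {b : ι → (E → V) → ℂ}
    (hpred : ∀ k l, k ≤ l → ∀ x v, b k (Function.update x (key l) v) = b k x) (s : Finset ι)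
    {ψ : ℝ} (hψ : 0 < ψ) (hb : ∀ k x, M * ‖b k x‖ ≤ ψ)
    (hsq : ∀ x, σ * ∑ k ∈ s, ‖b k x‖ ^ 2 ≤ ψ ^ 2) (t : ℝ) :
    prob w (fun x => 2 * t * ψ < ‖∑ k ∈ s, (ξ k (x (key k)) : ℂ) * b k x‖) ≤
      4 * Real.exp (1 - t) := by
  -- Used for `±re` and `±im`. Dividing by `ψ` normalizes both the increments and the quadratic
  -- variation to `1`.
  have key_bound : ∀ φ : ℂ → ℝ, (∀ u, |φ u| ≤ ‖u‖) →
      prob w (fun x => t ≤ ∑ k ∈ s, ξ k (x (key k)) * (φ (b k x) / ψ)) ≤ Real.exp (1 - t) := by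
    intro φ hφ
    refine prob_real_sum_ge_le hw hw1 hkey hmean hM hvar (f := fun k x => φ (b k x) / ψ)
      (fun k x => ?_) (fun k l hkl x v => by simp only [hpred k l hkl]) s (fun x => ?_) t
    · rw [abs_div, abs_of_pos hψ, mul_div_assoc', div_le_one hψ]
      exact (mul_le_mul_of_nonneg_left (hφ _) hM0).trans (hb k x)
    · simp only [div_pow]
      rw [← Finset.sum_div, mul_div_assoc', div_le_one (by positivity)]
      refine le_trans (mul_le_mul_of_nonneg_left (Finset.sum_le_sum fun k _ => ?_) hσ) (hsq x)
      rw [← sq_abs]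
      exact pow_le_pow_left₀ (abs_nonneg _) (hφ _) 2
  have hre := key_bound Complex.re Complex.abs_re_le_norm
  have him := key_bound Complex.im Complex.abs_im_le_norm
  have hre' := key_bound (fun u => -u.re) (fun u => by
    rw [abs_neg]; exact Complex.abs_re_le_norm u)
  have him' := key_bound (fun u => -u.im) (fun u => by
    rw [abs_neg]; exact Complex.abs_im_le_norm u)
  have hsub : ∀ x, 2 * t * ψ < ‖∑ k ∈ s, (ξ k (x (key k)) : ℂ) * b k x‖ →
      ((t ≤ ∑ k ∈ s, ξ k (x (key k)) * ((b k x).re / ψ)) ∨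
        (t ≤ ∑ k ∈ s, ξ k (x (key k)) * ((b k x).im / ψ))) ∨
      ((t ≤ ∑ k ∈ s, ξ k (x (key k)) * (-(b k x).re / ψ)) ∨
        (t ≤ ∑ k ∈ s, ξ k (x (key k)) * (-(b k x).im / ψ))) := by
    intro x hx
    by_contra hcon
    push Not at hcon
    obtain ⟨⟨h1, h2⟩, h3, h4⟩ := hcon
    have e1 : ∑ k ∈ s, ξ k (x (key k)) * ((b k x).re / ψ) =
        (∑ k ∈ s, (ξ k (x (key k)) : ℂ) * b k x).re / ψ := by
      rw [Complex.re_sum, Finset.sum_div]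
      exact Finset.sum_congr rfl fun k _ => by rw [Complex.re_ofReal_mul]; ring
    have e2 : ∑ k ∈ s, ξ k (x (key k)) * ((b k x).im / ψ) =
        (∑ k ∈ s, (ξ k (x (key k)) : ℂ) * b k x).im / ψ := by
      rw [Complex.im_sum, Finset.sum_div]
      exact Finset.sum_congr rfl fun k _ => by rw [Complex.im_ofReal_mul]; ring
    have e3 : ∑ k ∈ s, ξ k (x (key k)) * (-(b k x).re / ψ) =
        -(∑ k ∈ s, ξ k (x (key k)) * ((b k x).re / ψ)) := by
      rw [← Finset.sum_neg_distrib]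
      exact Finset.sum_congr rfl fun k _ => by ring
    have e4 : ∑ k ∈ s, ξ k (x (key k)) * (-(b k x).im / ψ) =
        -(∑ k ∈ s, ξ k (x (key k)) * ((b k x).im / ψ)) := by
      rw [← Finset.sum_neg_distrib]
      exact Finset.sum_congr rfl fun k _ => by ring
    rw [e3] at h3
    rw [e4] at h4
    rw [e1, div_lt_iff₀ hψ] at h1
    rw [e2, div_lt_iff₀ hψ] at h2
    rw [e1, neg_lt, lt_div_iff₀ hψ] at h3
    rw [e2, neg_lt, lt_div_iff₀ hψ] at h4
    have := Complex.norm_le_abs_re_add_abs_im (∑ k ∈ s, (ξ k (x (key k)) : ℂ) * b k x)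
    have h5 := abs_lt.2 ⟨by linarith, h1⟩
    have h6 := abs_lt.2 ⟨by linarith, h2⟩
    linarith
  refine (prob_mono hw hsub).trans ((prob_or_le hw _ _).trans ?_)
  linarith [prob_or_le hw (fun x => t ≤ ∑ k ∈ s, ξ k (x (key k)) * ((b k x).re / ψ))
    (fun x => t ≤ ∑ k ∈ s, ξ k (x (key k)) * ((b k x).im / ψ)),
    prob_or_le hw (fun x => t ≤ ∑ k ∈ s, ξ k (x (key k)) * (-(b k x).re / ψ))
    (fun x => t ≤ ∑ k ∈ s, ξ k (x (key k)) * (-(b k x).im / ψ))]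

end FiniteProduct

/-! ### From the probability space to finite configurations -/

section Transfer

variable {N : ℕ} {V : Type*} [Fintype V]

/-- Positions of a symmetric matrix on or above the diagonal. -/
abbrev UpperIndex (N : ℕ) : Type := {e : Fin N × Fin N // e.1 ≤ e.2}

/-- The position on or above the diagonal that carries the entry `(i, j)`. -/
def upperIndex (i j : Fin N) : UpperIndex N := ⟨(min i j, max i j), min_le_max⟩

lemma upperIndex_comm (i j : Fin N) : upperIndex i j = upperIndex j i := by
  simp [upperIndex, min_comm, max_comm]

lemma upperIndex_eq_iff {i j k l : Fin N} :
    upperIndex i j = upperIndex k l ↔ (i = k ∧ j = l) ∨ (i = l ∧ j = k) := by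
  simp only [upperIndex, Subtype.mk.injEq, Prod.mk.injEq]
  grind

lemma upperIndex_injective (i : Fin N) : Function.Injective (upperIndex i) := by
  intro k l h
  rcases upperIndex_eq_iff.1 h with ⟨_, h⟩ | ⟨h1, h2⟩
  · exact h
  · rw [h2, h1]

lemma upperIndex_ne {i k l m : Fin N} (hk : k ≠ i) (hl : l ≠ i) :
    upperIndex k l ≠ upperIndex i m := by
  rw [Ne, upperIndex_eq_iff]
  tauto

/-- The symmetric matrix whose entries are read off from a configuration. -/
def configMatrix (val : UpperIndex N → V → ℝ) (x : UpperIndex N → V) :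
    Matrix (Fin N) (Fin N) ℝ :=
  Matrix.of fun i j => val (upperIndex i j) (x (upperIndex i j))

/-- Almost surely every entry takes one of its listed values, since their probabilities add up to
`1`. Independence then gives each configuration its product weight. Covering by configurations gives
an upper bound for outer measure, so `P` need not be measurable. -/
lemma measure_le_prob_configMatrix {Ω : Type*} [MeasurableSpace Ω] {μ : Measure Ω}
    [IsProbabilityMeasure μ] {H : Ω → Matrix (Fin N) (Fin N) ℝ} (hH : IsSymmIndep μ H)
    {val : UpperIndex N → V → ℝ} (hval : ∀ e, Function.Injective (val e))
    {w : UpperIndex N → V → ℝ}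
    (hw : ∀ e v, μ.real {ω | H ω e.1.1 e.1.2 = val e v} = w e v)
    (hw1 : ∀ e, ∑ v, w e v = 1) (P : Matrix (Fin N) (Fin N) ℝ → Prop) :
    μ {ω | P (H ω)} ≤ ENNReal.ofReal (prob w fun x => P (configMatrix val x)) := by
  classical
  have hmeas : ∀ e v, MeasurableSet {ω | H ω e.1.1 e.1.2 = val e v} := fun e v =>
    hH.measurable_entry _ _ (measurableSet_singleton _)
  have hnull : μ (⋃ e : UpperIndex N, {ω | ∀ v, H ω e.1.1 e.1.2 ≠ val e v}) = 0 := by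
    refine measure_iUnion_null fun e => ?_
    have hU : {ω | ∀ v, H ω e.1.1 e.1.2 ≠ val e v} =
        (⋃ v, {ω | H ω e.1.1 e.1.2 = val e v})ᶜ := by ext; simp
    rw [hU, prob_compl_eq_zero_iff (MeasurableSet.iUnion fun v => hmeas e v),
      measure_iUnion _ (hmeas e), tsum_fintype]
    · rw [← ENNReal.ofReal_one, ← hw1 e, ENNReal.ofReal_sum_of_nonneg]
      · refine Finset.sum_congr rfl fun v _ => ?_
        rw [← hw, ofReal_measureReal]
      · intro v _
        rw [← hw]
        exact measureReal_nonneg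
    · intro v v' hvv
      refine Set.disjoint_left.2 fun ω h1 h2 => hvv (hval e ?_)
      exact h1.symm.trans h2
  have hsub : {ω | P (H ω)} ⊆ (⋃ x ∈ (Finset.univ.filter fun x => P (configMatrix val x)),
      ⋂ e ∈ (Finset.univ : Finset (UpperIndex N)), {ω | H ω e.1.1 e.1.2 = val e (x e)}) ∪
        ⋃ e : UpperIndex N, {ω | ∀ v, H ω e.1.1 e.1.2 ≠ val e v} := by
    intro ω hω
    by_cases h : ∃ e : UpperIndex N, ∀ v, H ω e.1.1 e.1.2 ≠ val e v
    · exact Or.inr (mem_iUnion.2 h)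
    · push Not at h
      choose x hx using h
      left
      have hM : configMatrix val x = H ω := by
        ext i j
        simp only [configMatrix, Matrix.of_apply, ← hx]
        rcases le_total i j with hij | hij
        · simp [upperIndex, hij]
        · simp [upperIndex, hij, hH.symm ω i j]
      simp only [mem_iUnion, mem_iInter, Finset.mem_filter, Finset.mem_univ, true_and,
        exists_prop, forall_const]
      exact ⟨x, by rw [hM]; exact hω, hx⟩
  have hpt : ∀ x : UpperIndex N → V,
      μ (⋂ e ∈ (Finset.univ : Finset (UpperIndex N)), {ω | H ω e.1.1 e.1.2 = val e (x e)}) =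
        ENNReal.ofReal (∏ e, w e (x e)) := by
    intro x
    have h := hH.indep.measure_inter_preimage_eq_mul Finset.univ
      (sets := fun e => {val e (x e)}) (fun e _ => measurableSet_singleton _)
    have h' : ∀ e : UpperIndex N, (fun ω => H ω e.1.1 e.1.2) ⁻¹' {val e (x e)} =
        {ω | H ω e.1.1 e.1.2 = val e (x e)} := fun e => rfl
    simp only [h'] at h
    rw [h, ENNReal.ofReal_prod_of_nonneg]
    · refine Finset.prod_congr rfl fun e _ => ?_
      rw [← hw, ofReal_measureReal]
    · intro e _
      rw [← hw]
      exact measureReal_nonneg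
  refine (measure_mono hsub).trans ((measure_union_le _ _).trans ?_)
  rw [hnull, add_zero]
  refine (measure_biUnion_finset_le _ _).trans ?_
  simp only [hpt]
  rw [← ENNReal.ofReal_sum_of_nonneg]
  · refine ENNReal.ofReal_le_ofReal (le_of_eq ?_)
    rw [Finset.sum_filter]
    exact Finset.sum_congr rfl fun x _ => by by_cases hx : P (configMatrix val x) <;> simp [hx]
  · intro x _
    refine Finset.prod_nonneg fun e _ => ?_
    rw [← hw]
    exact measureReal_nonneg

end Transfer

/-! ### Resolvent identities -/

section Resolvent

variable {N : ℕ}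

/-- The matrix `H - z`. -/
def shiftedMatrix (H : Matrix (Fin N) (Fin N) ℝ) (z : ℂ) : Matrix (Fin N) (Fin N) ℂ :=
  H.map (fun a : ℝ => (a : ℂ)) - z • (1 : Matrix (Fin N) (Fin N) ℂ)

lemma greenFunction_eq (H : Matrix (Fin N) (Fin N) ℝ) (z : ℂ) :
    greenFunction H z = (shiftedMatrix H z)⁻¹ := rfl

variable {H : Matrix (Fin N) (Fin N) ℝ} {z : ℂ}

lemma isHermitian_map_ofReal (hH : H.IsSymm) :
    (H.map (fun a : ℝ => (a : ℂ))).IsHermitian := by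
  ext i j
  simp [Matrix.conjTranspose_apply, Matrix.map_apply, hH.apply i j]

/-- A Hermitian matrix has no eigenvalue off the real line: a kernel vector `v` would force `Im z ·
∑ |v_i|² = 0`. -/
lemma isUnit_det_shiftedMatrix (hH : H.IsSymm) (hz : 0 < z.im) :
    IsUnit (shiftedMatrix H z).det := by
  rw [isUnit_iff_ne_zero]
  intro h0
  obtain ⟨v, hv0, hv⟩ := Matrix.exists_mulVec_eq_zero_iff.2 h0
  have h1 : (H.map (fun a : ℝ => (a : ℂ))).mulVec v = z • v := by
    have := hv
    rw [shiftedMatrix, Matrix.sub_mulVec, Matrix.smul_mulVec, Matrix.one_mulVec, sub_eq_zero] at this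
    exact this
  have h2 := (isHermitian_map_ofReal hH).im_star_dotProduct_mulVec_self v
  rw [h1, dotProduct_smul] at h2
  have h3 : (star v ⬝ᵥ v) = ((∑ i, ‖v i‖ ^ 2 : ℝ) : ℂ) := by
    simp only [dotProduct, Pi.star_apply, RCLike.star_def, Complex.conj_mul']
    push_cast
    rfl
  rw [h3] at h2
  simp only [smul_eq_mul, RCLike.im_to_complex, Complex.im_mul_ofReal] at h2
  rcases mul_eq_zero.1 h2 with h | h
  · exact hz.ne' h
  · refine hv0 (funext fun i => ?_)
    have := (Finset.sum_eq_zero_iff_of_nonneg (fun i _ => by positivity)).1 h i (Finset.mem_univ i)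
    simpa using this

lemma shiftedMatrix_mul_greenFunction (hH : H.IsSymm) (hz : 0 < z.im) :
    shiftedMatrix H z * greenFunction H z = 1 :=
  Matrix.mul_nonsing_inv _ (isUnit_det_shiftedMatrix hH hz)

lemma greenFunction_mul_shiftedMatrix (hH : H.IsSymm) (hz : 0 < z.im) :
    greenFunction H z * shiftedMatrix H z = 1 :=
  Matrix.nonsing_inv_mul _ (isUnit_det_shiftedMatrix hH hz)

lemma shiftedMatrix_transpose (hH : H.IsSymm) : (shiftedMatrix H z).transpose = shiftedMatrix H z := by
  ext i j
  simp [shiftedMatrix, Matrix.one_apply, hH.apply i j, eq_comm]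

lemma greenFunction_symm (hH : H.IsSymm) (i j : Fin N) :
    greenFunction H z i j = greenFunction H z j i := by
  have : (greenFunction H z).transpose = greenFunction H z := by
    rw [greenFunction_eq, Matrix.transpose_nonsing_inv, shiftedMatrix_transpose hH]
  rw [← this, Matrix.transpose_apply, this]

/-- The first resolvent identity in the spectral parameter. -/
lemma greenFunction_sub (hH : H.IsSymm) (hz : 0 < z.im) {z' : ℂ} (hz' : 0 < z'.im) :
    greenFunction H z - greenFunction H z' =
      (z - z') • (greenFunction H z * greenFunction H z') := by
  have h : shiftedMatrix H z' - shiftedMatrix H z = (z - z') • 1 := by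
    simp only [shiftedMatrix, sub_smul]; abel
  calc greenFunction H z - greenFunction H z'
      = greenFunction H z * (shiftedMatrix H z' - shiftedMatrix H z) * greenFunction H z' := by
        rw [mul_sub, sub_mul, greenFunction_mul_shiftedMatrix hH hz, one_mul, mul_assoc,
          shiftedMatrix_mul_greenFunction hH hz', mul_one]
    _ = _ := by rw [h]; simp

/-- The Ward identity. -/
lemma ward_identity (hH : H.IsSymm) (hz : 0 < z.im) (j : Fin N) :
    z.im * ∑ k, ‖greenFunction H z k j‖ ^ 2 = (greenFunction H z j j).im := by
  set G := greenFunction H z with hG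
  -- The identity is the diagonal of `G* (S* - S) G = G - G*` with `S = H - z`.
  have hS : (shiftedMatrix H z).conjTranspose - shiftedMatrix H z = (2 * z.im * Complex.I) • 1 := by
    have h1 : (shiftedMatrix H z).conjTranspose =
        H.map (fun a : ℝ => (a : ℂ)) - (star z) • 1 := by
      rw [shiftedMatrix, Matrix.conjTranspose_sub, Matrix.conjTranspose_smul,
        Matrix.conjTranspose_one, isHermitian_map_ofReal hH]
    rw [h1, shiftedMatrix, sub_sub_sub_cancel_left, ← sub_smul]
    congr 1
    rw [RCLike.star_def, Complex.sub_conj]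
    push_cast
    ring
  have hmul : G.conjTranspose * ((shiftedMatrix H z).conjTranspose - shiftedMatrix H z) * G =
      G - G.conjTranspose := by
    have e1 : G.conjTranspose * (shiftedMatrix H z).conjTranspose = 1 := by
      rw [← Matrix.conjTranspose_mul, shiftedMatrix_mul_greenFunction hH hz,
        Matrix.conjTranspose_one]
    rw [mul_sub, sub_mul, e1, one_mul, mul_assoc, shiftedMatrix_mul_greenFunction hH hz, mul_one]
  rw [hS] at hmul
  have h2 := congrFun (congrFun hmul j) j
  simp only [Matrix.mul_smul, mul_one, Matrix.smul_apply, Matrix.sub_apply,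
    Matrix.mul_apply, Matrix.conjTranspose_apply, RCLike.star_def, smul_eq_mul,
    Complex.sub_conj, mul_assoc, Complex.conj_mul', ← Finset.mul_sum] at h2
  have h3 : (2 * Complex.I) * ((z.im * ∑ k, ‖G k j‖ ^ 2 : ℝ) : ℂ) =
      (2 * Complex.I) * ((G j j).im : ℂ) := by
    push_cast at h2 ⊢
    linear_combination h2
  have h4 : (2 * Complex.I : ℂ) ≠ 0 := by simp
  exact_mod_cast mul_left_cancel₀ h4 h3

/-- Ward gives `η |G_jj|² ≤ Im G_jj ≤ |G_jj|`. -/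
lemma norm_greenFunction_diag_le (hH : H.IsSymm) (hz : 0 < z.im) (j : Fin N) :
    ‖greenFunction H z j j‖ ≤ 1 / z.im := by
  have h := ward_identity hH hz j
  have h1 : ‖greenFunction H z j j‖ ^ 2 ≤ ∑ k, ‖greenFunction H z k j‖ ^ 2 :=
    Finset.single_le_sum (f := fun k => ‖greenFunction H z k j‖ ^ 2)
      (fun k _ => by positivity) (Finset.mem_univ j)
  have h2 := (le_abs_self _).trans (Complex.abs_im_le_norm (greenFunction H z j j))
  rw [le_div_iff₀ hz]
  by_contra hcon
  push Not at hcon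
  have h3 : 0 < ‖greenFunction H z j j‖ := by
    by_contra h0
    have : ‖greenFunction H z j j‖ = 0 := le_antisymm (not_lt.1 h0) (norm_nonneg _)
    rw [this] at hcon
    linarith
  nlinarith [mul_le_mul_of_nonneg_left h1 hz.le]

lemma sum_norm_sq_greenFunction_le (hH : H.IsSymm) (hz : 0 < z.im) (j : Fin N) :
    ∑ k, ‖greenFunction H z k j‖ ^ 2 ≤ ‖greenFunction H z j j‖ / z.im := by
  rw [le_div_iff₀ hz, mul_comm, ward_identity hH hz]
  exact (le_abs_self _).trans (Complex.abs_im_le_norm _)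

lemma sum_norm_sq_greenFunction_le_inv_sq (hH : H.IsSymm) (hz : 0 < z.im) (j : Fin N) :
    ∑ k, ‖greenFunction H z k j‖ ^ 2 ≤ (1 / z.im) ^ 2 := by
  refine (sum_norm_sq_greenFunction_le hH hz j).trans ?_
  rw [div_eq_mul_one_div, sq]
  exact mul_le_mul_of_nonneg_right (norm_greenFunction_diag_le hH hz j) (by positivity)

lemma norm_greenFunction_le (hH : H.IsSymm) (hz : 0 < z.im) (i j : Fin N) :
    ‖greenFunction H z i j‖ ≤ 1 / z.im := by
  have h1 : ‖greenFunction H z i j‖ ^ 2 ≤ ∑ k, ‖greenFunction H z k j‖ ^ 2 :=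
    Finset.single_le_sum (f := fun k => ‖greenFunction H z k j‖ ^ 2)
      (fun k _ => by positivity) (Finset.mem_univ i)
  exact (pow_le_pow_iff_left₀ (norm_nonneg _) (by positivity) two_ne_zero).1
    (h1.trans (sum_norm_sq_greenFunction_le_inv_sq hH hz j))

lemma norm_greenFunction_sub_le (hH : H.IsSymm) (hz : 0 < z.im) {z' : ℂ} (hz' : 0 < z'.im)
    (i j : Fin N) :
    ‖greenFunction H z i j - greenFunction H z' i j‖ ≤ ‖z - z'‖ * (1 / z.im * (1 / z'.im)) := by
  rw [← Matrix.sub_apply, greenFunction_sub hH hz hz', Matrix.smul_apply, smul_eq_mul, norm_mul]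
  refine mul_le_mul_of_nonneg_left ?_ (norm_nonneg _)
  rw [Matrix.mul_apply]
  refine (norm_sum_le _ _).trans ?_
  simp only [norm_mul]
  refine abs_le_of_sq_le_sq' ?_ (by positivity) |>.2
  refine (Finset.sum_mul_sq_le_sq_mul_sq _ _ _).trans ?_
  rw [mul_pow]
  refine mul_le_mul ?_ (sum_norm_sq_greenFunction_le_inv_sq hH hz' j)
    (Finset.sum_nonneg fun k _ => by positivity) (by positivity)
  simp only [greenFunction_symm hH i]
  exact sum_norm_sq_greenFunction_le_inv_sq hH hz i

/-- The matrix with the `i`-th row and column replaced by zero. -/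
def minorMatrix (H : Matrix (Fin N) (Fin N) ℝ) (i : Fin N) : Matrix (Fin N) (Fin N) ℝ :=
  Matrix.of fun k l => if k = i ∨ l = i then 0 else H k l

lemma minorMatrix_isSymm (hH : H.IsSymm) (i : Fin N) : (minorMatrix H i).IsSymm := by
  ext k l
  simp [minorMatrix, hH.apply k l, or_comm]

/-- Zeroing row and column `i`, rather than deleting them, keeps the index set fixed; index `i` then
decouples with eigenvalue `0`. -/
lemma greenFunction_minorMatrix_eq_zero (hH : H.IsSymm) (hz : 0 < z.im) {i j : Fin N}
    (hj : j ≠ i) : greenFunction (minorMatrix H i) z i j = 0 := by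
  have h := congrFun (congrFun
    (shiftedMatrix_mul_greenFunction (minorMatrix_isSymm hH i) hz) i) j
  have hz0 : z ≠ 0 := fun h => by simp [h] at hz
  simpa [Matrix.mul_apply, shiftedMatrix, minorMatrix, Matrix.one_apply, hj.symm, hz0] using h

/-- Expansion of the resolvent with respect to the entries of the `i`-th row. -/
lemma greenFunction_eq_minorMatrix_sub (hH : H.IsSymm) (hz : 0 < z.im) {i j : Fin N} (hj : j ≠ i)
    (k : Fin N) :
    greenFunction H z k j = greenFunction (minorMatrix H i) z k j -
      greenFunction H z k i *
        ∑ l ∈ Finset.univ.erase i, (H i l : ℂ) * greenFunction (minorMatrix H i) z l j := by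
  set G := greenFunction H z
  set G' := greenFunction (minorMatrix H i) z with hG'
  have hm := minorMatrix_isSymm hH i
  have h1 : G' - G = G * (shiftedMatrix H z - shiftedMatrix (minorMatrix H i) z) * G' := by
    rw [mul_sub, sub_mul, greenFunction_mul_shiftedMatrix hH hz, one_mul, mul_assoc,
      shiftedMatrix_mul_greenFunction hm hz, mul_one]
  -- The difference of the two matrices lives on row and column `i`. The column contributes nothing
  -- because `G' i j = 0`.
  have h2 : ∀ k, ((shiftedMatrix H z - shiftedMatrix (minorMatrix H i) z) * G') k j =
      if k = i then ∑ l ∈ Finset.univ.erase i, (H i l : ℂ) * G' l j else 0 := by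
    intro k
    have h0 : G' i j = 0 := greenFunction_minorMatrix_eq_zero hH hz hj
    rw [Matrix.mul_apply, ← Finset.add_sum_erase _ _ (Finset.mem_univ i), h0, mul_zero, zero_add]
    split_ifs with hk
    · refine Finset.sum_congr rfl fun l hl => ?_
      simp [shiftedMatrix, minorMatrix, hk]
    · refine Finset.sum_eq_zero fun l hl => ?_
      simp [shiftedMatrix, minorMatrix, hk, Finset.ne_of_mem_erase hl]
  have h3 := congrFun (congrFun h1 k) j
  rw [mul_assoc, Matrix.mul_apply, Matrix.sub_apply] at h3
  simp only [h2, mul_ite, mul_zero, Finset.sum_ite_eq', Finset.mem_univ, if_true] at h3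
  linear_combination -h3

lemma greenFunction_offDiag (hH : H.IsSymm) (hz : 0 < z.im) {i j : Fin N} (hj : j ≠ i) :
    greenFunction H z i j = -(greenFunction H z i i *
      ∑ l ∈ Finset.univ.erase i, (H i l : ℂ) * greenFunction (minorMatrix H i) z l j) := by
  rw [greenFunction_eq_minorMatrix_sub hH hz hj, greenFunction_minorMatrix_eq_zero hH hz hj]
  ring

/-- Schur's complement formula. -/
lemma greenFunction_schur (hH : H.IsSymm) (hz : 0 < z.im) (i : Fin N) :
    greenFunction H z i i * ((H i i : ℂ) - z - ∑ l ∈ Finset.univ.erase i,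
      ∑ k ∈ Finset.univ.erase i, (H i l : ℂ) * (H i k : ℂ) *
        greenFunction (minorMatrix H i) z k l) = 1 := by
  have h := congrFun (congrFun (shiftedMatrix_mul_greenFunction hH hz) i) i
  rw [Matrix.mul_apply, ← Finset.add_sum_erase _ _ (Finset.mem_univ i), Matrix.one_apply_eq] at h
  have h1 : ∑ l ∈ Finset.univ.erase i, shiftedMatrix H z i l * greenFunction H z l i =
      -(greenFunction H z i i * ∑ l ∈ Finset.univ.erase i,
      ∑ k ∈ Finset.univ.erase i, (H i l : ℂ) * (H i k : ℂ) *
        greenFunction (minorMatrix H i) z k l) := by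
    rw [Finset.mul_sum, ← Finset.sum_neg_distrib]
    refine Finset.sum_congr rfl fun l hl => ?_
    have hli := Finset.ne_of_mem_erase hl
    rw [greenFunction_symm hH l i, greenFunction_offDiag hH hz hli, Finset.mul_sum,
      Finset.mul_sum, ← Finset.sum_neg_distrib, Finset.mul_sum, ← Finset.sum_neg_distrib]
    refine Finset.sum_congr rfl fun k _ => ?_
    simp only [shiftedMatrix, Matrix.sub_apply, Matrix.map_apply, Matrix.smul_apply,
      Matrix.one_apply_ne hli.symm]
    simp
    ring
  rw [h1] at h
  simp only [shiftedMatrix, Matrix.sub_apply, Matrix.map_apply, Matrix.smul_apply,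
      Matrix.one_apply_eq, smul_eq_mul, mul_one] at h
  linear_combination h

end Resolvent

/-! ### Bounds, stability and continuity for the quadratic vector equation -/

section VectorEquation

variable {N : ℕ}

/-- The quadratic vector equation on the index set `{0, …, N-1}`. -/
structure SolvesVectorQVE (t : Matrix (Fin N) (Fin N) ℝ) (z : ℂ) (g : Fin N → ℂ) : Prop where
  im_pos : ∀ i, 0 < (g i).im
  eqn : ∀ i, g i * (z + ∑ j, (t i j : ℂ) * g j) = -1

/-- Two-sided bounds on a vector in the upper half plane. -/
structure IsBoundedSolution (a b : ℝ) (g : Fin N → ℂ) : Prop where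
  norm_ge : ∀ i, a ≤ ‖g i‖
  norm_le : ∀ i, ‖g i‖ ≤ b
  im_ge : ∀ i, a ≤ (g i).im

variable {t : Matrix (Fin N) (Fin N) ℝ} {z : ℂ} {g : Fin N → ℂ}

lemma SolvesVectorQVE.ne_zero (h : SolvesVectorQVE t z g) (i : Fin N) : g i ≠ 0 := fun h0 => by
  have := h.im_pos i
  rw [h0] at this
  simp at this

lemma SolvesVectorQVE.norm_pos (h : SolvesVectorQVE t z g) (i : Fin N) : 0 < ‖g i‖ :=
  norm_pos_iff.2 (h.ne_zero i)

/-- Multiply the equation by the conjugate of `g i` and take imaginary parts. This positive linear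
relation for `Im g` later yields the substochastic row sums. -/
lemma SolvesVectorQVE.im_eq (h : SolvesVectorQVE t z g) (i : Fin N) :
    (g i).im = ‖g i‖ ^ 2 * (z.im + ∑ j, t i j * (g j).im) := by
  have h1 : (starRingEnd ℂ) (g i) = -((‖g i‖ ^ 2 : ℝ) : ℂ) * (z + ∑ j, (t i j : ℂ) * g j) := by
    have h2 := h.eqn i
    have h3 : (starRingEnd ℂ) (g i) * g i = ((‖g i‖ ^ 2 : ℝ) : ℂ) := by
      rw [Complex.conj_mul']; push_cast; rfl
    rw [← h3]
    linear_combination (starRingEnd ℂ) (g i) * h2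
  have h4 := congrArg Complex.im h1
  rw [Complex.conj_im, ← Complex.ofReal_neg, Complex.im_ofReal_mul, Complex.add_im,
    Complex.im_sum] at h4
  simp only [Complex.im_ofReal_mul] at h4
  linarith

lemma im_le_norm (u : ℂ) : u.im ≤ ‖u‖ := (le_abs_self _).trans (Complex.abs_im_le_norm u)

/-- By `im_eq`, `|g_i| ≥ Im g_i ≥ y |g_i|²`. -/
lemma SolvesVectorQVE.norm_le_of_le (h : SolvesVectorQVE t z g) {y : ℝ} (hy : 0 < y) (i : Fin N)
    (hle : y ≤ z.im + ∑ j, t i j * (g j).im) : ‖g i‖ ≤ 1 / y := by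
  rw [le_div_iff₀ hy]
  have h1 := h.im_eq i
  have h2 := im_le_norm (g i)
  have h3 := h.norm_pos i
  by_contra hcon
  push Not at hcon
  nlinarith [mul_le_mul_of_nonneg_left hle (sq_nonneg ‖g i‖)]

lemma SolvesVectorQVE.norm_ge {C b : ℝ} (ht : ∀ i j, t i j ∈ Icc 0 (C / N)) (hb0 : 0 < b)
    (hC : 0 < C)
    (h : SolvesVectorQVE t z g) (hb : ∀ i, ‖g i‖ ≤ b) (i : Fin N) :
    1 / (‖z‖ + C * b) ≤ ‖g i‖ := by
  have hN : (0 : ℝ) < N := by exact_mod_cast i.pos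
  have h1 := congrArg norm (h.eqn i)
  rw [norm_mul, norm_neg, norm_one] at h1
  have h2 : ‖z + ∑ j, (t i j : ℂ) * g j‖ ≤ ‖z‖ + C * b := by
    refine (norm_add_le _ _).trans (add_le_add_right ?_ _)
    calc ‖∑ j, (t i j : ℂ) * g j‖ ≤ ∑ j, ‖(t i j : ℂ) * g j‖ := norm_sum_le _ _
      _ ≤ ∑ _j : Fin N, C / N * b := by
          refine Finset.sum_le_sum fun j _ => ?_
          rw [norm_mul, Complex.norm_real, Real.norm_of_nonneg (ht i j).1]
          exact mul_le_mul (ht i j).2 (hb j) (norm_nonneg _) (by positivity)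
      _ = C * b := by simp; field_simp
  rw [div_le_iff₀ (by positivity), ← h1]
  exact mul_le_mul_of_nonneg_left h2 (norm_nonneg _)

/-- Solutions of the quadratic vector equation are bounded where the mean of `Im g` is bounded
from below, and at large imaginary part. -/
lemma SolvesVectorQVE.isBoundedSolution {τ C m R : ℝ} (hτ : 0 < τ) (hC : 0 < C) (hm : 0 < m)
    (hR : 0 < R)
    (ht : ∀ i j, t i j ∈ Icc (τ / N) (C / N)) (hz0 : 0 < z.im) (hz : ‖z‖ ≤ R)
    (h : SolvesVectorQVE t z g) (hcase : 1 ≤ z.im ∨ m ≤ (1 / N : ℝ) * ∑ j, (g j).im) :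
    IsBoundedSolution (min (1 / (R + C * (1 / min 1 (τ * m))))
      ((1 / (R + C * (1 / min 1 (τ * m)))) ^ 2 * min 1 (τ * m))) (1 / min 1 (τ * m)) g := by
  set y := min 1 (τ * m) with hy
  have hy0 : 0 < y := lt_min one_pos (mul_pos hτ hm)
  have hN : ∀ _ : Fin N, (0 : ℝ) < N := fun i => by exact_mod_cast i.pos
  -- Either `Im z ≥ 1` suffices, or the lower bound `τ/N` on the kernel turns the mean of `Im g`
  -- into a bound for every row.
  have hle : ∀ i, y ≤ z.im + ∑ j, t i j * (g j).im := by
    intro i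
    have h0 : 0 ≤ ∑ j, t i j * (g j).im := Finset.sum_nonneg fun j _ =>
      mul_nonneg ((div_nonneg hτ.le (hN i).le).trans (ht i j).1) (h.im_pos j).le
    rcases hcase with h1 | h1
    · exact (min_le_left _ _).trans (by linarith)
    · have h2 : τ * m ≤ ∑ j, t i j * (g j).im := by
        calc τ * m ≤ τ * ((1 / N : ℝ) * ∑ j, (g j).im) := mul_le_mul_of_nonneg_left h1 hτ.le
          _ = ∑ j, τ / N * (g j).im := by rw [← Finset.mul_sum]; ring
          _ ≤ _ := Finset.sum_le_sum fun j _ =>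
              mul_le_mul_of_nonneg_right (ht i j).1 (h.im_pos j).le
      exact (min_le_right _ _).trans (by linarith)
  have hb : ∀ i, ‖g i‖ ≤ 1 / y := fun i => h.norm_le_of_le hy0 i (hle i)
  have hge : ∀ i, 1 / (R + C * (1 / y)) ≤ ‖g i‖ := fun i => by
    refine le_trans ?_ (h.norm_ge (fun i j =>
      ⟨(div_nonneg hτ.le (hN i).le).trans (ht i j).1, (ht i j).2⟩) (by positivity) hC hb i)
    have hpos : 0 ≤ ‖z‖ := norm_nonneg z
    have hz' : 0 < ‖z‖ := norm_pos_iff.2 fun h => by simp [h] at hz0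
    exact one_div_le_one_div_of_le (by positivity) (by linarith)
  refine ⟨fun i => (min_le_left _ _).trans (hge i), hb, fun i => (min_le_right _ _).trans ?_⟩
  rw [h.im_eq i]
  exact mul_le_mul (pow_le_pow_left₀ (by positivity) (hge i) 2) (hle i) hy0.le (by positivity)

/-- A vector equation `y = b P y + r` with a substochastic matrix `P` whose entries are comparable
to `1/N` is stable if the phases `b` stay away from `1`. -/
lemma norm_le_of_phase_mul_substochastic {P : Matrix (Fin N) (Fin N) ℝ} {p p' L β : ℝ}
    (hp : 0 < p) (hp' : 0 < p') (hL : 0 < L) (hβ : 0 < β)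
    (hP : ∀ i j, P i j ∈ Icc (p / N) (p' / N)) (hrow : ∀ i, ∑ j, P i j ≤ 1)
    (hcomp : ∀ i j, 1 - ∑ k, P i k ≤ L * (1 - ∑ k, P j k))
    {b y r : Fin N → ℂ} (hb : ∀ i, ‖b i‖ ≤ 1) (hbre : ∀ i, (b i).re ≤ 1 - β)
    (hy : ∀ i, y i = b i * ∑ j, (P i j : ℂ) * y j + r i) {ρ : ℝ} (hr : ∀ i, ‖r i‖ ≤ ρ)
    (i : Fin N) :
    ‖y i‖ ≤ 2 / β * ((L + p' / p) / β + 1 + 1 / p) * ρ := by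
  have hNpos : (0 : ℝ) < N := by exact_mod_cast i.pos
  obtain ⟨i₀, -, hi₀⟩ := Finset.exists_max_image Finset.univ (fun i => ‖y i‖) ⟨i, Finset.mem_univ i⟩
  set Y := ‖y i₀‖ with hY
  have hmax : ∀ j, ‖y j‖ ≤ Y := fun j => hi₀ j (Finset.mem_univ j)
  refine (hmax i).trans ?_
  have hρ : 0 ≤ ρ := (norm_nonneg _).trans (hr i)
  have hY0 : 0 ≤ Y := norm_nonneg _
  have hP0 : ∀ i j, 0 ≤ P i j := fun i j => (by positivity : (0 : ℝ) ≤ p / N).trans (hP i j).1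
  set u : Fin N → ℂ := fun i => ∑ j, (P i j : ℂ) * y j with hu
  have huY : ∀ i, ‖u i‖ ≤ Y := fun i => by
    calc ‖u i‖ ≤ ∑ j, ‖(P i j : ℂ) * y j‖ := norm_sum_le _ _
      _ ≤ ∑ j, P i j * Y := Finset.sum_le_sum fun j _ => by
          rw [norm_mul, Complex.norm_real, Real.norm_of_nonneg (hP0 i j)]
          exact mul_le_mul_of_nonneg_left (hmax j) (hP0 i j)
      _ = (∑ j, P i j) * Y := by rw [Finset.sum_mul]
      _ ≤ Y := mul_le_of_le_one_left hY0 (hrow i)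
  -- Rotate so that the average at the maximizing row is a nonnegative real; `d` below measures how
  -- far each rotated `y j` falls short of the maximum `Y`.
  obtain ⟨ζ, hζ, hζu⟩ : ∃ ζ : ℂ, ‖ζ‖ = 1 ∧ (ζ * u i₀).re = ‖u i₀‖ := by
    by_cases h0 : u i₀ = 0
    · exact ⟨1, norm_one, by simp [h0]⟩
    · have hn : (‖u i₀‖ : ℂ) ≠ 0 := by simpa using h0
      refine ⟨(starRingEnd ℂ) (u i₀) / ‖u i₀‖, ?_, ?_⟩
      · rw [norm_div, RCLike.norm_conj, Complex.norm_real, norm_norm, div_self]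
        simpa using h0
      · rw [div_mul_eq_mul_div, Complex.conj_mul', sq, mul_div_assoc, div_self hn, mul_one,
          Complex.ofReal_re]
  have hu0 : Y - ρ ≤ ‖u i₀‖ := by
    have h1 : Y ≤ ‖b i₀ * u i₀‖ + ‖r i₀‖ := by
      rw [hY, hy i₀]; exact norm_add_le _ _
    rw [norm_mul] at h1
    linarith [hr i₀, mul_le_of_le_one_left (norm_nonneg (u i₀)) (hb i₀)]
  set d : Fin N → ℝ := fun j => Y - (ζ * y j).re with hd
  have hre_le : ∀ v : ℂ, (ζ * v).re ≤ ‖v‖ := fun v =>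
    (Complex.re_le_norm _).trans (by rw [norm_mul, hζ, one_mul])
  have hd0 : ∀ j, 0 ≤ d j := fun j => sub_nonneg.2 ((hre_le _).trans (hmax j))
  have hsum : ∀ i, ∑ j, P i j * d j = (∑ j, P i j) * Y - (ζ * u i).re := fun i => by
    simp only [hd, hu, mul_sub, Finset.sum_sub_distrib, Finset.mul_sum, Complex.re_sum,
      Finset.sum_mul]
    congr 1
    refine Finset.sum_congr rfl fun j _ => ?_
    rw [mul_left_comm, Complex.re_ofReal_mul]
  -- At the maximizing row almost nothing is lost, so both nonnegative losses, from averaging and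
  -- from the missing mass, are at most `ρ`.
  have hA : ∑ j, P i₀ j * d j + (1 - ∑ j, P i₀ j) * Y ≤ ρ := by
    rw [hsum, hζu]; linarith
  have hA1 : 0 ≤ (1 - ∑ j, P i₀ j) * Y := mul_nonneg (sub_nonneg.2 (hrow i₀)) hY0
  have hA2 : 0 ≤ ∑ j, P i₀ j * d j := Finset.sum_nonneg fun j _ => mul_nonneg (hP0 _ _) (hd0 j)
  have hdsum : p / N * ∑ j, d j ≤ ρ := by
    rw [Finset.mul_sum]
    refine (Finset.sum_le_sum fun j _ => mul_le_mul_of_nonneg_right (hP i₀ j).1 (hd0 j)).trans ?_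
    linarith
  set A := L + p' / p with hAdef
  have hA0 : 0 < A := by positivity
  -- Comparable rows carry the small loss from `i₀` to every row: all averages almost attain `Y` in
  -- the same direction.
  have hre : ∀ i, Y - A * ρ ≤ (ζ * u i).re := fun i => by
    have h1 : ∑ j, P i j * d j ≤ p' / p * ρ := by
      calc ∑ j, P i j * d j ≤ ∑ j, p' / N * d j := Finset.sum_le_sum fun j _ =>
            mul_le_mul_of_nonneg_right (hP i j).2 (hd0 j)
        _ = p' / p * (p / N * ∑ j, d j) := by rw [← Finset.mul_sum]; field_simp
        _ ≤ _ := mul_le_mul_of_nonneg_left hdsum (by positivity)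
    have h2 : (1 - ∑ j, P i j) * Y ≤ L * ρ := by
      calc (1 - ∑ j, P i j) * Y ≤ L * (1 - ∑ j, P i₀ j) * Y :=
            mul_le_mul_of_nonneg_right (hcomp i i₀) hY0
        _ = L * ((1 - ∑ j, P i₀ j) * Y) := by ring
        _ ≤ _ := mul_le_mul_of_nonneg_left (by linarith) hL.le
    rw [hsum] at h1
    rw [hAdef, add_mul]
    linarith
  -- Some coordinate `y k` is itself nearly maximal. But `y k` is `b k * u k` up to `ρ` with `u k`
  -- near `Y`, so the phase loses about `β Y`; hence `Y` is of order `ρ`.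
  obtain ⟨k, hk⟩ : ∃ k, d k ≤ ρ / p := by
    by_contra hcon
    push Not at hcon
    have : ∑ _j : Fin N, ρ / p < ∑ j, d j :=
      Finset.sum_lt_sum_of_nonempty ⟨i, Finset.mem_univ i⟩ fun j _ => hcon j
    rw [Finset.sum_const, Finset.card_univ, Fintype.card_fin, nsmul_eq_mul] at this
    have h3 := mul_lt_mul_of_pos_left this (by positivity : 0 < p / N)
    have h4 : p / N * (N * (ρ / p)) = ρ := by field_simp
    linarith
  have hnear : ‖(Y : ℂ) - ζ * u k‖ ^ 2 ≤ 2 * A * ρ * Y := by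
    have h1 : ‖ζ * u k‖ ≤ Y := by rw [norm_mul, hζ, one_mul]; exact huY k
    have h2 : ‖(Y : ℂ) - ζ * u k‖ ^ 2 = Y ^ 2 - 2 * Y * (ζ * u k).re + ‖ζ * u k‖ ^ 2 := by
      rw [← Complex.normSq_eq_norm_sq (_ - _), ← Complex.normSq_eq_norm_sq (ζ * u k),
        Complex.normSq_apply, Complex.normSq_apply]
      simp only [Complex.sub_re, Complex.ofReal_re, Complex.sub_im, Complex.ofReal_im]
      ring
    rw [h2]
    nlinarith [pow_le_pow_left₀ (norm_nonneg _) h1 2, mul_le_mul_of_nonneg_left (hre k) hY0]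
  have hyk : (ζ * y k).re ≤ (1 - β) * Y + ‖(Y : ℂ) - ζ * u k‖ + ρ := by
    have h1 : ζ * y k = (Y : ℂ) * b k - b k * ((Y : ℂ) - ζ * u k) + ζ * r k := by
      rw [hy k]; ring
    rw [h1, Complex.add_re, Complex.sub_re, Complex.re_ofReal_mul]
    have h2 : -(b k * ((Y : ℂ) - ζ * u k)).re ≤ ‖(Y : ℂ) - ζ * u k‖ := by
      refine (neg_le_abs _).trans ((Complex.abs_re_le_norm _).trans ?_)
      rw [norm_mul]
      exact mul_le_of_le_one_left (norm_nonneg _) (hb k)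
    nlinarith [hre_le (r k), hr k, mul_le_mul_of_nonneg_left (hbre k) hY0]
  have hfin : β * Y ≤ ‖(Y : ℂ) - ζ * u k‖ + (1 + 1 / p) * ρ := by
    have : d k = Y - (ζ * y k).re := rfl
    have h5 : ρ / p = 1 / p * ρ := by ring
    linarith
  -- The arithmetic–geometric mean inequality trades the bound of order `√(ρ Y)` for half of the
  -- gain `β Y`.
  have hsq : ‖(Y : ℂ) - ζ * u k‖ ≤ β * Y / 2 + A * ρ / β := by
    refine abs_le_of_sq_le_sq' (hnear.trans ?_) (by positivity) |>.2
    have h6 : β * Y / 2 * (A * ρ / β) = A * ρ * Y / 2 := by field_simp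
    nlinarith [sq_nonneg (β * Y / 2 - A * ρ / β)]
  have h7 : 2 / β * (A / β + 1 + 1 / p) * ρ = (2 * (A * ρ / β + (1 + 1 / p) * ρ)) / β := by
    field_simp
    ring
  rw [h7, le_div_iff₀ hβ]
  linarith

/-- The stability constant of the linearized quadratic vector equation. -/
def stabilityConstant (τ C a b : ℝ) : ℝ :=
  b * (2 / (2 * a ^ 2 / b ^ 2) * ((b ^ 3 / a ^ 3 + (b ^ 2 * C * b / a) / (a ^ 2 * τ * a / b)) /
    (2 * a ^ 2 / b ^ 2) + 1 + 1 / (a ^ 2 * τ * a / b)) / a)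

lemma stabilityConstant_pos {τ C a b : ℝ} (hτ : 0 < τ) (hC : 0 < C) (ha : 0 < a) (hb : 0 < b) :
    0 < stabilityConstant τ C a b := by
  unfold stabilityConstant
  positivity

/-- Stability of the linearized quadratic vector equation. -/
lemma SolvesVectorQVE.linear_stability {τ C a b : ℝ} (hτ : 0 < τ) (hC : 0 < C) (ha : 0 < a)
    (hb : 0 < b) (ht : ∀ i j, t i j ∈ Icc (τ / N) (C / N)) (hz0 : 0 < z.im)
    (h : SolvesVectorQVE t z g) (hg : IsBoundedSolution a b g) {v r : Fin N → ℂ}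
    (hv : ∀ i, v i = g i ^ 2 * ∑ j, (t i j : ℂ) * v j + r i) {ρ : ℝ} (hr : ∀ i, ‖r i‖ ≤ ρ)
    (i : Fin N) : ‖v i‖ ≤ stabilityConstant τ C a b * ρ := by
  have hN : (0 : ℝ) < N := by exact_mod_cast i.pos
  have hρ : 0 ≤ ρ := (norm_nonneg _).trans (hr i)
  have him := h.im_pos
  have himb : ∀ j, (g j).im ≤ b := fun j => (im_le_norm _).trans (hg.norm_le j)
  have hnp := h.norm_pos
  set P : Matrix (Fin N) (Fin N) ℝ := fun i j => ‖g i‖ ^ 2 * t i j * (g j).im / (g i).im with hP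
  have ht0 : ∀ i j, 0 < t i j := fun i j => lt_of_lt_of_le (by positivity) (ht i j).1
  have hrow : ∀ i, ∑ j, P i j = 1 - z.im * (‖g i‖ ^ 2 / (g i).im) := fun i => by
    have h1 : ∑ j, P i j = ‖g i‖ ^ 2 * (∑ j, t i j * (g j).im) / (g i).im := by
      rw [Finset.mul_sum, Finset.sum_div]
      exact Finset.sum_congr rfl fun j _ => by simp only [hP]; ring
    have h2 := h.im_eq i
    rw [h1, eq_sub_iff_add_eq, mul_div_assoc', ← add_div, div_eq_one_iff_eq (him i).ne']
    linarith
  have hlow : ∀ i, a ^ 2 / b ≤ ‖g i‖ ^ 2 / (g i).im := fun i =>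
    div_le_div₀ (by positivity) (pow_le_pow_left₀ ha.le (hg.norm_ge i) 2) (him i) (himb i)
  have hupp : ∀ i, ‖g i‖ ^ 2 / (g i).im ≤ b ^ 2 / a := fun i =>
    div_le_div₀ (by positivity) (pow_le_pow_left₀ (norm_nonneg _) (hg.norm_le i) 2) ha (hg.im_ge i)
  -- The unknown is `v / Im g`. The row deficits are `η |g_i|² / Im g_i`, comparable with ratio
  -- `(b²/a)/(a²/b)`, which gives `L`; and `Re (g²/|g|²) = 1 - 2 (Im g)²/|g|²` gives `β`.
  have key := norm_le_of_phase_mul_substochastic (P := P) (p := a ^ 2 * τ * a / b)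
    (p' := b ^ 2 * C * b / a) (L := b ^ 3 / a ^ 3) (β := 2 * a ^ 2 / b ^ 2)
    (b := fun i => g i ^ 2 / (‖g i‖ ^ 2 : ℝ)) (y := fun i => v i / (g i).im)
    (r := fun i => r i / (g i).im) (ρ := ρ / a)
    (by positivity) (by positivity) (by positivity) (by positivity)
    (fun i j => ⟨?_, ?_⟩) (fun i => ?_) (fun i j => ?_) (fun i => ?_) (fun i => ?_) (fun i => ?_)
    (fun i => ?_) i
  · rw [norm_div, Complex.norm_real, Real.norm_of_nonneg (him i).le, div_le_iff₀ (him i)] at key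
    have hA : 0 ≤ 2 / (2 * a ^ 2 / b ^ 2) * ((b ^ 3 / a ^ 3 +
      (b ^ 2 * C * b / a) / (a ^ 2 * τ * a / b)) /
      (2 * a ^ 2 / b ^ 2) + 1 + 1 / (a ^ 2 * τ * a / b)) * (ρ / a) := by positivity
    refine key.trans ((mul_le_mul_of_nonneg_left (himb i) hA).trans (le_of_eq ?_))
    unfold stabilityConstant
    ring
  · calc a ^ 2 * τ * a / b / N = a ^ 2 * (τ / N) * a / b := by ring
      _ ≤ P i j := by
        refine div_le_div₀ (by have := him j; have := ht0 i j; positivity) ?_ (him i) (himb i)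
        exact mul_le_mul (mul_le_mul (pow_le_pow_left₀ ha.le (hg.norm_ge i) 2) (ht i j).1
          (by positivity) (by positivity)) (hg.im_ge j) ha.le
          (by have := ht0 i j; positivity)
  · calc P i j ≤ b ^ 2 * (C / N) * b / a := by
          refine div_le_div₀ (by positivity) ?_ ha (hg.im_ge i)
          exact mul_le_mul (mul_le_mul (pow_le_pow_left₀ (norm_nonneg _) (hg.norm_le i) 2) (ht i j).2
            (ht0 i j).le (by positivity)) (himb j) (him j).le (by positivity)
      _ = b ^ 2 * C * b / a / N := by ring
  · rw [hrow]
    have := him i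
    have : 0 ≤ z.im * (‖g i‖ ^ 2 / (g i).im) := by positivity
    linarith
  · rw [hrow, hrow, sub_sub_cancel, sub_sub_cancel]
    calc z.im * (‖g i‖ ^ 2 / (g i).im) ≤ z.im * (b ^ 2 / a) :=
          mul_le_mul_of_nonneg_left (hupp i) hz0.le
      _ = b ^ 3 / a ^ 3 * (z.im * (a ^ 2 / b)) := by field_simp
      _ ≤ _ := mul_le_mul_of_nonneg_left (mul_le_mul_of_nonneg_left (hlow j) hz0.le)
          (by positivity)
  · have := hnp i
    simp only [norm_div, norm_pow, Complex.norm_real, norm_norm]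
    rw [div_self (by positivity)]
  · have h1 : (g i ^ 2).re = ‖g i‖ ^ 2 - 2 * (g i).im ^ 2 := by
      rw [← Complex.normSq_eq_norm_sq, Complex.normSq_apply, sq, Complex.mul_re]; ring
    have h2 : 0 < ‖g i‖ ^ 2 := by have := hnp i; positivity
    rw [Complex.div_ofReal_re, h1, sub_div, div_self h2.ne']
    refine sub_le_sub_left ?_ _
    refine div_le_div₀ (by positivity) ?_ h2
      (pow_le_pow_left₀ (norm_nonneg _) (hg.norm_le i) 2)
    exact mul_le_mul_of_nonneg_left (pow_le_pow_left₀ ha.le (hg.im_ge i) 2) zero_le_two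
  · have hi : ((g i).im : ℂ) ≠ 0 := by exact_mod_cast (him i).ne'
    have hn : ((‖g i‖ ^ 2 : ℝ) : ℂ) ≠ 0 := by
      have := hnp i
      exact_mod_cast (by positivity : ‖g i‖ ^ 2 ≠ 0)
    have h1 : ∑ j, ((P i j : ℝ) : ℂ) * (v j / (g j).im) =
        ((‖g i‖ ^ 2 : ℝ) : ℂ) / (g i).im * ∑ j, (t i j : ℂ) * v j := by
      rw [Finset.mul_sum]
      refine Finset.sum_congr rfl fun j _ => ?_
      have hj : ((g j).im : ℂ) ≠ 0 := by exact_mod_cast (him j).ne'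
      simp only [hP]
      push_cast
      field_simp
    rw [h1, hv i, add_div]
    congr 1
    field_simp
  · rw [norm_div, Complex.norm_real, Real.norm_of_nonneg (him i).le]
    exact div_le_div₀ hρ (hr i) ha (hg.im_ge i)

/-- Stability of the quadratic vector equation under a small perturbation. -/
lemma SolvesVectorQVE.stability {τ C a b c₀ : ℝ} (hτ : 0 < τ) (hC : 0 < C) (ha : 0 < a)
    (hb : 0 < b) (hc₀ : stabilityConstant τ C a b * (b * C * c₀) ≤ 1 / 2)
    (ht : ∀ i j, t i j ∈ Icc (τ / N) (C / N)) (hz0 : 0 < z.im)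
    (h : SolvesVectorQVE t z g) (hg : IsBoundedSolution a b g) {G Υ : Fin N → ℂ}
    (hG : ∀ i, G i * (z + ∑ j, (t i j : ℂ) * G j + Υ i) = -1)
    (hclose : ∀ i, ‖G i - g i‖ ≤ c₀) {ρ : ℝ} (hΥ : ∀ i, ‖Υ i‖ ≤ ρ) (i : Fin N) :
    ‖G i - g i‖ ≤ 2 * stabilityConstant τ C a b * (b * (b + c₀)) * ρ := by
  have hN : (0 : ℝ) < N := by exact_mod_cast i.pos
  obtain ⟨i₀, -, hi₀⟩ := Finset.exists_max_image Finset.univ (fun i => ‖G i - g i‖)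
    ⟨i, Finset.mem_univ i⟩
  set Y := ‖G i₀ - g i₀‖ with hY
  have hmax : ∀ j, ‖G j - g j‖ ≤ Y := fun j => hi₀ j (Finset.mem_univ j)
  refine (hmax i).trans ?_
  have hK := stabilityConstant_pos hτ hC ha hb
  have hY0 : 0 ≤ Y := norm_nonneg _
  have hc0 : 0 ≤ c₀ := (norm_nonneg _).trans (hclose i)
  have hT : ∀ i, ‖∑ j, (t i j : ℂ) * (G j - g j)‖ ≤ C * Y := fun i => by
    calc _ ≤ ∑ j, ‖(t i j : ℂ) * (G j - g j)‖ := norm_sum_le _ _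
      _ ≤ ∑ _j : Fin N, C / N * Y := by
          refine Finset.sum_le_sum fun j _ => ?_
          have ht0 : 0 ≤ t i j := le_trans (by positivity) (ht i j).1
          rw [norm_mul, Complex.norm_real, Real.norm_of_nonneg ht0]
          exact mul_le_mul (ht i j).2 (hmax j) (norm_nonneg _) (by positivity)
      _ = C * Y := by simp; field_simp
  -- Subtracting the two equations leaves a quadratic remainder and `g G Υ`. The former is at most
  -- `b C c₀ Y`, which the condition on `c₀` lets the left side absorb.
  have key := h.linear_stability hτ hC ha hb ht hz0 hg (v := fun i => G i - g i)
    (r := fun i => g i * (G i - g i) * ∑ j, (t i j : ℂ) * (G j - g j) + g i * G i * Υ i)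
    (fun i => ?_) (ρ := b * C * c₀ * Y + b * (b + c₀) * ρ) (fun i => ?_) i₀
  · change Y ≤ _ at key
    nlinarith [mul_le_mul_of_nonneg_right hc₀ hY0]
  · have h1 : ∑ j, (t i j : ℂ) * (G j - g j) =
        (∑ j, (t i j : ℂ) * G j) - ∑ j, (t i j : ℂ) * g j := by
      rw [← Finset.sum_sub_distrib]
      exact Finset.sum_congr rfl fun j _ => by ring
    rw [h1]
    linear_combination (-g i) * (hG i) + G i * (h.eqn i)
  · have hGn : ‖G i‖ ≤ b + c₀ := by
      calc ‖G i‖ = ‖g i + (G i - g i)‖ := by ring_nf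
        _ ≤ _ := (norm_add_le _ _).trans (add_le_add (hg.norm_le i) (hclose i))
    refine (norm_add_le _ _).trans (add_le_add ?_ ?_)
    · rw [norm_mul, norm_mul]
      calc ‖g i‖ * ‖G i - g i‖ * ‖∑ j, (t i j : ℂ) * (G j - g j)‖ ≤ b * c₀ * (C * Y) :=
            mul_le_mul (mul_le_mul (hg.norm_le i) (hclose i) (norm_nonneg _) hb.le) (hT i)
              (norm_nonneg _) (by positivity)
        _ = _ := by ring
    · rw [norm_mul, norm_mul]
      exact mul_le_mul (mul_le_mul (hg.norm_le i) hGn (norm_nonneg _) hb.le) (hΥ i)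
        (norm_nonneg _) (by positivity)

/-- Stability of the quadratic vector equation where the solution and its perturbation are small
(in particular at large imaginary part). -/
lemma SolvesVectorQVE.stability_of_norm_le {C K : ℝ} (hC : 0 < C) (hK : K ^ 2 * C ≤ 1 / 2)
    (ht : ∀ i j, t i j ∈ Icc 0 (C / N))
    (h : SolvesVectorQVE t z g) (hgK : ∀ i, ‖g i‖ ≤ K) {G Υ : Fin N → ℂ}
    (hG : ∀ i, G i * (z + ∑ j, (t i j : ℂ) * G j + Υ i) = -1)
    (hGK : ∀ i, ‖G i‖ ≤ K) {ρ : ℝ} (hΥ : ∀ i, ‖Υ i‖ ≤ ρ) (i : Fin N) :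
    ‖G i - g i‖ ≤ 2 * K ^ 2 * ρ := by
  have hN : (0 : ℝ) < N := by exact_mod_cast i.pos
  have hK0 : 0 ≤ K := (norm_nonneg _).trans (hgK i)
  obtain ⟨i₀, -, hi₀⟩ := Finset.exists_max_image Finset.univ (fun i => ‖G i - g i‖)
    ⟨i, Finset.mem_univ i⟩
  set Y := ‖G i₀ - g i₀‖ with hY
  have hmax : ∀ j, ‖G j - g j‖ ≤ Y := fun j => hi₀ j (Finset.mem_univ j)
  refine (hmax i).trans ?_
  have hY0 : 0 ≤ Y := norm_nonneg _
  have h1 : G i₀ - g i₀ = G i₀ * g i₀ * (∑ j, (t i₀ j : ℂ) * (G j - g j) + Υ i₀) := by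
    have h1 : ∑ j, (t i₀ j : ℂ) * (G j - g j) =
        (∑ j, (t i₀ j : ℂ) * G j) - ∑ j, (t i₀ j : ℂ) * g j := by
      rw [← Finset.sum_sub_distrib]
      exact Finset.sum_congr rfl fun j _ => by ring
    rw [h1]
    linear_combination (-g i₀) * (hG i₀) + G i₀ * (h.eqn i₀)
  have h2 : ‖∑ j, (t i₀ j : ℂ) * (G j - g j) + Υ i₀‖ ≤ C * Y + ρ := by
    refine (norm_add_le _ _).trans (add_le_add ?_ (hΥ i₀))
    calc _ ≤ ∑ j, ‖(t i₀ j : ℂ) * (G j - g j)‖ := norm_sum_le _ _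
      _ ≤ ∑ _j : Fin N, C / N * Y := by
          refine Finset.sum_le_sum fun j _ => ?_
          rw [norm_mul, Complex.norm_real, Real.norm_of_nonneg (ht i₀ j).1]
          exact mul_le_mul (ht i₀ j).2 (hmax j) (norm_nonneg _) (by positivity)
      _ = C * Y := by simp; field_simp
  have h3 : Y ≤ K * K * (C * Y + ρ) := by
    calc Y = ‖G i₀‖ * ‖g i₀‖ * ‖∑ j, (t i₀ j : ℂ) * (G j - g j) + Υ i₀‖ := by
          rw [← norm_mul, ← norm_mul, ← h1]
      _ ≤ _ := mul_le_mul (mul_le_mul (hGK _) (hgK _) (norm_nonneg _) hK0) h2 (norm_nonneg _)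
          (by positivity)
  nlinarith [mul_le_mul_of_nonneg_right hK hY0]

/-- Lipschitz continuity of the solution in the spectral parameter. -/
lemma SolvesVectorQVE.norm_sub_le {b m : ℝ} {z' : ℂ} {g' : Fin N → ℂ} (hm : 0 < m)
    (ht : ∀ i j, 0 ≤ t i j) (hz : m ≤ z.im) (hz' : m ≤ z'.im)
    (h : SolvesVectorQVE t z g) (h' : SolvesVectorQVE t z' g')
    (hb : ∀ i, ‖g i‖ ≤ b) (hb' : ∀ i, ‖g' i‖ ≤ b) (i : Fin N) :
    ‖g i - g' i‖ ≤ b * (‖z - z'‖ / m) := by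
  have hb0 : 0 ≤ b := (norm_nonneg _).trans (hb i)
  -- The right weight for comparing two solutions: by `im_eq`, `s i = |g i| |g' i| √(x x')` with the
  -- `x`, `x'` of that row, while Cauchy–Schwarz bounds the kernel applied to `s` by `√(x x') - m`.
  -- The gap `m` controls the maximal ratio.
  set s : Fin N → ℝ := fun i => √((g i).im * (g' i).im) with hs
  have hspos : ∀ i, 0 < s i := fun i => Real.sqrt_pos.2 (mul_pos (h.im_pos i) (h'.im_pos i))
  have hsb : ∀ i, s i ≤ b := fun i => by
    refine Real.sqrt_le_iff.2 ⟨hb0, ?_⟩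
    rw [sq]
    exact mul_le_mul ((im_le_norm _).trans (hb i)) ((im_le_norm _).trans (hb' i))
      (h'.im_pos i).le hb0
  obtain ⟨i₀, -, hi₀⟩ := Finset.exists_max_image Finset.univ (fun i => ‖g i - g' i‖ / s i)
    ⟨i, Finset.mem_univ i⟩
  set M := ‖g i₀ - g' i₀‖ / s i₀ with hM
  have hM0 : 0 ≤ M := div_nonneg (norm_nonneg _) (hspos i₀).le
  have hmax : ∀ j, ‖g j - g' j‖ ≤ M * s j := fun j =>
    (div_le_iff₀ (hspos j)).1 (hi₀ j (Finset.mem_univ j))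
  suffices hfin : M ≤ ‖z - z'‖ / m by
    refine (hmax i).trans ?_
    rw [mul_comm]
    exact mul_le_mul (hsb i) hfin hM0 hb0
  set x := z.im + ∑ j, t i₀ j * (g j).im with hx
  set x' := z'.im + ∑ j, t i₀ j * (g' j).im with hx'
  have hS0 : 0 ≤ ∑ j, t i₀ j * (g j).im :=
    Finset.sum_nonneg fun j _ => mul_nonneg (ht _ _) (h.im_pos j).le
  have hS0' : 0 ≤ ∑ j, t i₀ j * (g' j).im :=
    Finset.sum_nonneg fun j _ => mul_nonneg (ht _ _) (h'.im_pos j).le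
  have hsum : ∑ j, t i₀ j * s j ≤ √(x * x') - m := by
    have hcs : ∑ j, t i₀ j * s j ≤
        √(∑ j, t i₀ j * (g j).im) * √(∑ j, t i₀ j * (g' j).im) := by
      refine le_trans (le_of_eq ?_) (Real.sum_sqrt_mul_sqrt_le (f := fun j => t i₀ j * (g j).im)
        (g := fun j => t i₀ j * (g' j).im) Finset.univ
        (fun j => mul_nonneg (ht _ _) (h.im_pos j).le)
        (fun j => mul_nonneg (ht _ _) (h'.im_pos j).le))
      refine Finset.sum_congr rfl fun j _ => ?_
      rw [← Real.sqrt_mul (mul_nonneg (ht _ _) (h.im_pos j).le), hs,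
        show t i₀ j * (g j).im * (t i₀ j * (g' j).im) = (t i₀ j) ^ 2 * ((g j).im * (g' j).im) by
          ring, Real.sqrt_mul (sq_nonneg _), Real.sqrt_sq (ht _ _)]
    refine hcs.trans ?_
    have hxm : m ≤ x := by linarith
    have hxm' : m ≤ x' := by linarith
    have hmle : m ≤ √(x * x') := Real.le_sqrt_of_sq_le (by nlinarith)
    calc √(∑ j, t i₀ j * (g j).im) * √(∑ j, t i₀ j * (g' j).im)
        ≤ √(x - m) * √(x' - m) := mul_le_mul (Real.sqrt_le_sqrt (by linarith))
          (Real.sqrt_le_sqrt (by linarith)) (Real.sqrt_nonneg _) (Real.sqrt_nonneg _)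
      _ = √((x - m) * (x' - m)) := (Real.sqrt_mul (by linarith) _).symm
      _ ≤ √(x * x') - m := by
          refine Real.sqrt_le_iff.2 ⟨by linarith, ?_⟩
          have h1 : √(x * x') ^ 2 = x * x' := Real.sq_sqrt (by nlinarith)
          have h2 : 2 * √(x * x') ≤ x + x' := by
            have := abs_le_of_sq_le_sq' (a := 2 * √(x * x')) (b := x + x')
              (by nlinarith [sq_nonneg (x - x')]) (by linarith)
            exact this.2
          nlinarith
  have h1 : g i₀ - g' i₀ = g i₀ * g' i₀ * (∑ j, (t i₀ j : ℂ) * (g j - g' j) + (z - z')) := by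
    have h1 : ∑ j, (t i₀ j : ℂ) * (g j - g' j) =
        (∑ j, (t i₀ j : ℂ) * g j) - ∑ j, (t i₀ j : ℂ) * g' j := by
      rw [← Finset.sum_sub_distrib]
      exact Finset.sum_congr rfl fun j _ => by ring
    rw [h1]
    linear_combination (-g' i₀) * (h.eqn i₀) + g i₀ * (h'.eqn i₀)
  have h2 : ‖∑ j, (t i₀ j : ℂ) * (g j - g' j) + (z - z')‖ ≤ M * (√(x * x') - m) + ‖z - z'‖ := by
    refine (norm_add_le _ _).trans (add_le_add_left ?_ _)
    calc _ ≤ ∑ j, ‖(t i₀ j : ℂ) * (g j - g' j)‖ := norm_sum_le _ _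
      _ ≤ ∑ j, M * (t i₀ j * s j) := by
          refine Finset.sum_le_sum fun j _ => ?_
          rw [norm_mul, Complex.norm_real, Real.norm_of_nonneg (ht _ _), mul_left_comm]
          exact mul_le_mul_of_nonneg_left (hmax j) (ht _ _)
      _ ≤ _ := by
          rw [← Finset.mul_sum]
          exact mul_le_mul_of_nonneg_left hsum hM0
  have h3 : s i₀ = ‖g i₀‖ * ‖g' i₀‖ * √(x * x') := by
    rw [hs]
    dsimp only
    rw [h.im_eq i₀, h'.im_eq i₀, ← hx, ← hx',
      show ‖g i₀‖ ^ 2 * x * (‖g' i₀‖ ^ 2 * x') = (‖g i₀‖ * ‖g' i₀‖) ^ 2 * (x * x') by ring,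
      Real.sqrt_mul (sq_nonneg _), Real.sqrt_sq (by positivity)]
  have h4 : M * s i₀ ≤ ‖g i₀‖ * ‖g' i₀‖ * (M * (√(x * x') - m) + ‖z - z'‖) := by
    rw [hM, div_mul_cancel₀ _ (hspos i₀).ne']
    calc ‖g i₀ - g' i₀‖ = ‖g i₀‖ * ‖g' i₀‖ * ‖∑ j, (t i₀ j : ℂ) * (g j - g' j) + (z - z')‖ := by
          rw [← norm_mul, ← norm_mul, ← h1]
      _ ≤ _ := mul_le_mul_of_nonneg_left h2 (by positivity)
  have hpos : 0 < ‖g i₀‖ * ‖g' i₀‖ := mul_pos (h.norm_pos _) (h'.norm_pos _)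
  rw [le_div_iff₀ hm]
  have h5 : M * √(x * x') ≤ M * (√(x * x') - m) + ‖z - z'‖ := by
    refine le_of_mul_le_mul_left ?_ hpos
    calc ‖g i₀‖ * ‖g' i₀‖ * (M * √(x * x')) = M * s i₀ := by rw [h3]; ring
      _ ≤ _ := h4
  linarith

end VectorEquation

/-! ### From the integral equation to the finite system -/

section StepFunctions

variable {N : ℕ}

lemma eq_of_mem_cell {i j : Fin N} {y : ℝ} (hi : y ∈ cell N i) (hj : y ∈ cell N j) : i = j := by
  have hN' : (0 : ℝ) < N := by exact_mod_cast i.pos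
  obtain ⟨h1, h2⟩ := hi
  obtain ⟨h3, h4⟩ := hj
  rw [div_lt_iff₀ hN'] at h1 h3
  rw [le_div_iff₀ hN'] at h2 h4
  have h5 : ((i : ℕ) : ℝ) < (j : ℕ) + 1 := by linarith
  have h6 : ((j : ℕ) : ℝ) < (i : ℕ) + 1 := by linarith
  have h7 : (i : ℕ) < j + 1 := by exact_mod_cast h5
  have h8 : (j : ℕ) < i + 1 := by exact_mod_cast h6
  exact Fin.ext (by omega)

lemma right_endpoint_mem_cell (i : Fin N) : ((i : ℝ) + 1) / N ∈ cell N i := by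
  have hN' : (0 : ℝ) < N := by exact_mod_cast i.pos
  exact ⟨by gcongr; linarith, le_rfl⟩

lemma right_endpoint_mem_Ioc (i : Fin N) : ((i : ℝ) + 1) / N ∈ Ioc (0 : ℝ) 1 := by
  have hN' : (0 : ℝ) < N := by exact_mod_cast i.pos
  refine ⟨by positivity, (div_le_one hN').2 ?_⟩
  exact_mod_cast i.isLt

lemma indicator_cell {i j : Fin N} {x : ℝ} (hx : x ∈ cell N i) :
    (cell N j).indicator (1 : ℝ → ℝ) x = if j = i then 1 else 0 := by
  split_ifs with h
  · rw [h, indicator_of_mem hx, Pi.one_apply]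
  · exact indicator_of_notMem (fun hj => h (eq_of_mem_cell hj hx)) _

lemma stepKernel_of_mem_cell (t : Matrix (Fin N) (Fin N) ℝ) {i j : Fin N} {x y : ℝ}
    (hx : x ∈ cell N i) (hy : y ∈ cell N j) : stepKernel t x y = N * t i j := by
  simp [stepKernel, indicator_cell hx, indicator_cell hy]

/-- The integral of a step function. -/
lemma integral_of_eq_on_cells (hN : 0 < N) {φ : ℝ → ℂ} {a : Fin N → ℂ}
    (h : ∀ i, ∀ y ∈ cell N i, φ y = a i) :
    ∫ y in (0 : ℝ)..1, φ y = (1 / N : ℂ) * ∑ i, a i := by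
  have hN' : (0 : ℝ) < N := by exact_mod_cast hN
  have hle : ∀ k : ℕ, ((k : ℝ)) / N ≤ ((k + 1 : ℕ) : ℝ) / N := fun k => by
    gcongr; simp
  have hI : ∀ k : ℕ, ∀ hk : k < N, EqOn φ (fun _ => a ⟨k, hk⟩)
      (Ioc ((k : ℝ) / N) (((k + 1 : ℕ) : ℝ) / N)) := fun k hk y hy =>
    h ⟨k, hk⟩ y (by simpa [cell] using hy)
  have h1 := intervalIntegral.sum_integral_adjacent_intervals (f := φ) (μ := volume) (n := N)
    (a := fun k : ℕ => (k : ℝ) / N) (fun k hk => by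
      rw [intervalIntegrable_iff_integrableOn_Ioc_of_le (hle k)]
      exact (integrableOn_congr_fun (hI k hk) measurableSet_Ioc).2 (by simp))
  simp only [Nat.cast_zero, zero_div, div_self hN'.ne'] at h1
  rw [← h1, Finset.sum_range, Finset.mul_sum]
  refine Finset.sum_congr rfl fun k _ => ?_
  rw [intervalIntegral.integral_of_le (hle k), setIntegral_congr_fun measurableSet_Ioc (hI k k.2)]
  rw [setIntegral_const]
  simp only [measureReal_def, Real.volume_Ioc, Fin.eta, Complex.real_smul]
  rw [ENNReal.toReal_ofReal (sub_nonneg.2 (hle k))]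
  push_cast
  congr 1
  field_simp
  ring

variable {t : Matrix (Fin N) (Fin N) ℝ} {g : ℂ → ℝ → ℂ}

lemma SolvesQVE.eq_of_mem_cell (h : SolvesQVE t g) {z : ℂ} (hz : 0 < z.im) {i : Fin N} {x : ℝ}
    (hx : x ∈ cell N i) : g z x = g z (((i : ℝ) + 1) / N) := by
  have hN' : (0 : ℝ) < N := by exact_mod_cast i.pos
  have hx1 : x ∈ Ioc (0 : ℝ) 1 := by
    refine ⟨lt_of_le_of_lt (by positivity) hx.1, hx.2.trans (right_endpoint_mem_Ioc i).2⟩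
  rw [h.eqn z hz x hx1, h.eqn z hz _ (right_endpoint_mem_Ioc i)]
  have : ∀ y, stepKernel t x y = stepKernel t (((i : ℝ) + 1) / N) y := fun y => by
    simp [stepKernel, indicator_cell hx, indicator_cell (right_endpoint_mem_cell i)]
  simp only [this]

lemma SolvesQVE.solvesVectorQVE (h : SolvesQVE t g) {z : ℂ} (hz : 0 < z.im) :
    SolvesVectorQVE t z fun i => g z (((i : ℝ) + 1) / N) := by
  refine ⟨fun i => h.im_pos z hz _ (right_endpoint_mem_Ioc i), fun i => ?_⟩
  have hN' : (N : ℂ) ≠ 0 := by exact_mod_cast i.pos.ne'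
  have h1 := h.eqn z hz _ (right_endpoint_mem_Ioc i)
  rw [integral_of_eq_on_cells i.pos (a := fun j => ((N * t i j : ℝ) : ℂ) *
    g z (((j : ℝ) + 1) / N)) (fun j y hy => by
      rw [stepKernel_of_mem_cell t (right_endpoint_mem_cell i) hy, h.eq_of_mem_cell hz hy]),
    Finset.mul_sum] at h1
  have h2 : ∑ j, (1 / N : ℂ) * (((N * t i j : ℝ) : ℂ) * g z (((j : ℝ) + 1) / N)) =
      ∑ j, (t i j : ℂ) * g z (((j : ℝ) + 1) / N) :=
    Finset.sum_congr rfl fun j _ => by push_cast; field_simp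
  rw [h2] at h1
  have h3 : z + ∑ j, (t i j : ℂ) * g z (((j : ℝ) + 1) / N) ≠ 0 := fun h0 => by
    have := h.im_pos z hz _ (right_endpoint_mem_Ioc i)
    rw [h1, h0, div_zero] at this
    simp at this
  rw [h1, div_mul_cancel₀ _ h3]

lemma SolvesQVE.qveMean_eq (h : SolvesQVE t g) (hN : 0 < N) {z : ℂ} (hz : 0 < z.im) :
    qveMean g z = (1 / N : ℂ) * ∑ i : Fin N, g z (((i : ℝ) + 1) / N) :=
  integral_of_eq_on_cells hN fun _ _ hy => h.eq_of_mem_cell hz hy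

end StepFunctions

/-! ### Large deviations for linear and quadratic forms in a row -/

section RowEstimates

variable {N : ℕ}

/-- The resolvent of the matrix without its `i`-th row and column is bounded by `K`. -/
def BoundedMinor (K : ℝ) (H : Matrix (Fin N) (Fin N) ℝ) (i : Fin N) (z : ℂ) : Prop :=
  ∀ k l, k ≠ i → l ≠ i → ‖greenFunction (minorMatrix H i) z k l‖ ≤ K

/-- The linear and quadratic forms in the entries of each row, with coefficients from the resolvent
of the corresponding minor, have their typical size. -/
structure RowEstimates (σ : Matrix (Fin N) (Fin N) ℝ) (K b b₂ : ℝ)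
    (H : Matrix (Fin N) (Fin N) ℝ) (z : ℂ) : Prop where
  lin : ∀ i j, j ≠ i → BoundedMinor K H i z →
    ‖∑ k ∈ Finset.univ.erase i, (H i k : ℂ) * greenFunction (minorMatrix H i) z k j‖ ≤ b
  diag : ∀ i, BoundedMinor K H i z →
    ‖∑ k ∈ Finset.univ.erase i, ((H i k ^ 2 - σ i k : ℝ) : ℂ) *
      greenFunction (minorMatrix H i) z k k‖ ≤ b
  quad : ∀ i, BoundedMinor K H i z →
    ‖∑ l ∈ Finset.univ.erase i, (H i l : ℂ) * ∑ k ∈ (Finset.univ.erase i).filter (· < l),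
      (H i k : ℂ) * greenFunction (minorMatrix H i) z k l‖ ≤ b₂

variable {V : Type*}

variable {val : UpperIndex N → V → ℝ}

lemma configMatrix_isSymm (x : UpperIndex N → V) : (configMatrix val x).IsSymm := by
  ext i j
  simp [configMatrix, upperIndex_comm i j]

/-- This is the independence of a row from its minor, and the source of predictability of all
coefficients below. -/
lemma minorMatrix_configMatrix_update (x : UpperIndex N → V) (i l : Fin N) (v : V) :
    minorMatrix (configMatrix val (Function.update x (upperIndex i l) v)) i =
      minorMatrix (configMatrix val x) i := by
  ext k m
  simp only [minorMatrix, configMatrix, Matrix.of_apply]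
  split_ifs with h
  · rfl
  · push Not at h
    rw [Function.update_of_ne (upperIndex_ne h.1 h.2)]

lemma boundedMinor_update {K : ℝ} {z : ℂ} (x : UpperIndex N → V) (i l : Fin N) (v : V) :
    BoundedMinor K (configMatrix val (Function.update x (upperIndex i l) v)) i z ↔
      BoundedMinor K (configMatrix val x) i z := by
  simp only [BoundedMinor, minorMatrix_configMatrix_update]

lemma configMatrix_update_of_ne (x : UpperIndex N → V) {i k l : Fin N} (h : k ≠ l) (v : V) :
    configMatrix val (Function.update x (upperIndex i l) v) i k = configMatrix val x i k := by
  simp only [configMatrix, Matrix.of_apply]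
  rw [Function.update_of_ne fun h' => h (upperIndex_injective i h')]

variable [Fintype V]

/-- A finite model of independent centered entries bounded by `M` with variances at most `C/N`. -/
structure IsSparseModel (w val : UpperIndex N → V → ℝ) (M C : ℝ) : Prop where
  nonneg : ∀ e v, 0 ≤ w e v
  sum_one : ∀ e, ∑ v, w e v = 1
  mean : ∀ e, ∑ v, w e v * val e v = 0
  bound : ∀ e v, |val e v| ≤ M
  variance : ∀ e, ∑ v, w e v * val e v ^ 2 ≤ C / N

/-- The variances of the entries of a finite model. -/
def modelVariance (w val : UpperIndex N → V → ℝ) : Matrix (Fin N) (Fin N) ℝ :=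
  Matrix.of fun i j => ∑ v, w (upperIndex i j) v * val (upperIndex i j) v ^ 2

variable {w : UpperIndex N → V → ℝ} {M C : ℝ}
variable {K ψ ψ₂ t : ℝ} {z : ℂ}

lemma sum_norm_sq_minor_le {H : Matrix (Fin N) (Fin N) ℝ} (hH : H.IsSymm) (hz : 0 < z.im)
    {i j : Fin N} (hj : j ≠ i) (hB : BoundedMinor K H i z) (s : Finset (Fin N)) :
    ∑ k ∈ s, ‖greenFunction (minorMatrix H i) z k j‖ ^ 2 ≤ K / z.im := by
  refine (Finset.sum_le_univ_sum_of_nonneg fun k => by positivity).trans ?_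
  refine (sum_norm_sq_greenFunction_le (minorMatrix_isSymm hH i) hz j).trans ?_
  exact div_le_div_of_nonneg_right (hB j j hj hj) hz.le

lemma IsSparseModel.prob_lin_gt_le (hw : IsSparseModel w val M C) (hM : 0 ≤ M) (hC : 0 ≤ C)
    (hz : 0 < z.im) (hK : 0 ≤ K) (hψ : 0 < ψ) (h1 : M * K ≤ ψ)
    (h2 : C / N * (K / z.im) ≤ ψ ^ 2) {i j : Fin N} (hj : j ≠ i) {s : Finset (Fin N)}
    (hs : s ⊆ Finset.univ.erase i) :
    prob w (fun x => BoundedMinor K (configMatrix val x) i z ∧ 2 * t * ψ <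
      ‖∑ k ∈ s, (configMatrix val x i k : ℂ) *
        greenFunction (minorMatrix (configMatrix val x) i) z k j‖) ≤ 4 * Real.exp (1 - t) := by
  classical
  have h := prob_norm_sum_gt_le (key := upperIndex i) (ξ := fun k v => val (upperIndex i k) v)
    (M := M) (σ := C / N) (ψ := ψ)
    -- Truncating off the event `BoundedMinor` makes the coefficient bounds deterministic; the event
    -- ignores row `i`, so predictability survives.
    (b := fun k x => if k ≠ i ∧ BoundedMinor K (configMatrix val x) i z then
      greenFunction (minorMatrix (configMatrix val x) i) z k j else 0)
    hw.nonneg hw.sum_one (upperIndex_injective i) hM (by positivity) (fun k => hw.mean _)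
    (fun k v => hw.bound _ v) (fun k => hw.variance _)
    (fun k l _ x v => by
      simp only [boundedMinor_update, minorMatrix_configMatrix_update]) s hψ
    (fun k x => ?_) (fun x => ?_) t
  · refine (prob_mono hw.nonneg fun x hx => ?_).trans h
    refine hx.2.trans_eq ?_
    congr 1
    refine Finset.sum_congr rfl fun k hk => ?_
    rw [if_pos ⟨Finset.ne_of_mem_erase (hs hk), hx.1⟩]
    rfl
  · split_ifs with hB
    · exact (mul_le_mul_of_nonneg_left (hB.2 k j hB.1 hj) hM).trans h1
    · simpa using hψ.le
  · refine le_trans (mul_le_mul_of_nonneg_left ?_ (by positivity)) h2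
    by_cases hB : BoundedMinor K (configMatrix val x) i z
    · refine le_trans (Finset.sum_le_sum fun k _ => ?_)
        (sum_norm_sq_minor_le (configMatrix_isSymm x) hz hj hB s)
      split_ifs
      · exact le_rfl
      · rw [norm_zero, zero_pow two_ne_zero]; positivity
    · have h0 : 0 ≤ K / z.im := div_nonneg hK hz.le
      simpa [hB] using h0

/-- The centered squares are bounded by `M²` with variance at most `M² C/N`. Hence the crude bound
`N K²` for the sum of squared coefficients suffices, and Ward is not needed. -/
lemma IsSparseModel.prob_diag_gt_le (hw : IsSparseModel w val M C) (hC : 0 ≤ C)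
    (hK : 0 ≤ K) (hψ : 0 < ψ) (h1 : M ^ 2 * K ≤ ψ)
    (h2 : M ^ 2 * C * K ^ 2 ≤ ψ ^ 2) (i : Fin N) :
    prob w (fun x => BoundedMinor K (configMatrix val x) i z ∧ 2 * t * ψ <
      ‖∑ k ∈ Finset.univ.erase i, ((configMatrix val x i k ^ 2 - modelVariance w val i k : ℝ) : ℂ) *
        greenFunction (minorMatrix (configMatrix val x) i) z k k‖) ≤ 4 * Real.exp (1 - t) := by
  classical
  have hN : (0 : ℝ) < N := by exact_mod_cast i.pos
  have hsq : ∀ e v, val e v ^ 2 ≤ M ^ 2 := fun e v => by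
    rw [← sq_abs]; exact pow_le_pow_left₀ (abs_nonneg _) (hw.bound e v) 2
  have hσ0 : ∀ k, 0 ≤ modelVariance w val i k := fun k =>
    Finset.sum_nonneg fun v _ => mul_nonneg (hw.nonneg _ _) (sq_nonneg _)
  have hσM : ∀ k, modelVariance w val i k ≤ M ^ 2 := fun k => by
    calc modelVariance w val i k ≤ ∑ v, w (upperIndex i k) v * M ^ 2 :=
          Finset.sum_le_sum fun v _ => mul_le_mul_of_nonneg_left (hsq _ _) (hw.nonneg _ _)
      _ = M ^ 2 := by rw [← Finset.sum_mul, hw.sum_one, one_mul]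
  have h := prob_norm_sum_gt_le (key := upperIndex i)
    (ξ := fun k v => val (upperIndex i k) v ^ 2 - modelVariance w val i k)
    (M := M ^ 2) (σ := M ^ 2 * (C / N)) (ψ := ψ)
    (b := fun k x => if k ≠ i ∧ BoundedMinor K (configMatrix val x) i z then
      greenFunction (minorMatrix (configMatrix val x) i) z k k else 0)
    hw.nonneg hw.sum_one (upperIndex_injective i) (by positivity) (by positivity) (fun k => ?_)
    (fun k v => ?_) (fun k => ?_)
    (fun k l _ x v => by
      simp only [boundedMinor_update, minorMatrix_configMatrix_update]) (Finset.univ.erase i) hψ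
    (fun k x => ?_) (fun x => ?_) t
  · refine (prob_mono hw.nonneg fun x hx => ?_).trans h
    refine hx.2.trans_eq ?_
    congr 1
    refine Finset.sum_congr rfl fun k hk => ?_
    rw [if_pos ⟨Finset.ne_of_mem_erase hk, hx.1⟩]
    rfl
  · simp only [mul_sub, Finset.sum_sub_distrib, ← Finset.sum_mul, hw.sum_one, one_mul]
    exact sub_self _
  · exact abs_le.2 ⟨by linarith [sq_nonneg (val (upperIndex i k) v), hσM k],
      by linarith [hsq (upperIndex i k) v, hσ0 k]⟩
  · have hσ : modelVariance w val i k = ∑ v, w (upperIndex i k) v * val (upperIndex i k) v ^ 2 := rfl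
    calc ∑ v, w (upperIndex i k) v * (val (upperIndex i k) v ^ 2 - modelVariance w val i k) ^ 2
        = ∑ v, w (upperIndex i k) v * val (upperIndex i k) v ^ 4 -
          2 * modelVariance w val i k *
            ∑ v, w (upperIndex i k) v * val (upperIndex i k) v ^ 2 +
          modelVariance w val i k ^ 2 * ∑ v, w (upperIndex i k) v := by
          rw [Finset.mul_sum, Finset.mul_sum, ← Finset.sum_sub_distrib, ← Finset.sum_add_distrib]
          exact Finset.sum_congr rfl fun v _ => by ring
      _ ≤ ∑ v, w (upperIndex i k) v * val (upperIndex i k) v ^ 4 := by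
          rw [← hσ, hw.sum_one]
          nlinarith [sq_nonneg (modelVariance w val i k)]
      _ ≤ ∑ v, M ^ 2 * (w (upperIndex i k) v * val (upperIndex i k) v ^ 2) := by
          refine Finset.sum_le_sum fun v _ => ?_
          have := mul_le_mul_of_nonneg_left (hsq (upperIndex i k) v)
            (mul_nonneg (hw.nonneg (upperIndex i k) v) (sq_nonneg (val (upperIndex i k) v)))
          nlinarith
      _ ≤ M ^ 2 * (C / N) := by
          rw [← Finset.mul_sum]
          exact mul_le_mul_of_nonneg_left (hw.variance _) (sq_nonneg M)
  · split_ifs with hB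
    · exact (mul_le_mul_of_nonneg_left (hB.2 k k hB.1 hB.1) (sq_nonneg M)).trans h1
    · simpa using hψ.le
  · have hle : ∑ k ∈ Finset.univ.erase i, ‖(if k ≠ i ∧ BoundedMinor K (configMatrix val x) i z then
        greenFunction (minorMatrix (configMatrix val x) i) z k k else 0)‖ ^ 2 ≤ N * K ^ 2 := by
      refine (Finset.sum_le_card_nsmul _ _ (K ^ 2) fun k _ => ?_).trans ?_
      · refine pow_le_pow_left₀ (norm_nonneg _) ?_ 2
        split_ifs with hB
        · exact hB.2 k k hB.1 hB.1
        · simpa using hK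
      · rw [nsmul_eq_mul]
        refine mul_le_mul_of_nonneg_right ?_ (sq_nonneg K)
        exact_mod_cast (Finset.card_le_univ _).trans_eq (Fintype.card_fin N)
    refine (mul_le_mul_of_nonneg_left hle (by positivity)).trans (le_trans (le_of_eq ?_) h2)
    field_simp

/-- Restricting to `k < l` makes the inner sums `X l` predictable for the outer sum over `l`. The
linear bound controls every `X l` at once outside a bad event; truncating at that size, the
concentration bound applies a second time. -/
lemma IsSparseModel.prob_quad_gt_le (hw : IsSparseModel w val M C) (hM : 0 ≤ M) (hC : 0 ≤ C)
    (hz : 0 < z.im) (hK : 0 ≤ K) (hψ : 0 < ψ) (h1 : M * K ≤ ψ)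
    (h2 : C / N * (K / z.im) ≤ ψ ^ 2) (hψ₂ : 0 < ψ₂) (ht : 0 ≤ t) (h3 : M * (2 * t * ψ) ≤ ψ₂)
    (h4 : C * (2 * t * ψ) ^ 2 ≤ ψ₂ ^ 2) (i : Fin N) :
    prob w (fun x => BoundedMinor K (configMatrix val x) i z ∧ 2 * t * ψ₂ <
      ‖∑ l ∈ Finset.univ.erase i, (configMatrix val x i l : ℂ) *
        ∑ k ∈ (Finset.univ.erase i).filter (· < l), (configMatrix val x i k : ℂ) *
        greenFunction (minorMatrix (configMatrix val x) i) z k l‖) ≤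
      (N + 1) * (4 * Real.exp (1 - t)) := by
  classical
  have hN : (0 : ℝ) < N := by exact_mod_cast i.pos
  set X : Fin N → (UpperIndex N → V) → ℂ := fun l x =>
    ∑ k ∈ (Finset.univ.erase i).filter (· < l), (configMatrix val x i k : ℂ) *
        greenFunction (minorMatrix (configMatrix val x) i) z k l with hX
  have hXpred : ∀ l m : Fin N, l ≤ m → ∀ x v,
      X l (Function.update x (upperIndex i m) v) = X l x := fun l m hlm x v => by
    refine Finset.sum_congr rfl fun k hk => ?_
    rw [minorMatrix_configMatrix_update, configMatrix_update_of_ne]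
    exact ((Finset.mem_filter.1 hk).2.trans_le hlm).ne
  have hbad : prob w (fun x => ∃ l : Fin N, l ≠ i ∧ BoundedMinor K (configMatrix val x) i z ∧
      2 * t * ψ < ‖X l x‖) ≤ N * (4 * Real.exp (1 - t)) := by
    refine (prob_exists_le hw.nonneg _ (a := 4 * Real.exp (1 - t)) fun l => ?_).trans_eq (by simp)
    by_cases hl : l = i
    · refine le_trans (le_of_eq ?_) (by positivity : (0 : ℝ) ≤ 4 * Real.exp (1 - t))
      simp [prob, expect, hl]
    · exact (prob_mono hw.nonneg fun x hx => hx.2).trans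
        (hw.prob_lin_gt_le hM hC hz hK hψ h1 h2 hl (Finset.filter_subset _ _))
  have h := prob_norm_sum_gt_le (key := upperIndex i) (ξ := fun k v => val (upperIndex i k) v)
    (M := M) (σ := C / N) (ψ := ψ₂)
    (b := fun l x => if ‖X l x‖ ≤ 2 * t * ψ then X l x else 0)
    hw.nonneg hw.sum_one (upperIndex_injective i) hM (by positivity) (fun k => hw.mean _)
    (fun k v => hw.bound _ v) (fun k => hw.variance _)
    (fun l m hlm x v => by simp only [hXpred l m hlm]) (Finset.univ.erase i) hψ₂
    (fun l x => ?_) (fun x => ?_) t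
  · rw [add_mul, one_mul]
    refine (prob_mono hw.nonneg (fun x hx => ?_)).trans
      ((prob_or_le hw.nonneg _ _).trans (add_le_add hbad h))
    by_cases hb : ∃ l : Fin N, l ≠ i ∧ BoundedMinor K (configMatrix val x) i z ∧
      2 * t * ψ < ‖X l x‖
    · exact Or.inl hb
    · right
      push Not at hb
      refine hx.2.trans_eq ?_
      congr 1
      refine Finset.sum_congr rfl fun l hl => ?_
      rw [if_pos (hb l (Finset.ne_of_mem_erase hl) hx.1)]
      rfl
  · split_ifs with hB
    · exact (mul_le_mul_of_nonneg_left hB hM).trans h3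
    · simpa using hψ₂.le
  · have hle : ∑ l ∈ Finset.univ.erase i, ‖(if ‖X l x‖ ≤ 2 * t * ψ then X l x else 0)‖ ^ 2 ≤
        N * (2 * t * ψ) ^ 2 := by
      refine (Finset.sum_le_card_nsmul _ _ ((2 * t * ψ) ^ 2) fun k _ => ?_).trans ?_
      · refine pow_le_pow_left₀ (norm_nonneg _) ?_ 2
        split_ifs with hB
        · exact hB
        · simp only [norm_zero]; positivity
      · rw [nsmul_eq_mul]
        refine mul_le_mul_of_nonneg_right ?_ (sq_nonneg _)
        exact_mod_cast (Finset.card_le_univ _).trans_eq (Fintype.card_fin N)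
    refine (mul_le_mul_of_nonneg_left hle (by positivity)).trans (le_trans (le_of_eq ?_) h4)
    field_simp

/-- The row estimates hold with overwhelming probability. -/
lemma IsSparseModel.prob_not_rowEstimates_le (hw : IsSparseModel w val M C) (hM : 0 ≤ M)
    (hC : 0 ≤ C) (hz : 0 < z.im) (hK : 0 ≤ K) (hψ : 0 < ψ) (h1 : M * K ≤ ψ)
    (h2 : C / N * (K / z.im) ≤ ψ ^ 2) (h1' : M ^ 2 * K ≤ ψ) (h2' : M ^ 2 * C * K ^ 2 ≤ ψ ^ 2)
    (hψ₂ : 0 < ψ₂) (ht : 0 ≤ t) (h3 : M * (2 * t * ψ) ≤ ψ₂)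
    (h4 : C * (2 * t * ψ) ^ 2 ≤ ψ₂ ^ 2) :
    prob w (fun x => ¬ RowEstimates (modelVariance w val) K (2 * t * ψ) (2 * t * ψ₂)
      (configMatrix val x) z) ≤ 8 * N * (N + 1) * Real.exp (1 - t) := by
  classical
  have e1 : prob w (fun x => ∃ p : Fin N × Fin N, p.2 ≠ p.1 ∧
      BoundedMinor K (configMatrix val x) p.1 z ∧ 2 * t * ψ <
      ‖∑ k ∈ Finset.univ.erase p.1, (configMatrix val x p.1 k : ℂ) *
        greenFunction (minorMatrix (configMatrix val x) p.1) z k p.2‖) ≤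
      (N * N) * (4 * Real.exp (1 - t)) := by
    refine (prob_exists_le hw.nonneg _ (a := 4 * Real.exp (1 - t)) fun p => ?_).trans_eq (by simp)
    by_cases hp : p.2 = p.1
    · refine le_trans (le_of_eq ?_) (by positivity : (0 : ℝ) ≤ 4 * Real.exp (1 - t))
      simp [prob, expect, hp]
    · exact (prob_mono hw.nonneg fun x hx => hx.2).trans
        (hw.prob_lin_gt_le hM hC hz hK hψ h1 h2 hp subset_rfl)
  have e2 := prob_exists_le hw.nonneg _ fun i =>
    hw.prob_diag_gt_le (z := z) (t := t) hC hK hψ h1' h2' i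
  have e3 := prob_exists_le hw.nonneg _ fun i =>
    hw.prob_quad_gt_le hM hC hz hK hψ h1 h2 hψ₂ ht h3 h4 i
  rw [Fintype.card_fin] at e2 e3
  refine (prob_mono hw.nonneg (fun x hx => ?_)).trans ((prob_or_le hw.nonneg _ _).trans
    ((add_le_add ((prob_or_le hw.nonneg _ _).trans (add_le_add e1 e2)) e3).trans
      (le_of_eq (by ring))))
  by_contra hcon
  push Not at hcon
  obtain ⟨⟨c1, c2⟩, c3⟩ := hcon
  exact hx ⟨fun i j hj hB => c1 (i, j) hj hB, c2, c3⟩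

end RowEstimates

/-! ### The self-consistent equation and improvement of rough bounds -/

section SelfConsistent

variable {N : ℕ} {H σ t : Matrix (Fin N) (Fin N) ℝ} {z : ℂ}

lemma sum_sum_eq_diag_add_two_mul {ι : Type*} [LinearOrder ι] (s : Finset ι) (F : ι → ι → ℂ)
    (hF : ∀ k l, F k l = F l k) :
    ∑ l ∈ s, ∑ k ∈ s, F k l = ∑ k ∈ s, F k k + 2 * ∑ l ∈ s, ∑ k ∈ s.filter (· < l), F k l := by
  have h1 : ∀ l ∈ s, ∑ k ∈ s, F k l = F l l + ∑ k ∈ s.filter (· < l), F k l +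
      ∑ k ∈ s.filter (l < ·), F k l := fun l hl => by
    -- The diagonal term becomes a sum with an indicator, so that trichotomy settles the identity
    -- termwise.
    rw [Finset.sum_filter, Finset.sum_filter, add_assoc, ← Finset.sum_add_distrib,
      ← Finset.sum_ite_eq' s l (fun k => F k l) |>.trans (if_pos hl), ← Finset.sum_add_distrib]
    refine Finset.sum_congr rfl fun k _ => ?_
    rcases lt_trichotomy k l with h | h | h
    · simp [h, h.ne, h.not_gt]
    · simp [h]
    · simp [h, h.ne', h.not_gt]
  have h2 : ∑ l ∈ s, ∑ k ∈ s.filter (l < ·), F k l = ∑ l ∈ s, ∑ k ∈ s.filter (· < l), F k l := by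
    simp only [Finset.sum_filter]
    rw [Finset.sum_comm]
    refine Finset.sum_congr rfl fun k _ => Finset.sum_congr rfl fun l _ => ?_
    rw [hF]
  rw [Finset.sum_congr rfl h1, Finset.sum_add_distrib, Finset.sum_add_distrib, h2]
  ring

lemma RowEstimates.norm_offDiag_le {K b b₂ : ℝ} (hH : H.IsSymm) (hz : 0 < z.im)
    (hR : RowEstimates σ K b b₂ H z) (hG : ∀ i j, ‖greenFunction H z i j‖ ≤ K)
    (hB : ∀ i, BoundedMinor K H i z) {i j : Fin N} (hij : i ≠ j) :
    ‖greenFunction H z i j‖ ≤ K * b := by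
  rw [greenFunction_offDiag hH hz hij.symm, norm_neg, norm_mul]
  exact mul_le_mul (hG i i) (hR.lin i j hij.symm (hB i)) (norm_nonneg _)
    ((norm_nonneg _).trans (hG i i))

/-- The error term in the self-consistent equation for the diagonal resolvent entries. -/
def selfConsistentError (t H : Matrix (Fin N) (Fin N) ℝ) (z : ℂ) (i : Fin N) : ℂ :=
  ∑ l ∈ Finset.univ.erase i, ∑ k ∈ Finset.univ.erase i, (H i l : ℂ) * (H i k : ℂ) *
    greenFunction (minorMatrix H i) z k l - (H i i : ℂ) - ∑ j, (t i j : ℂ) * greenFunction H z j j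

lemma greenFunction_selfConsistent (hH : H.IsSymm) (hz : 0 < z.im) (i : Fin N) :
    greenFunction H z i i * (z + ∑ j, (t i j : ℂ) * greenFunction H z j j +
      selfConsistentError t H z i) = -1 := by
  have h := greenFunction_schur hH hz i
  rw [selfConsistentError]
  linear_combination -h

lemma RowEstimates.norm_selfConsistentError_le {K b b₂ M C d : ℝ} (hK : 0 ≤ K) (hC : 0 ≤ C)
    (hH : H.IsSymm)
    (hz : 0 < z.im) (hR : RowEstimates σ K b b₂ H z) (hG : ∀ i j, ‖greenFunction H z i j‖ ≤ K)
    (hB : ∀ i, BoundedMinor K H i z) (hM : ∀ i j, |H i j| ≤ M)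
    (hσ : ∀ i j, σ i j ∈ Icc 0 (C / N)) (hd : ∀ i j, |σ i j - t i j| ≤ d / N) (i : Fin N) :
    ‖selfConsistentError t H z i‖ ≤ M + b + 2 * b₂ + C * (K * b) + C * K / N + d * K := by
  have hN : (0 : ℝ) < N := by exact_mod_cast i.pos
  set s := Finset.univ.erase i with hs
  set G := greenFunction H z with hGdef
  set G' := greenFunction (minorMatrix H i) z with hG'
  have hcard : ((s.card : ℕ) : ℝ) ≤ N := by
    exact_mod_cast (Finset.card_le_univ s).trans_eq (Fintype.card_fin N)
  have hsym : ∀ k l, G' k l = G' l k := greenFunction_symm (minorMatrix_isSymm hH i)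
  -- In order: the diagonal entry, the fluctuation of the squares, the off-diagonal quadratic form,
  -- the replacement of the minor by `G`, the omitted index `i`, and the mismatch between true
  -- variances and `t`.
  have hdecomp : selfConsistentError t H z i =
      -(H i i : ℂ) + ∑ k ∈ s, ((H i k ^ 2 - σ i k : ℝ) : ℂ) * G' k k +
      2 * ∑ l ∈ s, (H i l : ℂ) * ∑ k ∈ s.filter (· < l), (H i k : ℂ) * G' k l +
      ∑ k ∈ s, (σ i k : ℂ) * (G' k k - G k k) - (σ i i : ℂ) * G i i +
      ∑ k, ((σ i k - t i k : ℝ) : ℂ) * G k k := by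
    have e1 : ∑ l ∈ s, ∑ k ∈ s, (H i l : ℂ) * (H i k : ℂ) * G' k l =
        ∑ k ∈ s, (H i k : ℂ) * (H i k : ℂ) * G' k k +
        2 * ∑ l ∈ s, ∑ k ∈ s.filter (· < l), (H i l : ℂ) * (H i k : ℂ) * G' k l :=
      sum_sum_eq_diag_add_two_mul s (fun k l => (H i l : ℂ) * (H i k : ℂ) * G' k l)
        fun k l => by rw [hsym k l]; ring
    have e2 : ∑ l ∈ s, ∑ k ∈ s.filter (· < l), (H i l : ℂ) * (H i k : ℂ) * G' k l =
        ∑ l ∈ s, (H i l : ℂ) * ∑ k ∈ s.filter (· < l), (H i k : ℂ) * G' k l := by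
      refine Finset.sum_congr rfl fun l _ => ?_
      rw [Finset.mul_sum]
      exact Finset.sum_congr rfl fun k _ => by ring
    have e3 : ∑ k, ((σ i k - t i k : ℝ) : ℂ) * G k k =
        (σ i i : ℂ) * G i i + ∑ k ∈ s, (σ i k : ℂ) * G k k - ∑ k, (t i k : ℂ) * G k k := by
      rw [hs, Finset.add_sum_erase _ (fun k => (σ i k : ℂ) * G k k) (Finset.mem_univ i),
        ← Finset.sum_sub_distrib]
      exact Finset.sum_congr rfl fun k _ => by push_cast; ring
    have e4 : ∑ k ∈ s, ((H i k ^ 2 - σ i k : ℝ) : ℂ) * G' k k +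
        ∑ k ∈ s, (σ i k : ℂ) * (G' k k - G k k) =
        ∑ k ∈ s, (H i k : ℂ) * (H i k : ℂ) * G' k k - ∑ k ∈ s, (σ i k : ℂ) * G k k := by
      rw [← Finset.sum_add_distrib, ← Finset.sum_sub_distrib]
      exact Finset.sum_congr rfl fun k _ => by push_cast; ring
    rw [selfConsistentError, ← hs, ← hG', e1, e2, e3]
    linear_combination -e4
  have b1 : ‖-(H i i : ℂ)‖ ≤ M := by
    rw [norm_neg, Complex.norm_real]; exact hM i i
  have b2 := hR.diag i (hB i)
  have b3 : ‖2 * ∑ l ∈ s, (H i l : ℂ) * ∑ k ∈ s.filter (· < l), (H i k : ℂ) * G' k l‖ ≤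
      2 * b₂ := by
    rw [norm_mul, Complex.norm_two]
    exact mul_le_mul_of_nonneg_left (hR.quad i (hB i)) zero_le_two
  have hb0 : 0 ≤ b := (norm_nonneg _).trans b2
  have b4 : ‖∑ k ∈ s, (σ i k : ℂ) * (G' k k - G k k)‖ ≤ C * (K * b) := by
    calc _ ≤ ∑ k ∈ s, ‖(σ i k : ℂ) * (G' k k - G k k)‖ := norm_sum_le _ _
      _ ≤ ∑ _k ∈ s, C / N * (K * b) := by
          refine Finset.sum_le_sum fun k hk => ?_
          have hki := Finset.ne_of_mem_erase hk
          have h1 : G' k k - G k k = G k i * ∑ l ∈ s, (H i l : ℂ) * G' l k := by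
            have := greenFunction_eq_minorMatrix_sub hH hz hki k
            linear_combination -this
          rw [norm_mul, Complex.norm_real, Real.norm_of_nonneg (hσ i k).1, h1, norm_mul]
          exact mul_le_mul (hσ i k).2 (mul_le_mul (hG k i) (hR.lin i k hki (hB i))
            (norm_nonneg _) hK) (by positivity) (by positivity)
      _ = s.card * (C / N * (K * b)) := by rw [Finset.sum_const, nsmul_eq_mul]
      _ ≤ N * (C / N * (K * b)) := mul_le_mul_of_nonneg_right hcard (by positivity)
      _ = C * (K * b) := by field_simp
  have b5 : ‖(σ i i : ℂ) * G i i‖ ≤ C * K / N := by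
    rw [norm_mul, Complex.norm_real, Real.norm_of_nonneg (hσ i i).1]
    refine (mul_le_mul (hσ i i).2 (hG i i) (norm_nonneg _) (by positivity)).trans_eq ?_
    ring
  have b6 : ‖∑ k, ((σ i k - t i k : ℝ) : ℂ) * G k k‖ ≤ d * K := by
    calc _ ≤ ∑ k, ‖((σ i k - t i k : ℝ) : ℂ) * G k k‖ := norm_sum_le _ _
      _ ≤ ∑ _k : Fin N, d / N * K := by
          refine Finset.sum_le_sum fun k _ => ?_
          rw [norm_mul, Complex.norm_real]
          exact mul_le_mul (hd i k) (hG k k) (norm_nonneg _) ((abs_nonneg _).trans (hd i k))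
      _ = d * K := by simp; field_simp
  rw [hdecomp]
  refine (norm_add_le _ _).trans (add_le_add ((norm_sub_le _ _).trans (add_le_add
    ((norm_add_le _ _).trans (add_le_add ((norm_add_le _ _).trans (add_le_add
    ((norm_add_le _ _).trans (add_le_add b1 b2)) b3)) b4)) b5)) b6)

/-- The resolvent minors are bounded if the resolvent is bounded and its diagonal entries are
bounded from below. -/
lemma boundedMinor_of_norm_le {K₀ a K : ℝ} (hH : H.IsSymm) (hz : 0 < z.im) (ha : 0 < a)
    (hG : ∀ i j, ‖greenFunction H z i j‖ ≤ K₀) {i : Fin N} (hi : a ≤ ‖greenFunction H z i i‖)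
    (hK : K₀ + K₀ * (K₀ / a) ≤ K) : BoundedMinor K H i z := by
  intro k l _ hl
  have h1 := greenFunction_eq_minorMatrix_sub hH hz hl k
  have h2 := greenFunction_offDiag hH hz hl
  set X := ∑ m ∈ Finset.univ.erase i, (H i m : ℂ) * greenFunction (minorMatrix H i) z m l
  -- The linear form is recovered as `-G_il / G_ii`, so no probabilistic input is needed.
  have h3 : ‖X‖ ≤ K₀ / a := by
    rw [le_div_iff₀ ha]
    have h4 : ‖greenFunction H z i i‖ * ‖X‖ ≤ K₀ := by
      rw [← norm_mul, ← norm_neg, ← h2]; exact hG i l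
    nlinarith [norm_nonneg X]
  have h5 : greenFunction (minorMatrix H i) z k l =
      greenFunction H z k l + greenFunction H z k i * X := by
    rw [h1]; ring
  rw [h5]
  refine (norm_add_le _ _).trans (le_trans (add_le_add (hG k l) ?_) hK)
  rw [norm_mul]
  exact mul_le_mul (hG k i) h3 (norm_nonneg _) ((norm_nonneg _).trans (hG k i))

lemma boundedMinor_of_large_im {K : ℝ} (hH : H.IsSymm) (hz : 0 < z.im) (hK : 1 / z.im ≤ K)
    (i : Fin N) : BoundedMinor K H i z := fun k l _ _ =>
  (norm_greenFunction_le (minorMatrix_isSymm hH i) hz k l).trans hK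

/-- The resolvent is entrywise within distance `r` of the diagonal matrix with entries `g`. -/
def IsCloseToDiag (H : Matrix (Fin N) (Fin N) ℝ) (z : ℂ) (g : Fin N → ℂ) (r : ℝ) : Prop :=
  (∀ i, ‖greenFunction H z i i - g i‖ ≤ r) ∧ ∀ i j, i ≠ j → ‖greenFunction H z i j‖ ≤ r

/-- The a priori bound on the resolvent and its minors used in the bootstrap. -/
def resolventBound (a b : ℝ) : ℝ := (b + 1) + (b + 1) * ((b + 1) / (a / 2))

/-- The row estimates improve a rough bound on the resolvent. -/
lemma RowEstimates.isCloseToDiag {τ C a b c₀ r r' ρ : ℝ} {g : Fin N → ℂ} (hτ : 0 < τ)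
    (hC : 0 < C) (ha : 0 < a) (hb : 0 < b)
    (hc₀ : stabilityConstant τ C a b * (b * C * c₀) ≤ 1 / 2) (hc₀a : c₀ ≤ a / 2) (hc₀1 : c₀ ≤ 1)
    (ht : ∀ i j, t i j ∈ Icc (τ / N) (C / N)) (hz : 0 < z.im) (hsol : SolvesVectorQVE t z g)
    (hg : IsBoundedSolution a b g) (hH : H.IsSymm)
    (hR : RowEstimates σ (resolventBound a b) r r' H z)
    (hclose : IsCloseToDiag H z g c₀)
    (herr : (∀ i j, ‖greenFunction H z i j‖ ≤ resolventBound a b) →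
      (∀ i, BoundedMinor (resolventBound a b) H i z) → ∀ i, ‖selfConsistentError t H z i‖ ≤ ρ) :
    IsCloseToDiag H z g (max (2 * stabilityConstant τ C a b * (b * (b + c₀)) * ρ)
      (resolventBound a b * r)) := by
  have hG0 : ∀ i j, ‖greenFunction H z i j‖ ≤ b + 1 := by
    intro i j
    by_cases hij : i = j
    · subst hij
      calc ‖greenFunction H z i i‖ = ‖g i + (greenFunction H z i i - g i)‖ := by ring_nf
        _ ≤ b + 1 := (norm_add_le _ _).trans
          (add_le_add (hg.norm_le i) ((hclose.1 i).trans hc₀1))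
    · exact (hclose.2 i j hij).trans (by linarith)
  have hGlow : ∀ i, a / 2 ≤ ‖greenFunction H z i i‖ := fun i => by
    have h1 : ‖g i‖ ≤ ‖greenFunction H z i i‖ + ‖greenFunction H z i i - g i‖ := by
      calc ‖g i‖ = ‖greenFunction H z i i - (greenFunction H z i i - g i)‖ := by ring_nf
        _ ≤ _ := norm_sub_le _ _
    linarith [hg.norm_ge i, hclose.1 i]
  have hB : ∀ i, BoundedMinor (resolventBound a b) H i z := fun i =>
    boundedMinor_of_norm_le hH hz (half_pos ha) hG0 (hGlow i) le_rfl
  have hG : ∀ i j, ‖greenFunction H z i j‖ ≤ resolventBound a b := fun i j =>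
    (hG0 i j).trans (by unfold resolventBound; exact le_add_of_nonneg_right (by positivity))
  refine ⟨fun i => le_trans ?_ (le_max_left _ _), fun i j hij => le_trans ?_ (le_max_right _ _)⟩
  · exact hsol.stability hτ hC ha hb hc₀ ht hz hg (G := fun i => greenFunction H z i i)
      (fun i => greenFunction_selfConsistent hH hz i) hclose.1 (herr hG hB) i
  · exact hR.norm_offDiag_le hH hz hG hB hij

/-- The initial estimate at large imaginary part. -/
lemma RowEstimates.isCloseToDiag_of_large_im {C K r r' ρ : ℝ} {g : Fin N → ℂ} (hC : 0 < C)
    (hz : 0 < z.im) (hzC : (1 / z.im) ^ 2 * C ≤ 1 / 2) (hK : 1 / z.im ≤ K)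
    (ht : ∀ i j, t i j ∈ Icc 0 (C / N)) (hsol : SolvesVectorQVE t z g) (hH : H.IsSymm)
    (hR : RowEstimates σ K r r' H z)
    (herr : (∀ i j, ‖greenFunction H z i j‖ ≤ K) →
      (∀ i, BoundedMinor K H i z) → ∀ i, ‖selfConsistentError t H z i‖ ≤ ρ) :
    IsCloseToDiag H z g (max (2 * (1 / z.im) ^ 2 * ρ) (K * r)) := by
  have hG : ∀ i j, ‖greenFunction H z i j‖ ≤ K := fun i j =>
    (norm_greenFunction_le hH hz i j).trans hK
  have hB : ∀ i, BoundedMinor K H i z := fun i => boundedMinor_of_large_im hH hz hK i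
  refine ⟨fun i => le_trans ?_ (le_max_left _ _), fun i j hij => le_trans ?_ (le_max_right _ _)⟩
  · refine hsol.stability_of_norm_le hC hzC ht (fun i => hsol.norm_le_of_le hz i ?_)
      (G := fun i => greenFunction H z i i)
      (fun i => greenFunction_selfConsistent hH hz i) (fun i => norm_greenFunction_le hH hz i i)
      (herr hG hB) i
    exact le_add_of_nonneg_right (Finset.sum_nonneg fun j _ =>
      mul_nonneg (ht i j).1 (hsol.im_pos j).le)
  · exact hR.norm_offDiag_le hH hz hG hB hij

/-- At height at least `m` the resolvent entries have Lipschitz constant `m⁻²` and the solution has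
`b/m`. -/
lemma IsCloseToDiag.of_near {z' : ℂ} {b m r D : ℝ} {g g' : Fin N → ℂ} (hH : H.IsSymm)
    (hm : 0 < m) (hz : m ≤ z.im) (hz' : m ≤ z'.im) (ht : ∀ i j, 0 ≤ t i j)
    (hsol : SolvesVectorQVE t z g) (hsol' : SolvesVectorQVE t z' g') (hb : ∀ i, ‖g i‖ ≤ b)
    (hb' : ∀ i, ‖g' i‖ ≤ b) (hD : ‖z - z'‖ * (1 / m * (1 / m)) + b * (‖z - z'‖ / m) ≤ D)
    (hclose : IsCloseToDiag H z g r) : IsCloseToDiag H z' g' (r + D) := by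
  have h1 : ∀ i j, ‖greenFunction H z i j - greenFunction H z' i j‖ ≤
      ‖z - z'‖ * (1 / m * (1 / m)) := fun i j => by
    refine (norm_greenFunction_sub_le hH (hm.trans_le hz) (hm.trans_le hz') i j).trans ?_
    refine mul_le_mul_of_nonneg_left ?_ (norm_nonneg _)
    exact mul_le_mul (one_div_le_one_div_of_le hm hz) (one_div_le_one_div_of_le hm hz')
      (by have := hm.trans_le hz'; positivity) (by positivity)
  have h2 := fun i => hsol.norm_sub_le hm ht hz hz' hsol' hb hb' i
  refine ⟨fun i => ?_, fun i j hij => ?_⟩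
  · calc ‖greenFunction H z' i i - g' i‖ = ‖(greenFunction H z i i - g i) -
          (greenFunction H z i i - greenFunction H z' i i) + (g i - g' i)‖ := by ring_nf
      _ ≤ r + ‖z - z'‖ * (1 / m * (1 / m)) + b * (‖z - z'‖ / m) :=
          (norm_add_le _ _).trans (add_le_add ((norm_sub_le _ _).trans
            (add_le_add (hclose.1 i) (h1 i i))) (h2 i))
      _ ≤ r + D := by linarith
  · have h3 : 0 ≤ b * (‖z - z'‖ / m) := (norm_nonneg _).trans (h2 i)
    calc ‖greenFunction H z' i j‖ = ‖greenFunction H z i j -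
          (greenFunction H z i j - greenFunction H z' i j)‖ := by ring_nf
      _ ≤ r + ‖z - z'‖ * (1 / m * (1 / m)) :=
          (norm_sub_le _ _).trans (add_le_add (hclose.2 i j hij) (h1 i j))
      _ ≤ r + D := by linarith

/-- Nonnegativity of `r` covers empty index sets, on which a real supremum is `0`. -/
lemma IsCloseToDiag.lambdaMax_le {g : ℂ → ℝ → ℂ} {r : ℝ} (hr : 0 ≤ r)
    (h : IsCloseToDiag H z (fun i : Fin N => g z (((i : ℝ) + 1) / N)) r) :
    |lambdaMax H g z| ≤ r := by
  have h1 : lambdaDiag H g z ≤ r := Real.iSup_le h.1 hr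
  have h2 : lambdaOff H z ≤ r := Real.iSup_le (fun e => h.2 _ _ e.2) hr
  have h3 : 0 ≤ lambdaDiag H g z := Real.iSup_nonneg fun i => norm_nonneg _
  rw [lambdaMax, abs_of_nonneg (le_max_of_le_left h3)]
  exact max_le h1 h2

end SelfConsistent

/-! ### The bootstrap in the imaginary part at fixed size -/

section FixedSize

variable {N : ℕ}

/-- The six error terms contribute `1 + 2 + 8 + 2 + 1 + 1 = 15` units. -/
lemma error_sum_le {K C M θ Φ d : ℝ} (hK : 1 ≤ K) (hC : 1 ≤ C) (hθ : 1 ≤ θ) (hΦ : 0 ≤ Φ)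
    (hM : M ≤ Φ) (hN : 1 / (N : ℝ) ≤ Φ) (hd : d ≤ C ^ 2 * Φ) :
    M + 2 * θ * (C * K * Φ) + 2 * (2 * θ * (2 * θ * C * (C * K * Φ))) +
      C * (K * (2 * θ * (C * K * Φ))) + C * K / N + d * K ≤ 15 * C ^ 2 * K ^ 2 * θ ^ 2 * Φ := by
  have hU : ∀ {x : ℝ}, x ≤ C ^ 2 * K ^ 2 * θ ^ 2 → x * Φ ≤ C ^ 2 * K ^ 2 * θ ^ 2 * Φ :=
    fun h => mul_le_mul_of_nonneg_right h hΦ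
  have hC2 : C ≤ C ^ 2 := by nlinarith
  have hK2 : K ≤ K ^ 2 := by nlinarith
  have hθ2 : θ ≤ θ ^ 2 := by nlinarith
  have h1C : 1 ≤ C ^ 2 := hC.trans hC2
  have h1K : 1 ≤ K ^ 2 := hK.trans hK2
  have h1θ : 1 ≤ θ ^ 2 := hθ.trans hθ2
  have hmul : ∀ {x y u : ℝ}, 0 ≤ x → 0 ≤ y → 0 ≤ u → x ≤ C ^ 2 → y ≤ K ^ 2 → u ≤ θ ^ 2 →
      x * y * u ≤ C ^ 2 * K ^ 2 * θ ^ 2 := fun hx hy hu h1 h2 h3 =>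
    mul_le_mul (mul_le_mul h1 h2 hy (by positivity)) h3 hu (by positivity)
  have e1 := hU (hmul zero_le_one zero_le_one zero_le_one h1C h1K h1θ)
  have e2 := hU (hmul (by linarith) (by linarith) (by linarith) hC2 hK2 hθ2)
  have e3 := hU (hmul (by positivity) (by linarith) (by positivity) (le_refl (C ^ 2)) hK2
    (le_refl (θ ^ 2)))
  have e4 := hU (hmul (by positivity) (by positivity) (by linarith) (le_refl (C ^ 2))
    (le_refl (K ^ 2)) hθ2)
  have e5 := hU (hmul (by linarith) (by linarith) zero_le_one hC2 hK2 h1θ)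
  have e6 := hU (hmul (by positivity) (by linarith) zero_le_one (le_refl (C ^ 2)) hK2 h1θ)
  have e7 : C * K / N ≤ C * K * Φ := by
    rw [div_eq_mul_one_div]
    exact mul_le_mul_of_nonneg_left hN (by nlinarith)
  have e8 : d * K ≤ C ^ 2 * Φ * K := mul_le_mul_of_nonneg_right hd (by linarith)
  nlinarith

/-- The constant in the local law. -/
def localLawConstant (τ C a b c₀ : ℝ) : ℝ :=
  15 * C ^ 2 * resolventBound a b ^ 2 * (2 * stabilityConstant τ C a b * (b * (b + c₀)) + 2)

lemma one_le_resolventBound {a b : ℝ} (ha : 0 < a) (hb : 0 < b) : 1 ≤ resolventBound a b := by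
  unfold resolventBound
  have : 0 ≤ (b + 1) * ((b + 1) / (a / 2)) := by positivity
  linarith

variable {H σ t : Matrix (Fin N) (Fin N) ℝ}

/-- The bootstrap along a sequence of spectral parameters. -/
lemma isCloseToDiag_of_rowEstimates {τ C a b c₀ M θ Φ d η D : ℝ} (hτ : 0 < τ) (hC : 1 ≤ C)
    (ha : 0 < a) (hb : 0 < b) (hc₀ : stabilityConstant τ C a b * (b * C * c₀) ≤ 1 / 2)
    (hc₀0 : 0 < c₀) (hc₀a : c₀ ≤ a / 2) (hc₀1 : c₀ ≤ 1) (hθ : 1 ≤ θ) (hΦ : 0 ≤ Φ) (hMΦ : M ≤ Φ)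
    (hNΦ : 1 / (N : ℝ) ≤ Φ) (hdΦ : d ≤ C ^ 2 * Φ) (hη : 0 < η)
    (ht : ∀ i j, t i j ∈ Icc (τ / N) (C / N))
    (hσ : ∀ i j, σ i j ∈ Icc 0 (C / N)) (hd : ∀ i j, |σ i j - t i j| ≤ d / N)
    (hH : H.IsSymm) (hM : ∀ i j, |H i j| ≤ M)
    {g : ℂ → Fin N → ℂ} {ζ : ℕ → ℂ} {n : ℕ} (hζ : ∀ k ≤ n, η ≤ (ζ k).im)
    (hζ0 : 1 ≤ (ζ 0).im) (hζ0' : (1 / (ζ 0).im) ^ 2 * C ≤ 1 / 2)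
    (hstep : ∀ k < n, ‖ζ k - ζ (k + 1)‖ * (1 / η * (1 / η)) +
      b * (‖ζ k - ζ (k + 1)‖ / η) ≤ D)
    (hsol : ∀ k ≤ n, SolvesVectorQVE t (ζ k) (g (ζ k)))
    (hg : ∀ k ≤ n, IsBoundedSolution a b (g (ζ k)))
    (hR : ∀ k ≤ n, RowEstimates σ (resolventBound a b) (2 * θ * (C * resolventBound a b * Φ))
      (2 * θ * (2 * θ * C * (C * resolventBound a b * Φ))) H (ζ k))
    (hsmall : localLawConstant τ C a b c₀ * θ ^ 2 * Φ ≤ c₀ / 2) (hD : D ≤ c₀ / 2) :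
    ∀ k ≤ n, IsCloseToDiag H (ζ k) (g (ζ k)) (localLawConstant τ C a b c₀ * θ ^ 2 * Φ) := by
  set K := resolventBound a b with hKdef
  have hK : 1 ≤ K := one_le_resolventBound ha hb
  have hC0 : 0 < C := by linarith
  have hs := stabilityConstant_pos hτ hC0 ha hb
  set S := 2 * stabilityConstant τ C a b * (b * (b + c₀)) with hS
  have hS0 : 0 ≤ S := by positivity
  have hA : localLawConstant τ C a b c₀ * θ ^ 2 * Φ =
      (S + 2) * (15 * C ^ 2 * K ^ 2 * θ ^ 2 * Φ) := by
    rw [localLawConstant, ← hS, ← hKdef]; ring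
  set ρ := 15 * C ^ 2 * K ^ 2 * θ ^ 2 * Φ with hρ
  have hρ0 : 0 ≤ ρ := by positivity
  have hKr : K * (2 * θ * (C * K * Φ)) ≤ 2 * ρ := by
    have h1 : C * θ ≤ C ^ 2 * θ ^ 2 := by
      have : 1 ≤ C * θ := by nlinarith
      nlinarith
    have h2 := mul_le_mul_of_nonneg_right h1 (by positivity : 0 ≤ K ^ 2 * Φ)
    rw [hρ]
    nlinarith [(by positivity : 0 ≤ C ^ 2 * θ ^ 2 * (K ^ 2 * Φ))]
  have hpos : ∀ k ≤ n, 0 < (ζ k).im := fun k hk => hη.trans_le (hζ k hk)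
  have herr : ∀ k ≤ n, (∀ i j, ‖greenFunction H (ζ k) i j‖ ≤ K) →
      (∀ i, BoundedMinor K H i (ζ k)) → ∀ i, ‖selfConsistentError t H (ζ k) i‖ ≤ ρ :=
    fun k hk hG hB i => ((hR k hk).norm_selfConsistentError_le (by linarith) hC0.le hH (hpos k hk)
      hG hB hM hσ hd i).trans (error_sum_le hK hC hθ hΦ hMΦ hNΦ hdΦ)
  have hweak : ∀ {k r}, r ≤ localLawConstant τ C a b c₀ * θ ^ 2 * Φ →
      IsCloseToDiag H (ζ k) (g (ζ k)) r →
      IsCloseToDiag H (ζ k) (g (ζ k)) (localLawConstant τ C a b c₀ * θ ^ 2 * Φ) :=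
    fun hr h => ⟨fun i => (h.1 i).trans hr, fun i j hij => (h.2 i j hij).trans hr⟩
  intro k
  induction k with
  | zero =>
    intro h0
    have hinv : 1 / (ζ 0).im ≤ 1 := (div_le_one (by linarith)).2 hζ0
    have hinv0 : 0 ≤ 1 / (ζ 0).im := by positivity
    refine hweak ?_ ((hR 0 h0).isCloseToDiag_of_large_im hC0 (hpos 0 h0) hζ0' (hinv.trans hK)
      (fun i j => ⟨(div_nonneg hτ.le (Nat.cast_nonneg N)).trans (ht i j).1, (ht i j).2⟩)
      (hsol 0 h0) hH (herr 0 h0))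
    rw [hA]
    refine max_le ?_ ?_
    · have : (1 / (ζ 0).im) ^ 2 ≤ 1 := pow_le_one₀ hinv0 hinv
      exact mul_le_mul_of_nonneg_right (by linarith) hρ0
    · nlinarith [mul_nonneg hS0 hρ0]
  | succ k ih =>
    intro hk
    have hprev := ih (by omega)
    have hnear := hprev.of_near hH hη (hζ k (by omega)) (hζ (k + 1) hk)
      (fun i j => (div_nonneg hτ.le (Nat.cast_nonneg N)).trans (ht i j).1)
      (hsol k (by omega)) (hsol (k + 1) hk) (hg k (by omega)).norm_le (hg (k + 1) hk).norm_le
      (hstep k (by omega))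
    -- Half of `c₀` is spent on the sharp bound at the previous point, half on the step. Stability
    -- then returns the same sharp bound.
    have hc : IsCloseToDiag H (ζ (k + 1)) (g (ζ (k + 1))) c₀ :=
      ⟨fun i => (hnear.1 i).trans (by linarith), fun i j hij => (hnear.2 i j hij).trans (by linarith)⟩
    refine hweak ?_ ((hR (k + 1) hk).isCloseToDiag hτ hC0 ha hb hc₀ hc₀a hc₀1 ht (hpos _ hk)
      (hsol _ hk) (hg _ hk) hH hc (herr _ hk))
    rw [hA]
    refine max_le ?_ ?_
    · exact mul_le_mul_of_nonneg_right (by linarith) hρ0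
    · nlinarith [mul_nonneg hS0 hρ0]

variable {V : Type*} [Fintype V] {w val : UpperIndex N → V → ℝ}

lemma IsSparseModel.modelVariance_mem {M C : ℝ} (hw : IsSparseModel w val M C) (i j : Fin N) :
    modelVariance w val i j ∈ Icc 0 (C / N) :=
  ⟨Finset.sum_nonneg fun _ _ => mul_nonneg (hw.nonneg _ _) (sq_nonneg _), hw.variance _⟩

/-- The local law at a fixed spectral parameter for a finite model. -/
lemma IsSparseModel.prob_not_isCloseToDiag_le {τ C a b c₀ M θ Φ d η η₀ E : ℝ}
    (hw : IsSparseModel w val M C) (hτ : 0 < τ)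
    (hC : 1 ≤ C) (ha : 0 < a) (hb : 0 < b)
    (hc₀ : stabilityConstant τ C a b * (b * C * c₀) ≤ 1 / 2)
    (hc₀0 : 0 < c₀) (hc₀a : c₀ ≤ a / 2) (hc₀1 : c₀ ≤ 1) (hθ : 1 ≤ θ) (hΦ : 0 < Φ) (hM0 : 0 ≤ M)
    (hM1 : M ≤ 1)
    (hMΦ : M ≤ Φ) (hNΦ : 1 / (N : ℝ) ≤ Φ) (hηΦ : 1 / (N * η) ≤ Φ ^ 2) (hdΦ : d ≤ C ^ 2 * Φ)
    (hη : 0 < η)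
    (hη₀ : η ≤ η₀) (hη₀1 : 1 ≤ η₀) (hη₀C : (1 / η₀) ^ 2 * C ≤ 1 / 2)
    (ht : ∀ i j, t i j ∈ Icc (τ / N) (C / N))
    (hd : ∀ i j, |modelVariance w val i j - t i j| ≤ d / N)
    {g : ℂ → Fin N → ℂ} (hsol : ∀ y : ℝ, 0 < y → SolvesVectorQVE t (E + y * Complex.I)
      (g (E + y * Complex.I)))
    (hg : ∀ y : ℝ, 0 < y → y ≤ η₀ → IsBoundedSolution a b (g (E + y * Complex.I)))
    {n : ℕ} (hn : 0 < n)
    (hstep : η₀ / n * (1 / η * (1 / η)) + b * (η₀ / n / η) ≤ c₀ / 2)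
    (hsmall : localLawConstant τ C a b c₀ * θ ^ 2 * Φ ≤ c₀ / 2) :
    prob w (fun x => ¬ IsCloseToDiag (configMatrix val x) (E + η * Complex.I)
      (g (E + η * Complex.I)) (localLawConstant τ C a b c₀ * θ ^ 2 * Φ)) ≤
      (n + 1) * (8 * N * (N + 1) * Real.exp (1 - θ)) := by
  classical
  set K := resolventBound a b with hKdef
  have hK : 1 ≤ K := one_le_resolventBound ha hb
  have hn' : (0 : ℝ) < n := by exact_mod_cast hn
  -- An equally spaced descent from `η₀` to `η`. The control parameter of the lowest point serves
  -- for the whole grid, since the Ward bound only improves with height.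
  set y : ℕ → ℝ := fun k => η + (η₀ - η) * (1 - k / n) with hy
  set ζ : ℕ → ℂ := fun k => E + y k * Complex.I with hζ
  have him : ∀ k, (ζ k).im = y k := fun k => by simp [hζ]
  have hkn : ∀ k ≤ n, (k : ℝ) / n ∈ Icc (0 : ℝ) 1 := fun k hk =>
    ⟨by positivity, (div_le_one hn').2 (by exact_mod_cast hk)⟩
  have hy1 : ∀ k ≤ n, η ≤ y k := fun k hk => by
    have := mul_nonneg (sub_nonneg.2 hη₀) (sub_nonneg.2 (hkn k hk).2)
    simp only [hy]; linarith
  have hy2 : ∀ k ≤ n, y k ≤ η₀ := fun k hk => by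
    have := mul_nonneg (sub_nonneg.2 hη₀) (hkn k hk).1
    simp only [hy]; linarith
  have hy0 : y 0 = η₀ := by simp [hy]
  have hyn : y n = η := by simp [hy, div_self hn'.ne']
  have hdist : ∀ k, ‖ζ k - ζ (k + 1)‖ ≤ η₀ / n := fun k => by
    have : ζ k - ζ (k + 1) = (((η₀ - η) / n : ℝ) : ℂ) * Complex.I := by
      simp only [hζ, hy]
      push_cast
      field_simp
      ring
    rw [this, norm_mul, Complex.norm_I, mul_one, Complex.norm_real,
      Real.norm_of_nonneg (div_nonneg (sub_nonneg.2 hη₀) hn'.le)]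
    exact div_le_div_of_nonneg_right (by linarith) hn'.le
  have hCKΦ : Φ ≤ C * K * Φ := le_mul_of_one_le_left hΦ.le (by nlinarith)
  have hψ : 0 < C * K * Φ := by positivity
  have hfail : ∀ k : Fin (n + 1), prob w (fun x => ¬ RowEstimates (modelVariance w val) K
      (2 * θ * (C * K * Φ)) (2 * θ * (2 * θ * C * (C * K * Φ))) (configMatrix val x) (ζ k)) ≤
      8 * N * (N + 1) * Real.exp (1 - θ) := by
    intro k
    have hk : (k : ℕ) ≤ n := Nat.lt_succ_iff.1 k.2
    have hMK : M * K ≤ C * K * Φ := by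
      calc M * K ≤ Φ * K := mul_le_mul_of_nonneg_right hMΦ (by linarith)
        _ ≤ C * (Φ * K) := le_mul_of_one_le_left (by positivity) hC
        _ = _ := by ring
    refine hw.prob_not_rowEstimates_le hM0 (by linarith) (by rw [him]; exact hη.trans_le (hy1 k hk))
      (by linarith) hψ hMK ?_ ?_ ?_ (by positivity) (by linarith) ?_ ?_
    · rw [him]
      calc C / N * (K / y k) ≤ C / N * (K / η) :=
            mul_le_mul_of_nonneg_left (div_le_div_of_nonneg_left (by linarith) hη (hy1 k hk))
              (by positivity)
        _ = C * K * (1 / (N * η)) := by ring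
        _ ≤ C * K * Φ ^ 2 := mul_le_mul_of_nonneg_left hηΦ (by positivity)
        _ ≤ (C * K) * (C * K * Φ ^ 2) :=
            le_mul_of_one_le_left (by positivity) (by nlinarith)
        _ = _ := by ring
    · refine le_trans ?_ hMK
      exact mul_le_mul_of_nonneg_right (by nlinarith) (by linarith)
    · have h1 : M ^ 2 ≤ Φ ^ 2 := pow_le_pow_left₀ hM0 hMΦ 2
      calc M ^ 2 * C * K ^ 2 = M ^ 2 * (C * K ^ 2) := by ring
        _ ≤ Φ ^ 2 * (C * (C * K ^ 2)) := mul_le_mul h1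
            (le_mul_of_one_le_left (by positivity) hC) (by positivity) (by positivity)
        _ = _ := by ring
    · have h1 : M ≤ C := hM1.trans hC
      calc M * (2 * θ * (C * K * Φ)) ≤ C * (2 * θ * (C * K * Φ)) :=
            mul_le_mul_of_nonneg_right h1 (by positivity)
        _ = _ := by ring
    · calc C * (2 * θ * (C * K * Φ)) ^ 2 ≤ C * (C * (2 * θ * (C * K * Φ)) ^ 2) :=
            le_mul_of_one_le_left (by positivity) hC
        _ = _ := by ring
  have hall := prob_exists_le hw.nonneg _ hfail
  rw [Fintype.card_fin] at hall
  push_cast at hall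
  refine (prob_mono hw.nonneg fun x hx => ?_).trans hall
  by_contra hcon
  push Not at hcon
  refine hx ?_
  have := isCloseToDiag_of_rowEstimates (D := c₀ / 2) hτ hC ha hb hc₀ hc₀0 hc₀a hc₀1 hθ hΦ.le hMΦ
    hNΦ hdΦ hη ht hw.modelVariance_mem hd (configMatrix_isSymm x) (fun i j => hw.bound _ _) (g := g)
    (ζ := ζ) (n := n)
    (fun k hk => by rw [him]; exact hy1 k hk) (by rw [him, hy0]; exact hη₀1)
    (by rw [him, hy0]; exact hη₀C) (fun k hk => ?_)
    (fun k hk => hsol _ (hη.trans_le (hy1 k hk)))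
    (fun k hk => hg _ (hη.trans_le (hy1 k hk)) (hy2 k hk))
    (fun k hk => hcon ⟨k, Nat.lt_succ_iff.2 hk⟩) hsmall le_rfl n le_rfl
  · simpa only [hζ, hyn] using this
  · refine le_trans (add_le_add ?_ ?_) hstep
    · exact mul_le_mul_of_nonneg_right (hdist k) (by positivity)
    · exact mul_le_mul_of_nonneg_left (div_le_div_of_nonneg_right (hdist k) hη.le) hb.le

end FixedSize

/-! ### The two ensembles as finite sparse models -/

section Models

variable {N : ℕ} {Ω : Type*} [MeasurableSpace Ω] {μ : Measure Ω}
  {q C : ℝ} {s t : Matrix (Fin N) (Fin N) ℝ} {H : Ω → Matrix (Fin N) (Fin N) ℝ}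

/-- The entries of `H` follow a finite sparse model whose variances are close to `t`. -/
def HasSparseModel (μ : Measure Ω) (q C : ℝ) (t : Matrix (Fin N) (Fin N) ℝ)
    (H : Ω → Matrix (Fin N) (Fin N) ℝ) : Prop :=
  ∃ (V : Type) (_ : Fintype V) (w val : UpperIndex N → V → ℝ),
    (∀ e, Function.Injective (val e)) ∧
    (∀ e v, μ.real {ω | H ω e.1.1 e.1.2 = val e v} = w e v) ∧
    IsSparseModel w val (1 / √q) C ∧
    ∀ i j, |modelVariance w val i j - t i j| ≤ C ^ 2 * (1 / √q) / N

lemma IsSymmIndep.setOf_eq_comm (hH : IsSymmIndep μ H) (i j : Fin N) (a : ℝ) :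
    {ω | H ω i j = a} = {ω | H ω j i = a} := by
  ext ω
  simp [hH.symm ω i j]

lemma IsUnbiasedSparse.symm_variance (hH : IsUnbiasedSparse μ q s H) (hq : 0 < q) (i j : Fin N) :
    s i j = s j i := by
  have h1 := hH.prob_pos i j
  rw [hH.toIsSymmIndep.setOf_eq_comm, hH.prob_pos j i] at h1
  have : q * (s j i - s i j) = 0 := by linarith
  rcases mul_eq_zero.1 this with h | h
  · exact absurd h hq.ne'
  · linarith

/-- Symmetry of `s` is forced by that of `H`: otherwise one entry would have two different values,
each of probability above `1/2`. -/
lemma IsBiasedSparse.symm_variance [IsProbabilityMeasure μ] (hH : IsBiasedSparse μ q s H) (hq : 0 < q)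
    (hs : ∀ i j, q * s i j < 1 / 2) (i j : Fin N) : s i j = s j i := by
  by_contra hne
  have hqs : 0 < √q := Real.sqrt_pos.2 hq
  have h1 := hH.prob_zero i j
  have h2 := hH.prob_zero j i
  rw [hH.toIsSymmIndep.setOf_eq_comm] at h2
  have hdisj : Disjoint {ω | H ω i j = 0 - √q * s i j} {ω | H ω i j = 0 - √q * s j i} := by
    refine Set.disjoint_left.2 fun ω h3 h4 => hne ?_
    have h5 : √q * (s i j - s j i) = 0 := by
      have : 0 - √q * s i j = 0 - √q * s j i := h3.symm.trans h4
      linarith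
    rcases mul_eq_zero.1 h5 with h | h
    · exact absurd h hqs.ne'
    · linarith
  have h3 := measureReal_union (μ := μ) hdisj
    (hH.measurable_entry i j (measurableSet_singleton (0 - √q * s j i)))
  have h4 : μ.real ({ω | H ω i j = 0 - √q * s i j} ∪ {ω | H ω i j = 0 - √q * s j i}) ≤ 1 :=
    measureReal_le_one
  rw [h3, h1, h2] at h4
  linarith [hs i j, hs j i]

lemma apply_upperIndex_of_symm (h : ∀ i j, s i j = s j i) (i j : Fin N) :
    s (upperIndex i j).1.1 (upperIndex i j).1.2 = s i j := by
  rcases le_total i j with hij | hij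
  · simp [upperIndex, hij]
  · simp [upperIndex, hij, h i j]

lemma IsUnbiasedSparse.hasSparseModel (hH : IsUnbiasedSparse μ q s H) (hq : 0 < q)
    (hs : ∀ i j, s i j ≤ C / N) : HasSparseModel μ q C s H := by
  have hqs : 0 < √q := Real.sqrt_pos.2 hq
  have hsq : √q ^ 2 = q := Real.sq_sqrt hq.le
  have hpos : 0 < 1 / √q := by positivity
  have hinv : q * (1 / √q) ^ 2 = 1 := by rw [div_pow, hsq]; field_simp
  have hw : ∀ (e : UpperIndex N) (v : Fin 3),
      μ.real {ω | H ω e.1.1 e.1.2 = (![1 / √q, -(1 / √q), 0] : Fin 3 → ℝ) v} =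
      (![q * s e.1.1 e.1.2 / 2, q * s e.1.1 e.1.2 / 2, 1 - q * s e.1.1 e.1.2] : Fin 3 → ℝ) v := by
    intro e v
    fin_cases v
    · exact hH.prob_pos _ _
    · exact hH.prob_neg _ _
    · exact hH.prob_zero _ _
  have hvar : ∀ e : UpperIndex N, ∑ v, (![q * s e.1.1 e.1.2 / 2, q * s e.1.1 e.1.2 / 2,
      1 - q * s e.1.1 e.1.2] : Fin 3 → ℝ) v * (![1 / √q, -(1 / √q), 0] : Fin 3 → ℝ) v ^ 2 =
      s e.1.1 e.1.2 := by
    intro e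
    simp only [Fin.sum_univ_three, Matrix.cons_val]
    linear_combination (s e.1.1 e.1.2) * hinv
  refine ⟨Fin 3, inferInstance, fun e => ![q * s e.1.1 e.1.2 / 2, q * s e.1.1 e.1.2 / 2,
    1 - q * s e.1.1 e.1.2], fun _ => ![1 / √q, -(1 / √q), 0], fun e => ?_, hw,
    ⟨fun e v => ?_, fun e => ?_, fun e => ?_, fun e v => ?_, fun e => ?_⟩, fun i j => ?_⟩
  · intro u v huv
    fin_cases u <;> fin_cases v <;> simp at huv ⊢ <;> linarith [inv_pos.2 hqs]
  · rw [← hw]; exact measureReal_nonneg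
  · simp only [Fin.sum_univ_three, Matrix.cons_val]; ring
  · simp only [Fin.sum_univ_three, Matrix.cons_val]; ring
  · fin_cases v <;> simp [abs_of_pos hqs]
  · rw [hvar]; exact hs _ _
  · have h1 : modelVariance (fun e : UpperIndex N => ![q * s e.1.1 e.1.2 / 2,
        q * s e.1.1 e.1.2 / 2, 1 - q * s e.1.1 e.1.2])
        (fun _ => (![1 / √q, -(1 / √q), 0] : Fin 3 → ℝ)) i j = s i j :=
      (hvar _).trans (apply_upperIndex_of_symm (hH.symm_variance hq) i j)
    rw [h1, sub_self, abs_zero]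
    positivity

lemma IsBiasedSparse.hasSparseModel [IsProbabilityMeasure μ] (hH : IsBiasedSparse μ q s H) (hq : 0 < q)
    (hs : ∀ i j, s i j ∈ Icc 0 (C / N)) (hqs' : ∀ i j, q * s i j < 1 / 2)
    (ht : ∀ i j, |s i j * (1 - q * s i j) - t i j| ≤ C ^ 2 * (1 / √q) / N) :
    HasSparseModel μ q C t H := by
  have hqs : 0 < √q := Real.sqrt_pos.2 hq
  have hsq : √q ^ 2 = q := Real.sq_sqrt hq.le
  have hpos : 0 < 1 / √q := by positivity
  have hmul : 1 / √q * √q = 1 := by field_simp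
  have hw : ∀ (e : UpperIndex N) (v : Fin 2),
      μ.real {ω | H ω e.1.1 e.1.2 =
        (![1 / √q - √q * s e.1.1 e.1.2, 0 - √q * s e.1.1 e.1.2] : Fin 2 → ℝ) v} =
      (![q * s e.1.1 e.1.2, 1 - q * s e.1.1 e.1.2] : Fin 2 → ℝ) v := by
    intro e v
    fin_cases v
    · exact hH.prob_one _ _
    · exact hH.prob_zero _ _
  have hvar : ∀ e : UpperIndex N, ∑ v, (![q * s e.1.1 e.1.2, 1 - q * s e.1.1 e.1.2] :
      Fin 2 → ℝ) v * (![1 / √q - √q * s e.1.1 e.1.2, 0 - √q * s e.1.1 e.1.2] : Fin 2 → ℝ) v ^ 2 =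
      s e.1.1 e.1.2 * (1 - q * s e.1.1 e.1.2) := by
    intro e
    simp only [Fin.sum_univ_two, Matrix.cons_val]
    have hinv : q * (1 / √q) ^ 2 = 1 := by rw [div_pow, hsq]; field_simp
    linear_combination (s e.1.1 e.1.2) * hinv - 2 * q * (s e.1.1 e.1.2) ^ 2 * hmul +
      (s e.1.1 e.1.2) ^ 2 * hsq
  refine ⟨Fin 2, inferInstance, fun e => ![q * s e.1.1 e.1.2, 1 - q * s e.1.1 e.1.2],
    fun e => ![1 / √q - √q * s e.1.1 e.1.2, 0 - √q * s e.1.1 e.1.2], fun e => ?_, hw,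
    ⟨fun e v => ?_, fun e => ?_, fun e => ?_, fun e v => ?_, fun e => ?_⟩, fun i j => ?_⟩
  · intro u v huv
    fin_cases u <;> fin_cases v <;> simp at huv ⊢
    · exact hqs.ne' huv
    · linarith [inv_pos.2 hqs]
  · rw [← hw]; exact measureReal_nonneg
  · simp only [Fin.sum_univ_two, Matrix.cons_val]; ring
  · simp only [Fin.sum_univ_two, Matrix.cons_val]
    have hinv : q * (1 / √q) = √q := by
      rw [mul_one_div, div_eq_iff hqs.ne', ← sq, hsq]
    linear_combination (s e.1.1 e.1.2) * hinv
  · have h0 := (hs e.1.1 e.1.2).1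
    have h1 : √q * s e.1.1 e.1.2 ≤ 1 / √q := by
      rw [le_div_iff₀ hqs]
      nlinarith [hqs' e.1.1 e.1.2]
    have h2 : 0 ≤ √q * s e.1.1 e.1.2 := by positivity
    fin_cases v
    · exact abs_le.2 ⟨by simp only [Fin.zero_eta, Matrix.cons_val]; linarith,
        by simp only [Fin.zero_eta, Matrix.cons_val]; linarith⟩
    · exact abs_le.2 ⟨by simp only [Fin.mk_one, Matrix.cons_val]; linarith,
        by simp only [Fin.mk_one, Matrix.cons_val]; linarith⟩
  · rw [hvar]
    refine le_trans ?_ (hs e.1.1 e.1.2).2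
    have h0 := (hs e.1.1 e.1.2).1
    exact mul_le_of_le_one_right h0 (by have := mul_nonneg hq.le h0; linarith)
  · have h1 : modelVariance (fun e : UpperIndex N => ![q * s e.1.1 e.1.2, 1 - q * s e.1.1 e.1.2])
        (fun e => (![1 / √q - √q * s e.1.1 e.1.2, 0 - √q * s e.1.1 e.1.2] : Fin 2 → ℝ)) i j =
        s i j * (1 - q * s i j) := by
      refine (hvar _).trans ?_
      rw [apply_upperIndex_of_symm (hH.symm_variance hq hqs') i j]
    rw [h1]
    exact ht i j

end Models

/-! ### Uniform constants and large-size asymptotics -/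

section Asymptotics

lemma exists_isBoundedSolution {τ C m R : ℝ} (hτ : 0 < τ) (hC : 0 < C) (hm : 0 < m) (hR : 0 < R) :
    ∃ a b : ℝ, 0 < a ∧ 0 < b ∧ ∀ (N : ℕ) (t : Matrix (Fin N) (Fin N) ℝ) (z : ℂ) (g : Fin N → ℂ),
      (∀ i j, t i j ∈ Icc (τ / N) (C / N)) → 0 < z.im → ‖z‖ ≤ R → SolvesVectorQVE t z g →
      (1 ≤ z.im ∨ m ≤ (1 / N : ℝ) * ∑ j, (g j).im) → IsBoundedSolution a b g := by
  have hy : 0 < min 1 (τ * m) := lt_min one_pos (mul_pos hτ hm)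
  refine ⟨_, _, ?_, ?_, fun N t z g ht hz0 hz h hcase =>
    h.isBoundedSolution hτ hC hm hR ht hz0 hz hcase⟩
  · exact lt_min (by positivity) (by positivity)
  · positivity

/-- The lower constant `c/2` absorbs the factor `1 - q s_ij`. Taking `t = s` in the biased case
costs `q s_ij²`, which is within `C² q^(-1/2)/N` exactly when `q^(3/2) ≤ N` is available; `small`
stands for `κ ≤ 2/3`. -/
lemma hasSparseModel_of_ensemble {N : ℕ} {Ω : Type*} [MeasurableSpace Ω] {μ : Measure Ω}
    [IsProbabilityMeasure μ] {q c C : ℝ} {s t : Matrix (Fin N) (Fin N) ℝ}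
    {H : Ω → Matrix (Fin N) (Fin N) ℝ} {small : Prop} (hq : 0 < q) (hc : 0 < c)
    (hs : ∀ i j, s i j ∈ Icc (c / N) (C / N)) (hqC : q * (C / N) ≤ 1 / 4)
    (hsmall : small → q * √q ≤ N)
    (hH : (IsUnbiasedSparse μ q s H ∧ t = s) ∨ (IsBiasedSparse μ q s H ∧
      (t = biasedVariance q s ∨ (small ∧ t = s)))) :
    IsSymmIndep μ H ∧ HasSparseModel μ q C t H ∧ ∀ i j, t i j ∈ Icc (c / 2 / N) (C / N) := by
  have hs0 : ∀ i j, 0 < s i j := fun i j =>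
    lt_of_lt_of_le (div_pos hc (by exact_mod_cast i.pos)) (hs i j).1
  have hqs : ∀ i j, q * s i j ≤ 1 / 4 := fun i j =>
    (mul_le_mul_of_nonneg_left (hs i j).2 hq.le).trans hqC
  have hhalf : c / 2 / N ≤ c / N := by
    gcongr
    linarith
  have hst : ∀ i j, s i j ∈ Icc (c / 2 / N) (C / N) := fun i j => ⟨hhalf.trans (hs i j).1, (hs i j).2⟩
  have hqs2 : ∀ i j, q * s i j < 1 / 2 := fun i j => (hqs i j).trans_lt (by norm_num)
  rcases hH with ⟨hH, rfl⟩ | ⟨hH, ht⟩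
  · exact ⟨hH.toIsSymmIndep, hH.hasSparseModel hq fun i j => (hs i j).2, hst⟩
  · have hmodel := fun t => hH.hasSparseModel (t := t) hq
      (fun i j => ⟨(hs0 i j).le, (hs i j).2⟩) hqs2
    refine ⟨hH.toIsSymmIndep, ?_⟩
    rcases ht with rfl | ⟨hsm, rfl⟩
    · refine ⟨hmodel _ fun i j => ?_, fun i j => ?_⟩
      · simp only [biasedVariance, Matrix.of_apply, sub_self, abs_zero]
        positivity
      · have h1 := hs0 i j
        have h2 := hqs i j
        have h3 : 0 < q * s i j := mul_pos hq h1
        have h4 : c / 2 / N = c / N * (1 / 2) := by ring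
        refine ⟨?_, ?_⟩
        · rw [h4]
          exact mul_le_mul (hs i j).1 (by linarith) (by norm_num) h1.le
        · exact (mul_le_of_le_one_right h1.le (by linarith)).trans (hs i j).2
    · refine ⟨hmodel _ fun i j => ?_, hst⟩
      have hN : (0 : ℝ) < N := by exact_mod_cast i.pos
      have hqs0 : 0 < √q := Real.sqrt_pos.2 hq
      have h1 : t i j * (1 - q * t i j) - t i j = -(q * t i j ^ 2) := by ring
      have h2 : 0 ≤ q * t i j ^ 2 := by positivity
      rw [h1, abs_neg, abs_of_nonneg h2]
      calc q * t i j ^ 2 ≤ q * (C / N) ^ 2 :=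
            mul_le_mul_of_nonneg_left (pow_le_pow_left₀ (hs0 i j).le (hs i j).2 2) hq.le
        _ = C ^ 2 * (1 / √q) / N * (q * √q / N) := by field_simp
        _ ≤ C ^ 2 * (1 / √q) / N := mul_le_of_le_one_right (by positivity)
            ((div_le_one hN).2 (hsmall hsm))

/-- The local law at a fixed spectral parameter. -/
lemma HasSparseModel.measure_lambdaMax_gt_le {N : ℕ} {Ω : Type*} [MeasurableSpace Ω]
    {μ : Measure Ω} [IsProbabilityMeasure μ] {H : Ω → Matrix (Fin N) (Fin N) ℝ}
    (hH : IsSymmIndep μ H) {t : Matrix (Fin N) (Fin N) ℝ} {q τ C a b c₀ θ η₀ : ℝ} {z : ℂ}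
    (hmodel : HasSparseModel μ q C t H) (hτ : 0 < τ)
    (hC : 1 ≤ C) (ha : 0 < a) (hb : 0 < b)
    (hc₀ : stabilityConstant τ C a b * (b * C * c₀) ≤ 1 / 2)
    (hc₀0 : 0 < c₀) (hc₀a : c₀ ≤ a / 2) (hc₀1 : c₀ ≤ 1) (hθ : 1 ≤ θ)
    (hN : 0 < N) (hq : 1 ≤ q) (hqN : q ≤ N) (hz : 0 < z.im)
    (hη₀ : z.im ≤ η₀) (hη₀1 : 1 ≤ η₀) (hη₀C : (1 / η₀) ^ 2 * C ≤ 1 / 2)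
    (ht : ∀ i j, t i j ∈ Icc (τ / N) (C / N)) {g : ℂ → ℝ → ℂ} (hsol : SolvesQVE t g)
    (hg : ∀ y : ℝ, 0 < y → y ≤ η₀ → IsBoundedSolution a b
      fun i : Fin N => g (z.re + y * Complex.I) (((i : ℝ) + 1) / N))
    {n : ℕ} (hn : 0 < n)
    (hstep : η₀ / n * (1 / z.im * (1 / z.im)) + b * (η₀ / n / z.im) ≤ c₀ / 2)
    (hsmall : localLawConstant τ C a b c₀ * θ ^ 2 * controlPhi q N z ≤ c₀ / 2)
    {B : ℝ} (hB : localLawConstant τ C a b c₀ * θ ^ 2 ≤ B) :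
    μ {ω | |lambdaMax (H ω) g z| > B * controlPhi q N z} ≤
      ENNReal.ofReal ((n + 1) * (8 * N * (N + 1) * Real.exp (1 - θ))) := by
  obtain ⟨V, _, w, val, hval, hw, hm, hvar⟩ := hmodel
  have hN' : (0 : ℝ) < N := by exact_mod_cast hN
  have hsq : 1 ≤ √q := Real.one_le_sqrt.2 hq
  have hM1 : 1 / √q ≤ 1 := (div_le_one (by linarith)).2 hsq
  have hM0 : 0 < 1 / √q := by positivity
  have hnη : 0 < √((N : ℝ) * z.im) := Real.sqrt_pos.2 (by positivity)
  have hMΦ : 1 / √q ≤ controlPhi q N z := le_add_of_nonneg_right (by positivity)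
  have hΦ : 0 < controlPhi q N z := hM0.trans_le hMΦ
  have hA : 0 ≤ localLawConstant τ C a b c₀ := by
    have := stabilityConstant_pos hτ (by linarith : 0 < C) ha hb
    unfold localLawConstant
    positivity
  have hNΦ : 1 / (N : ℝ) ≤ controlPhi q N z := by
    refine le_trans (one_div_le_one_div_of_le (by positivity) ?_) hMΦ
    exact (Real.sqrt_le_iff.2 ⟨by linarith, by nlinarith⟩).trans hqN
  have hηΦ : 1 / (N * z.im) ≤ controlPhi q N z ^ 2 := by
    calc 1 / (N * z.im) = (1 / √((N : ℝ) * z.im)) ^ 2 := by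
          rw [div_pow, Real.sq_sqrt (by positivity), one_pow]
      _ ≤ _ := pow_le_pow_left₀ (by positivity) (le_add_of_nonneg_left hM0.le) 2
  have hprob := hm.prob_not_isCloseToDiag_le (E := z.re) (η := z.im) hτ hC ha hb hc₀ hc₀0 hc₀a hc₀1
    hθ hΦ hM0.le hM1 hMΦ hNΦ hηΦ (mul_le_mul_of_nonneg_left hMΦ (sq_nonneg C)) hz hη₀ hη₀1 hη₀C ht
    hvar (g := fun z i => g z (((i : ℝ) + 1) / N))
    (fun y hy => hsol.solvesVectorQVE (by simpa using hy)) hg hn hstep hsmall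
  rw [Complex.re_add_im] at hprob
  refine le_trans (measure_mono fun ω hω => ?_) ((measure_le_prob_configMatrix hH hval hw hm.sum_one
    (fun H => ¬ IsCloseToDiag H z (fun i : Fin N => g z (((i : ℝ) + 1) / N))
      (localLawConstant τ C a b c₀ * θ ^ 2 * controlPhi q N z))).trans
    (ENNReal.ofReal_le_ofReal hprob))
  intro hclose
  refine absurd (hclose.lambdaMax_le (by positivity)) (not_le.2 (lt_of_le_of_lt ?_ hω))
  exact mul_le_mul_of_nonneg_right hB hΦ.le

lemma eventually_le_rpow {e : ℝ} (he : 0 < e) (A : ℝ) : ∀ᶠ N : ℕ in atTop, A ≤ (N : ℝ) ^ e :=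
  ((tendsto_rpow_atTop he).comp tendsto_natCast_atTop_atTop).eventually_ge_atTop A

lemma eventually_rpow_mul_exp_neg_le_one {e : ℝ} (he : 0 < e) (p : ℝ) :
    ∀ᶠ N : ℕ in atTop, (N : ℝ) ^ p * Real.exp (-(N : ℝ) ^ e) ≤ 1 := by
  have h1 : Tendsto (fun N : ℕ => ((N : ℝ) ^ e) ^ (p / e) * Real.exp (-1 * (N : ℝ) ^ e)) atTop
      (nhds 0) :=
    (tendsto_rpow_mul_exp_neg_mul_atTop_nhds_zero (p / e) 1 one_pos).comp
      ((tendsto_rpow_atTop he).comp tendsto_natCast_atTop_atTop)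
  filter_upwards [h1.eventually_le_const one_pos] with N hN
  rwa [← Real.rpow_mul (Nat.cast_nonneg N), mul_div_cancel₀ _ he.ne', neg_one_mul] at hN

/-- About `N³` grid points times `N²` row events give `96 N⁵ e^(-u)`; a sixth power of `N` pays for
the constant. -/
lemma failure_bound {N : ℕ} {u D : ℝ} (hN : 100 ≤ (N : ℝ))
    (h : (N : ℝ) ^ (6 + D) * Real.exp (-u) ≤ 1) :
    ((N ^ 3 : ℕ) + 1 : ℝ) * (8 * N * (N + 1) * Real.exp (1 - u)) ≤ (N : ℝ) ^ (-D) := by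
  have hN0 : (0 : ℝ) < N := by linarith
  have h1 : Real.exp (1 - u) ≤ 3 * Real.exp (-u) := by
    rw [sub_eq_add_neg, Real.exp_add]
    exact mul_le_mul_of_nonneg_right (by linarith [Real.exp_one_lt_d9]) (Real.exp_pos _).le
  have h2 : (N : ℝ) ^ (6 + D) = (N : ℝ) ^ 6 * (N : ℝ) ^ D := by
    rw [Real.rpow_add hN0]
    norm_cast
  have h3 : (1 : ℝ) ≤ (N : ℝ) ^ 3 := one_le_pow₀ (by linarith)
  have h4 : (N : ℝ) ^ 6 * Real.exp (-u) ≤ (N : ℝ) ^ (-D) := by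
    rw [Real.rpow_neg hN0.le, ← one_div, le_div_iff₀ (by positivity)]
    rw [h2] at h
    linarith
  refine le_trans ?_ h4
  push_cast
  calc ((N : ℝ) ^ 3 + 1) * (8 * N * (N + 1) * Real.exp (1 - u))
      ≤ (2 * (N : ℝ) ^ 3) * (8 * N * (2 * N) * (3 * Real.exp (-u))) := by
        gcongr
        · linarith
        · linarith
    _ = 96 * ((N : ℝ) ^ 5 * Real.exp (-u)) := by ring
    _ ≤ N * ((N : ℝ) ^ 5 * Real.exp (-u)) :=
        mul_le_mul_of_nonneg_right (by linarith) (by positivity)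
    _ = _ := by ring

/-- A grid of `N³` steps beats the Lipschitz constant, of order `η⁻² ≤ N²`. -/
lemma step_bound {N : ℕ} {η₀ b c₀ η : ℝ} (hN : 1 ≤ (N : ℝ)) (hη₀ : 0 ≤ η₀) (hb : 0 ≤ b)
    (hc₀ : 0 < c₀) (hη : 0 < η) (hinv : 1 / η ≤ N) (h : 2 * (η₀ * (1 + b)) / c₀ ≤ N) :
    η₀ / (N ^ 3 : ℕ) * (1 / η * (1 / η)) + b * (η₀ / (N ^ 3 : ℕ) / η) ≤ c₀ / 2 := by
  have hN0 : (0 : ℝ) < N := by linarith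
  have hNN : (N : ℝ) ≤ N * N := by nlinarith
  push_cast
  rw [div_le_iff₀ hc₀] at h
  have h2 : 0 ≤ 1 / η := by positivity
  calc η₀ / (N : ℝ) ^ 3 * (1 / η * (1 / η)) + b * (η₀ / (N : ℝ) ^ 3 / η)
      = η₀ / (N : ℝ) ^ 3 * ((1 / η * (1 / η)) + b * (1 / η)) := by ring
    _ ≤ η₀ / (N : ℝ) ^ 3 * ((N : ℝ) * N + b * (N * N)) := by
        refine mul_le_mul_of_nonneg_left (add_le_add ?_ ?_) (by positivity)
        · exact mul_le_mul hinv hinv h2 hN0.le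
        · exact mul_le_mul_of_nonneg_left (hinv.trans hNN) hb
    _ = η₀ * (1 + b) / N := by field_simp
    _ ≤ c₀ / 2 := by
        rw [div_le_iff₀ hN0]
        linarith

lemma SolvesQVE.isBoundedSolution_of_bulk {N : ℕ} (hN : 0 < N) {t : Matrix (Fin N) (Fin N) ℝ}
    {g : ℂ → ℝ → ℂ} (hsol : SolvesQVE t g) {I : Set ℝ} {R cI η₀ a b : ℝ}
    (hR : ∀ x ∈ I, ‖x‖ ≤ R)
    (hIm : ∀ z : ℂ, z.re ∈ I → 0 < z.im → z.im ≤ 1 → cI < (qveMean g z).im)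
    (hab : ∀ (z : ℂ) (g : Fin N → ℂ), 0 < z.im → ‖z‖ ≤ |R| + η₀ → SolvesVectorQVE t z g →
      (1 ≤ z.im ∨ cI ≤ (1 / N : ℝ) * ∑ j, (g j).im) → IsBoundedSolution a b g)
    {E : ℝ} (hE : E ∈ I) (y : ℝ) (hy : 0 < y) (hyη : y ≤ η₀) :
    IsBoundedSolution a b fun i : Fin N => g (E + y * Complex.I) (((i : ℝ) + 1) / N) := by
  have him : ((E : ℂ) + y * Complex.I).im = y := by simp
  have him0 : 0 < ((E : ℂ) + y * Complex.I).im := by rw [him]; exact hy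
  refine hab _ _ him0 ?_ (hsol.solvesVectorQVE him0) ?_
  · refine (norm_add_le _ _).trans (add_le_add ?_ ?_)
    · rw [Complex.norm_real]
      exact (hR _ hE).trans (le_abs_self R)
    · rw [norm_mul, Complex.norm_I, mul_one, Complex.norm_real, Real.norm_of_nonneg hy.le]
      exact hyη
  · rcases le_total 1 y with h1 | h1
    · left
      rwa [him]
    · right
      have h2 := hIm ((E : ℂ) + y * Complex.I) (by simpa using hE) him0 (by rwa [him])
      rw [hsol.qveMean_eq hN him0] at h2
      refine h2.le.trans_eq ?_
      rw [show (1 / N : ℂ) = ((1 / N : ℝ) : ℂ) by push_cast; rfl, Complex.im_ofReal_mul,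
        Complex.im_sum]

lemma one_div_sqrt_rpow_le {N : ℕ} {e p x : ℝ} (hN : 1 ≤ (N : ℝ)) (he : 8 * e ≤ p)
    (hx : (N : ℝ) ^ p ≤ x) : 1 / √x ≤ 1 / ((N : ℝ) ^ e) ^ 4 := by
  have hN0 : (0 : ℝ) < N := by linarith
  refine one_div_le_one_div_of_le (by positivity) (Real.le_sqrt_of_sq_le (le_trans ?_ hx))
  rw [← pow_mul, ← Real.rpow_mul_natCast hN0.le]
  refine Real.rpow_le_rpow_of_exponent_le hN ?_
  push_cast
  linarith

end Asymptotics

end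

/-! ### Choice of constants and conclusion -/

theorem theoremB1
    (κ : ℝ) (hκ0 : 0 < κ) (hκ1 : κ < 1) (c C : ℝ) (hc : 0 < c) (hC : 0 < C)
    {Ω : ℕ → Type*} [∀ N, MeasurableSpace (Ω N)]
    (μ : ∀ N, Measure (Ω N)) [∀ N, IsProbabilityMeasure (μ N)]
    (H : ∀ N, Ω N → Matrix (Fin N) (Fin N) ℝ)
    (s t : ∀ N, Matrix (Fin N) (Fin N) ℝ)
    (hs : ∀ᶠ N : ℕ in atTop, ∀ i j, s N i j ∈ Set.Icc (c / N) (C / N))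
    (hH : ∀ᶠ N : ℕ in atTop,
      (IsUnbiasedSparse (μ N) ((N : ℝ) ^ κ) (s N) (H N) ∧ t N = s N) ∨
      (IsBiasedSparse (μ N) ((N : ℝ) ^ κ) (s N) (H N) ∧
        (t N = biasedVariance ((N : ℝ) ^ κ) (s N) ∨ (κ ≤ 2 / 3 ∧ t N = s N))))
    (g : ℕ → ℂ → ℝ → ℂ)
    (hg : ∀ᶠ N : ℕ in atTop, SolvesQVE (t N) (g N))
    (I : Set ℝ) (hI : IsBulkInterval (fun N => qveMean (g N)) I)
    (δ : ℝ) (hδ : 0 < δ) :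
    StochDom μ (spectralDomain I δ)
      (fun N z ω => lambdaMax (H N ω) (g N) z)
      (fun N z _ => controlPhi ((N : ℝ) ^ κ) N z) := by
  intro ε hε D hD
  obtain ⟨-, hbd, cI, hcI, hIm⟩ := hI
  obtain ⟨R, hR⟩ := hbd.exists_norm_le
  obtain ⟨C₁, hC₁, hCC₁⟩ : ∃ C₁ : ℝ, 1 ≤ C₁ ∧ C ≤ C₁ := ⟨max C 1, le_max_right _ _, le_max_left _ _⟩
  have hC₁0 : 0 < C₁ := by linarith
  -- The starting height must lie above the spectral domain (`10`) and be large enough for the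
  -- initial contraction (`2 C₁`).
  obtain ⟨η₀, hη₀⟩ : ∃ η₀ : ℝ, η₀ = 10 + 2 * C₁ := ⟨_, rfl⟩
  have hη₀0 : 0 < η₀ := by linarith
  have hη₀C : (1 / η₀) ^ 2 * C₁ ≤ 1 / 2 := by
    rw [div_pow, one_pow, one_div_mul_eq_div, div_le_iff₀ (by positivity)]
    nlinarith
  have hτ : 0 < c / 2 := by linarith
  obtain ⟨a, b, ha, hb, hab⟩ := exists_isBoundedSolution hτ hC₁0 hcI
    (R := |R| + η₀) (by positivity)
  have hS := stabilityConstant_pos hτ hC₁0 ha hb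
  obtain ⟨c₀, hc₀0, hc₀a, hc₀1, hc₀⟩ : ∃ c₀ : ℝ, 0 < c₀ ∧ c₀ ≤ a / 2 ∧ c₀ ≤ 1 ∧
      stabilityConstant (c / 2) C₁ a b * (b * C₁ * c₀) ≤ 1 / 2 := by
    refine ⟨min (a / 2) (min 1 (1 / (2 * (stabilityConstant (c / 2) C₁ a b * (b * C₁))))),
      lt_min (by positivity) (lt_min one_pos (by positivity)), min_le_left _ _,
      (min_le_right _ _).trans (min_le_left _ _), ?_⟩
    have h1 : min (a / 2) (min 1 (1 / (2 * (stabilityConstant (c / 2) C₁ a b * (b * C₁))))) ≤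
        1 / (2 * (stabilityConstant (c / 2) C₁ a b * (b * C₁))) :=
      (min_le_right _ _).trans (min_le_right _ _)
    rw [le_div_iff₀ (by positivity)] at h1
    linarith
  obtain ⟨A, hA⟩ : ∃ A, A = localLawConstant (c / 2) C₁ a b c₀ := ⟨_, rfl⟩
  have hA0 : 0 < A := by
    have := one_le_resolventBound ha hb
    rw [hA, localLawConstant]
    positivity
  -- With `u = N^e` as deviation parameter, `A u² ≤ u³ ≤ N^ε` and `Φ ≤ 2 u⁻⁴`. Thus `A u² Φ` is of
  -- order `u⁻²`, below `c₀/2` for large `N`.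
  obtain ⟨e, he, heε, heκ, heδ⟩ : ∃ e : ℝ, 0 < e ∧ 8 * e ≤ ε ∧ 8 * e ≤ κ ∧ 8 * e ≤ δ := by
    refine ⟨min ε (min κ δ) / 8, by have := lt_min hε (lt_min hκ0 hδ); linarith, ?_, ?_, ?_⟩
    · linarith [min_le_left ε (min κ δ)]
    · linarith [(min_le_right ε (min κ δ)).trans (min_le_left _ _)]
    · linarith [(min_le_right ε (min κ δ)).trans (min_le_right _ _)]
  filter_upwards [hs, hH, hg, hIm, eventually_le_rpow he A, eventually_le_rpow he (4 * A / c₀),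
    eventually_le_rpow one_pos (max 100 (2 * (η₀ * (1 + b)) / c₀)),
    eventually_le_rpow (sub_pos.2 hκ1) (4 * C₁), eventually_rpow_mul_exp_neg_le_one he (6 + D)]
    with N hsN hHN hgN hImN hAN hAcN hNbig hκN hexp
  rw [Real.rpow_one] at hNbig
  have hN100 : (100 : ℝ) ≤ N := (le_max_left _ _).trans hNbig
  have hN1 : (1 : ℝ) ≤ N := by linarith
  have hN0 : (0 : ℝ) < N := by linarith
  have hNpos : 0 < N := by exact_mod_cast hN0
  set q := (N : ℝ) ^ κ with hq
  have hq1 : 1 ≤ q := Real.one_le_rpow hN1 hκ0.le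
  have hqN : q ≤ N := by
    simpa using Real.rpow_le_rpow_of_exponent_le hN1 hκ1.le
  have hqC : q * (C₁ / N) ≤ 1 / 4 := by
    have h1 : q * (N : ℝ) ^ (1 - κ) = N := by
      rw [hq, ← Real.rpow_add hN0, add_sub_cancel, Real.rpow_one]
    rw [mul_div_assoc', div_le_iff₀ hN0]
    nlinarith
  have hsmall : κ ≤ 2 / 3 → q * √q ≤ N := fun h => by
    rw [hq, Real.sqrt_eq_rpow, ← Real.rpow_mul hN0.le, ← Real.rpow_add hN0]
    simpa using Real.rpow_le_rpow_of_exponent_le hN1 (by linarith : κ + κ * (1 / 2) ≤ 1)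
  obtain ⟨hind, hmodel, htN⟩ := hasSparseModel_of_ensemble (by linarith) hc
    (fun i j => ⟨(hsN i j).1, (hsN i j).2.trans (by gcongr)⟩) hqC hsmall hHN
  set u := (N : ℝ) ^ e with hu
  have hu1 : 1 ≤ u := Real.one_le_rpow hN1 he.le
  have hu0 : 0 < u := by linarith
  have hB : A * u ^ 2 ≤ (N : ℝ) ^ ε := by
    calc A * u ^ 2 ≤ u * u ^ 2 := mul_le_mul_of_nonneg_right hAN (by positivity)
      _ = (N : ℝ) ^ (e * 3) := by
          rw [hu]
          have := Real.rpow_mul_natCast hN0.le e 3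
          push_cast at this
          rw [this]
          ring
      _ ≤ _ := Real.rpow_le_rpow_of_exponent_le hN1 (by linarith)
  -- The supremum stands outside the probability, so a bound at each fixed `z` with uniform
  -- constants suffices.
  refine iSup₂_le fun z hz => ?_
  obtain ⟨hzI, hzη, hz10⟩ := hz
  have hηN : 1 / (N : ℝ) ≤ z.im := by
    refine le_trans ?_ hzη
    rw [one_div, ← Real.rpow_neg_one]
    exact Real.rpow_le_rpow_of_exponent_le hN1 (by linarith)
  have hz0 : 0 < z.im := lt_of_lt_of_le (by positivity) hηN
  have hinvη : 1 / z.im ≤ N := by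
    rw [div_le_iff₀ hz0]
    rwa [div_le_iff₀ hN0, mul_comm] at hηN
  have hΦ : controlPhi q N z ≤ 2 / u ^ 4 := by
    have h1 : 1 / √q ≤ 1 / u ^ 4 := one_div_sqrt_rpow_le hN1 heκ le_rfl
    have h2 : 1 / √((N : ℝ) * z.im) ≤ 1 / u ^ 4 := by
      refine one_div_sqrt_rpow_le hN1 heδ ?_
      calc (N : ℝ) ^ δ = N * (N : ℝ) ^ (δ - 1) := by
            rw [← Real.rpow_one_add' hN0.le (by linarith), add_sub_cancel]
        _ ≤ _ := mul_le_mul_of_nonneg_left hzη hN0.le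
    calc controlPhi q N z ≤ 1 / u ^ 4 + 1 / u ^ 4 := add_le_add h1 h2
      _ = _ := by ring
  have hsmallΦ : A * u ^ 2 * controlPhi q N z ≤ c₀ / 2 := by
    rw [div_le_iff₀ hc₀0] at hAcN
    calc A * u ^ 2 * controlPhi q N z ≤ A * u ^ 2 * (2 / u ^ 4) :=
          mul_le_mul_of_nonneg_left hΦ (by positivity)
      _ = 2 * A / u ^ 2 := by field_simp
      _ ≤ c₀ / 2 := by
          rw [div_le_iff₀ (by positivity)]
          nlinarith [mul_pos hu0 hc₀0]
  have hstep := step_bound hN1 hη₀0.le hb.le hc₀0 hz0 hinvη ((le_max_right _ _).trans hNbig)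
  have hbound := hgN.isBoundedSolution_of_bulk (η₀ := η₀) hNpos hR hImN
    (fun z g h1 h2 h3 h4 => hab N (t N) z g htN h1 h2 h3 h4) hzI
  rw [hA] at hB hsmallΦ
  refine (hmodel.measure_lambdaMax_gt_le hind hτ hC₁ ha hb hc₀ hc₀0 hc₀a hc₀1 hu1 hNpos hq1 hqN hz0
    (by linarith) (by linarith) hη₀C htN hgN hbound (n := N ^ 3) (by positivity) hstep hsmallΦ
    hB).trans (ENNReal.ofReal_le_ofReal (failure_bound hN100 hexp))
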